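/- **Proposition.** Let $p\ge 1$. For $n\ge 1$, a $(p,2n)$-watermelon with wall condition is a family of $p$ lattice paths $(w_i(k))_{0\le k\le 2n}$, $1\le i\le p$, with $w_i(k)\in\mathbb Z$ and steps $w_i(k+1)-w_i(k)\in\{-1,1\}$, such that $w_i(0)=w_i(2n)=2i-2$ for all $i$, the paths do not touch each other ($w_1(k)<w_2(k)<\dots<w_p(k)$ for all $k$), and they do not cross the $x$-axis ($w_i(k)\ge 0$). Let $W^{(n)}$ be uniformly distributed on the finite set of $(p,2n)$-watermelons with wall condition and put $$X^{(n)}(t)=\frac1{\sqrt{2n}}\,W^{(n)}(\lfloor 2nt\rfloor)\in\mathbb R^p,\qquad t\in[0,1].$$ Let $H$ be a $(2p+1)\times(2p+1)$ Gaussian antisymmetric Hermitian random matrix, with law proportional to $e^{-\operatorname{tr}H^2}$: that is, $H=\sqrt{-1}\,A$ with $A$ real antisymmetric, whose entries above the diagonal are independent centred Gaussian variables of variance $1/4$. Let $\Lambda=(\lambda_1,\dots,\lambda_p)$ be the vector of the positive eigenvalues of $H$ (there are almost surely exactly $p$ of them) in increasing order. Then, for every fixed $t\in[0,1]$, $X^{(n)}(t)$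 converges in distribution to $2\sqrt{t(1-t)}\,\Lambda$ as $n\to\infty$. Moreover, for $0<t<1$ the law of $2\sqrt{t(1-t)}\,\Lambda$ has the density, with respect to Lebesgue measure on $\mathbb R^p$, $$f(t;x)=\frac{c_p}{(t(1-t))^{p^2+p/2}}\prod_{1\le i<j\le p}(x_j^2-x_i^2)^2\ \prod_{i=1}^p x_i^2\ \exp\Big(-\frac{\|x\|^2}{2t(1-t)}\Big)\,\mathbf 1_{0\le x_1\le\dots\le x_p},$$ where $\|\cdot\|$ is the Euclidean norm and $$c_p=\frac{2^{3p/2}\,p!}{(2p)!\,\pi^{p/2}\prod_{1\le i<j\le p}(j-i)(j+i-1)}.$$ -/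

import Mathlib

open MeasureTheory ProbabilityTheory Filter

namespace Watermelon

/-- The set of `p`-watermelons of length `N`, without deviation and with wall condition.
`w k i` is the position after `k` steps of the branch number `i + 1` (branches are indexed from
`0`): the `p` Bernoulli paths start and end at `0, 2, ..., 2p - 2`, have steps `1` or `-1`, do not
touch each other, and do not cross the `x` axis. -/
def watermelons (p N : ℕ) : Set (Fin (N + 1) → Fin p → ℤ) :=
  {w | (∀ i : Fin p, w 0 i = 2 * (i : ℤ)) ∧
    (∀ i : Fin p, w (Fin.last N) i = 2 * (i : ℤ)) ∧
    (∀ (k : Fin N) (i : Fin p),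
      w k.succ i - w k.castSucc i = 1 ∨ w k.succ i - w k.castSucc i = -1) ∧
    (∀ (k : Fin (N + 1)) (i j : Fin p), i < j → w k i < w k j) ∧
    (∀ (k : Fin (N + 1)) (i : Fin p), 0 ≤ w k i)}

theorem floor_time_lt (n : ℕ) (t : unitInterval) : ⌊2 * (n : ℝ) * (t : ℝ)⌋₊ < 2 * n + 1 := by
  have ht := t.2.2
  have hn : (0 : ℝ) ≤ 2 * (n : ℝ) := by positivity
  refine Nat.lt_succ_of_le (Nat.floor_le_of_le ?_)
  push_cast
  exact mul_le_of_le_one_right hn ht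

/-- The integer time `[2nt]`, for `t` in `[0, 1]`. -/
noncomputable def timeIndex (n : ℕ) (t : unitInterval) : Fin (2 * n + 1) :=
  ⟨⌊2 * (n : ℝ) * (t : ℝ)⌋₊, floor_time_lt n t⟩

/-- The renormalized path `X(t) = W([2nt]) / √(2n)` in Euclidean space `ℝ^p`
(it is only meaningful for `n ≥ 1`). -/
noncomputable def renormalize {p n : ℕ} (w : Fin (2 * n + 1) → Fin p → ℤ) (t : unitInterval) :
    EuclideanSpace ℝ (Fin p) :=
  WithLp.toLp 2 fun i => (w (timeIndex n t) i : ℝ) / √(2 * (n : ℝ))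

/-- `H` is a Gaussian antisymmetric Hermitian random matrix, with the normalization in which its
law is proportional to `exp (-tr H²)`. Such a matrix is `√(-1)` times a real antisymmetric matrix;
as `tr H² = 2 ∑_{i<j} (Im H_{ij})²`, this law means that the imaginary parts of the entries above
the diagonal are independent centred Gaussian variables of variance `1/4`. -/
structure IsGaussianAntisymmetricHermitian {Ω : Type*} [MeasurableSpace Ω] {N : ℕ}
    (H : Ω → Matrix (Fin N) (Fin N) ℂ) (μ : Measure Ω) : Prop where
  antisymmetric : ∀ ω, (H ω).transpose = -(H ω)
  hermitian : ∀ ω, (H ω).IsHermitian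
  indep : iIndepFun
    (fun (e : {e : Fin N × Fin N // e.1 < e.2}) (ω : Ω) => (H ω e.1.1 e.1.2).im) μ
  law : ∀ i j : Fin N, i < j → HasLaw (fun ω => (H ω i j).im) (gaussianReal 0 (1 / 4)) μ

/-- The positive eigenvalues, with multiplicity and in increasing order, of a matrix with real
eigenvalues. -/
noncomputable def positiveEigenvalues {N : ℕ} (M : Matrix (Fin N) (Fin N) ℂ) : List ℝ :=
  ((M.charpoly.roots.map Complex.re).filter (fun x => 0 < x)).sort (· ≤ ·)

/-- The vector of the `p` smallest positive eigenvalues of `M`, in increasing order. For a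
Gaussian antisymmetric Hermitian matrix of size `2p + 1` there are almost surely exactly `p`
positive eigenvalues; where there are fewer, the vector is completed with zeros. -/
noncomputable def positiveEigenvalueVector (p : ℕ) {N : ℕ} (M : Matrix (Fin N) (Fin N) ℂ) :
    EuclideanSpace ℝ (Fin p) :=
  WithLp.toLp 2 fun i => (positiveEigenvalues M).getD i 0

/-- `c_p = 2^{3p/2} p! / ((2p)! π^{p/2} ∏_{1 ≤ i < j ≤ p} (j - i)(j + i - 1))`; the indices in the
product below are shifted by one. -/
noncomputable def densityConst (p : ℕ) : ℝ :=
  (2 : ℝ) ^ (3 * (p : ℝ) / 2) * (p.factorial : ℝ) /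
    (((2 * p).factorial : ℝ) * Real.pi ^ ((p : ℝ) / 2) *
      ∏ i : Fin p, ∏ j ∈ Finset.Ioi i,
        (((j : ℕ) : ℝ) - ((i : ℕ) : ℝ)) * (((j : ℕ) : ℝ) + ((i : ℕ) : ℝ) + 1))

open Classical in
/-- The function `f(t; x)`, for `0 < t < 1`. -/
noncomputable def density (p : ℕ) (t : ℝ) (x : EuclideanSpace ℝ (Fin p)) : ℝ :=
  if (∀ i, 0 ≤ x i) ∧ (∀ i j, i ≤ j → x i ≤ x j) then
    densityConst p / (t * (1 - t)) ^ ((p : ℝ) ^ 2 + (p : ℝ) / 2) *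
      (∏ i : Fin p, ∏ j ∈ Finset.Ioi i, (x j ^ 2 - x i ^ 2) ^ 2) * (∏ i : Fin p, x i ^ 2) *
      Real.exp (-‖x‖ ^ 2 / (2 * t * (1 - t)))
  else 0

end Watermelon

/-!
The limit in distribution follows from a local limit theorem, once the limit density is known to
have total mass one; the total mass is obtained from the law of the eigenvalues, which has to be
computed anyway.

**Watermelons.** Given its position at a fixed time, the watermelon splits into two independent
families of nonintersecting walks above the wall, and each of them is counted by a Karlin–McGregor
determinant whose entries count single walks by the reflection principle (`card_watermelons_inter`).
From the starting point `0, 2, ..., 2p - 2` this determinant is a product of factorials, of the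
numbers `x j + 1`, and of a Vandermonde product in their squares (`starDet_eq_prod`). By Stirling's
formula, the probability that the watermelon is at a lattice point close to `√(2n) x`, times the
number of lattice points per unit volume, tends to `density p t x` (`tendsto_starDet_mul_div`,
`density_eq_limitDensity`). Fatou's lemma turns this into the lower bound for open sets in the
portmanteau theorem (`withDensity_le_liminf`), which suffices as soon as `density p t` is the
density of a probability measure. At the times `0` and `1` both sides are trivially zero in the
limit.

**Eigenvalues.** A Gaussian antisymmetric matrix is built column by column. If `A` is real
antisymmetric and `Aᵀ A` has the distinct eigenvalues `c k`, the matrix bordered by `v` has the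
characteristic polynomial `χ_A(s) s (1 + ∑ w k / (s ^ 2 + c k))`, where `w k` is the squared length
of the projection of `v` to the eigenspace of `c k` (`eval_charpoly_borderSkew_basis`). For Gaussian
`v` the weights `w k` are independent, with a law that depends only on the multiplicity, by rotation
invariance. The new squared eigenvalues `b` interlace with `c`, every positive `w` comes from
exactly one such `b`, and the Jacobian of `b ↦ w` is a quotient of Vandermonde products
(`lintegral_pos_eq_lintegral_interlaceSet`); moreover `∑ w = ∑ b - ∑ c`. This gives the conditional
law of `b` (`lintegral_borderSkew`). Integrating out `c` over the sequences that interlace `b` is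
the integral of a determinant column by column (`lintegral_vand_interlaceBox`,
`lintegral_vand_mul_interlaceBox`), and so the densities `evenWeight` and `oddWeight` alternate
along the induction on the size, with explicit constants (`HasSpectralDensity.odd`,
`HasSpectralDensity.even`, `oddNorm_eq`). The substitution `x = 2 √(t (1 - t)) √a` turns the density
for size `2p + 1` into `density p t` (`hasLaw_smul_positiveEigenvalueVector`).

The vector of the eigenvalues is measurable because the characteristic polynomial is a continuous
function of the entries, and the parametrization of such polynomials by increasing positive
sequences is continuous and injective, hence a measurable embedding by the Lusin–Souslin theorem.
-/

namespace Watermelon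

open scoped Topology ENNReal Matrix

/-! ### Counting nonintersecting walks above a wall -/

/-- The number of walks with `k` steps `±1` and total displacement `d`. -/
def walkCount : ℕ → ℤ → ℤ
  | 0, d => if d = 0 then 1 else 0
  | k + 1, d => walkCount k (d - 1) + walkCount k (d + 1)

/-- The number of walks from `y` to `x` in `k` steps that stay nonnegative, by reflection at `-1`.
It is extended to an odd function, with respect to that reflection, of `x` and of `y`. -/
def wallCount (k : ℕ) (y x : ℤ) : ℤ := walkCount k (x - y) - walkCount k (x + y + 2)

/-- The determinant that counts the families of nonintersecting walks above the wall, from `x` to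
`y` in `k` steps. -/
def starDet {p : ℕ} (k : ℕ) (x y : Fin p → ℤ) : ℤ :=
  (Matrix.of fun i j => wallCount k (x i) (y j)).det

/-- The possible positions of the `p` branches at a given time. -/
def InChamber {p : ℕ} (x : Fin p → ℤ) : Prop :=
  (∀ i j, i < j → x i < x j) ∧ ∀ i, 0 ≤ x i

/-- The initial position of a watermelon. -/
def startPoint (p : ℕ) : Fin p → ℤ := fun i => 2 * (i : ℤ)

/-- The families of `p` nonintersecting walks above the wall with `N` steps that go from `s` to `y`
and pass through `x` at time `k` (for `k > N` this last condition is void). -/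
def pinnedWalks {p : ℕ} (N k : ℕ) (s x y : Fin p → ℤ) : Set (Fin (N + 1) → Fin p → ℤ) :=
  {w | w 0 = s ∧
    (∀ (j : Fin N) (i : Fin p),
      w j.succ i - w j.castSucc i = 1 ∨ w j.succ i - w j.castSucc i = -1) ∧
    (∀ j, InChamber (w j)) ∧ (∀ j : Fin (N + 1), (j : ℕ) = k → w j = x) ∧ w (Fin.last N) = y}

/-- The increment vector coded by a family of signs. -/
def signStep {p : ℕ} (ε : Fin p → Bool) : Fin p → ℤ := fun i => if ε i then 1 else -1

lemma signStep_injective {p : ℕ} : Function.Injective (signStep (p := p)) := by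
  intro a b h
  funext i
  have := congrFun h i
  simp only [signStep] at this
  cases ha : a i <;> cases hb : b i <;> simp_all

lemma exists_signStep {p : ℕ} (d : Fin p → ℤ) (hd : ∀ i, d i = 1 ∨ d i = -1) :
    ∃ ε, signStep ε = d := by
  refine ⟨fun i => decide (d i = 1), funext fun i => ?_⟩
  rcases hd i with h | h <;> simp [signStep, h]

lemma signStep_eq {p : ℕ} (ε : Fin p → Bool) (i : Fin p) :
    signStep ε i = 1 ∨ signStep ε i = -1 := by
  by_cases h : ε i <;> simp [signStep, h]

lemma walkCount_neg (k : ℕ) (d : ℤ) : walkCount k (-d) = walkCount k d := by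
  induction k generalizing d with
  | zero => simp [walkCount]
  | succ k ih =>
    simp only [walkCount]
    rw [show -d - 1 = -(d + 1) by ring, show -d + 1 = -(d - 1) by ring, ih, ih, add_comm]

lemma wallCount_comm (k : ℕ) (y x : ℤ) : wallCount k y x = wallCount k x y := by
  unfold wallCount
  rw [← walkCount_neg k (x - y)]
  ring_nf

lemma wallCount_succ (k : ℕ) (y x : ℤ) :
    wallCount (k + 1) y x = wallCount k y (x - 1) + wallCount k y (x + 1) := by
  simp only [wallCount, walkCount]
  ring_nf

lemma wallCount_reflect (k : ℕ) (y x : ℤ) : wallCount k y (-2 - x) = -wallCount k y x := by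
  unfold wallCount
  rw [← walkCount_neg k (-2 - x - y), ← walkCount_neg k (-2 - x + y + 2)]
  ring_nf

lemma wallCount_neg_one (k : ℕ) (y : ℤ) : wallCount k y (-1) = 0 := by
  have := wallCount_reflect k y (-1)
  norm_num at this
  omega

lemma starDet_comm {p : ℕ} (k : ℕ) (x y : Fin p → ℤ) : starDet k x y = starDet k y x := by
  unfold starDet
  rw [← Matrix.det_transpose]
  congr 1
  ext i j
  simp [wallCount_comm k (x j)]

/-- In zero steps, only the identity permutation contributes, as both families of positions are
increasing and nonnegative. -/
lemma starDet_zero {p : ℕ} {x y : Fin p → ℤ} (hx : InChamber x) (hy : InChamber y) :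
    starDet 0 x y = if x = y then 1 else 0 := by
  have hent : ∀ i j, wallCount 0 (x i) (y j) = if x i = y j then 1 else 0 := by
    intro i j
    have h1 := hx.2 i
    have h2 := hy.2 j
    simp only [wallCount, walkCount]
    rw [if_neg (show ¬ y j + x i + 2 = 0 by omega)]
    by_cases h : x i = y j
    · simp [h]
    · rw [if_neg h, if_neg (by omega)]; simp
  unfold starDet
  split_ifs with h
  · subst h
    convert Matrix.det_one (n := Fin p) (R := ℤ)
    ext i j
    rw [Matrix.of_apply, hent, Matrix.one_apply]
    have hinj : StrictMono x := fun i j hij => hx.1 i j hij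
    simp [hinj.injective.eq_iff]
  · rw [Matrix.det_apply]
    refine Finset.sum_eq_zero fun σ _ => ?_
    by_cases hall : ∀ i, x (σ i) = y i
    · -- two increasing enumerations of the same set agree
      exfalso
      apply h
      have hxm : StrictMono x := fun i j hij => hx.1 i j hij
      have hym : StrictMono y := fun i j hij => hy.1 i j hij
      have hσ : StrictMono σ := fun i j hij => by
        rw [← hxm.lt_iff_lt, hall, hall]; exact hym hij
      have : ∀ i, σ i = i := fun i => by
        have h1 : σ = Equiv.refl _ := by
          have := Subsingleton.elim (hσ.orderIsoOfSurjective σ σ.surjective) (OrderIso.refl _)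
          ext i
          have h2 := DFunLike.congr_fun this i
          simpa using congrArg Fin.val h2
        rw [h1]; rfl
      funext i
      rw [← hall i, this i]
    · push Not at hall
      obtain ⟨i, hi⟩ := hall
      rw [Finset.prod_eq_zero (Finset.mem_univ i)]
      · simp
      · rw [Matrix.of_apply, hent, if_neg hi]

/-- The recursion of the counting determinant over the last steps of the walks, by multilinearity in
the columns. -/
lemma starDet_succ {p : ℕ} (k : ℕ) (x y : Fin p → ℤ) :
    starDet (k + 1) x y = ∑ ε : Fin p → Bool, starDet k x (y - signStep ε) := by
  unfold starDet
  simp only [Matrix.det_apply, Matrix.of_apply]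
  rw [Finset.sum_comm]
  refine Finset.sum_congr rfl fun σ _ => ?_
  rw [← Finset.smul_sum]
  congr 1
  have : ∀ i, wallCount (k + 1) (x (σ i)) (y i) =
      ∑ b : Bool, wallCount k (x (σ i)) (y i - if b then 1 else -1) := by
    intro i
    rw [wallCount_succ]
    simp [sub_eq_add_neg]
  simp only [this, Finset.prod_univ_sum, Fintype.piFinset_univ]
  rfl

/-- The boundary condition. When a step leaves the chamber, either a walk has reached `-1`, where
the entries vanish, or two neighbours meet, as walks of the same parity cannot exchange their
positions without meeting; then two columns are equal. -/
lemma starDet_eq_zero_of_not_inChamber {p : ℕ} (k : ℕ) (x y : Fin p → ℤ) (ε : Fin p → Bool)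
    (hy : InChamber y) (hpar : ∀ i j, (2 : ℤ) ∣ y i - y j)
    (h : ¬ InChamber (y - signStep ε)) : starDet k x (y - signStep ε) = 0 := by
  by_cases h0 : ∃ i, (y - signStep ε) i = -1
  · obtain ⟨i, hi⟩ := h0
    refine Matrix.det_eq_zero_of_column_eq_zero i fun j => ?_
    rw [Matrix.of_apply, hi, wallCount_neg_one]
  · push Not at h0
    have hpos : ∀ i, 0 ≤ (y - signStep ε) i := by
      intro i
      have h1 := h0 i
      have h2 := hy.2 i
      have h3 := signStep_eq ε i
      simp only [Pi.sub_apply] at h1 ⊢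
      omega
    have : ∃ i j, i < j ∧ ¬ ((y - signStep ε) i < (y - signStep ε) j) := by
      by_contra hcon
      push Not at hcon
      exact h ⟨hcon, hpos⟩
    obtain ⟨i, j, hij, hlt⟩ := this
    refine Matrix.det_zero_of_column_eq hij.ne fun l => ?_
    have heq : (y - signStep ε) i = (y - signStep ε) j := by
      have h1 := hy.1 i j hij
      have h2 := hpar i j
      have h3 := signStep_eq ε i
      have h4 := signStep_eq ε j
      simp only [Pi.sub_apply] at hlt ⊢
      omega
    rw [Matrix.of_apply, Matrix.of_apply, heq]

lemma snoc_mem_pinnedWalks {p : ℕ} {N k : ℕ} (hk : k ≤ N) {s x y : Fin p → ℤ}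
    (hy : InChamber y) {ε : Fin p → Bool} {w : Fin (N + 1) → Fin p → ℤ}
    (hw : w ∈ pinnedWalks N k s x (y - signStep ε)) :
    (Fin.snoc (α := fun _ => Fin p → ℤ) w y : Fin (N + 1 + 1) → Fin p → ℤ) ∈
      pinnedWalks (N + 1) k s x y := by
  obtain ⟨h0, hst, hch, hpin, hlast⟩ := hw
  refine ⟨?_, ?_, ?_, ?_, ?_⟩
  · rw [← Fin.castSucc_zero' (n := N + 1), Fin.snoc_castSucc]; exact h0
  · intro j
    induction j using Fin.lastCases with
    | last =>
      intro i
      rw [Fin.succ_last, Fin.snoc_last, Fin.snoc_castSucc, hlast]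
      simpa using signStep_eq ε i
    | cast j =>
      intro i
      rw [Fin.succ_castSucc, Fin.snoc_castSucc, Fin.snoc_castSucc]
      exact hst j i
  · intro j
    induction j using Fin.lastCases with
    | last => rw [Fin.snoc_last]; exact hy
    | cast j => rw [Fin.snoc_castSucc]; exact hch j
  · intro j
    induction j using Fin.lastCases with
    | last => intro h; simp at h; omega
    | cast j => intro h; rw [Fin.snoc_castSucc]; exact hpin j (by simpa using h)
  · rw [Fin.snoc_last]

/-- Decomposition of a family of walks according to its last step. -/
lemma exists_equiv_pinnedWalks_succ {p : ℕ} {N k : ℕ} (hk : k ≤ N) (s x y : Fin p → ℤ)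
    (hy : InChamber y) :
    Nonempty ((Σ ε : Fin p → Bool, pinnedWalks N k s x (y - signStep ε)) ≃
      pinnedWalks (N + 1) k s x y) := by
  let f : (Σ ε : Fin p → Bool, pinnedWalks N k s x (y - signStep ε)) →
      pinnedWalks (N + 1) k s x y := fun q =>
    ⟨Fin.snoc (α := fun _ => Fin p → ℤ) q.2.1 y, snoc_mem_pinnedWalks hk hy q.2.2⟩
  refine ⟨Equiv.ofBijective f ⟨?_, ?_⟩⟩
  · rintro ⟨ε, w, hw⟩ ⟨ε', w', hw'⟩ h
    have h1 : Fin.snoc (α := fun _ => Fin p → ℤ) w y = Fin.snoc (α := fun _ => Fin p → ℤ) w' y :=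
      congrArg Subtype.val h
    obtain rfl : w = w' := by
      have := congrArg Fin.init h1
      simpa [Fin.init_snoc] using this
    obtain rfl : ε = ε' := by
      apply signStep_injective
      have := hw.2.2.2.2.symm.trans hw'.2.2.2.2
      simpa using this
    rfl
  · rintro ⟨w, h0, hst, hch, hpin, hlast⟩
    obtain ⟨ε, hε⟩ := exists_signStep (w (Fin.last N).succ - w (Fin.last N).castSucc)
      (fun i => hst (Fin.last N) i)
    refine ⟨⟨ε, Fin.init w, ⟨?_, ?_, ?_, ?_, ?_⟩⟩, ?_⟩
    · exact h0
    · intro j i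
      exact hst j.castSucc i
    · intro j; exact hch _
    · intro j hj; exact hpin _ (by simpa using hj)
    · rw [hε, Fin.succ_last, ← hlast]; simp [Fin.init]
    · apply Subtype.ext
      change Fin.snoc (Fin.init w) y = w
      rw [← hlast]; exact Fin.snoc_init_self w

lemma pinnedWalks_eq_empty {p : ℕ} {N k : ℕ} {s x y : Fin p → ℤ} (hy : ¬ InChamber y) :
    pinnedWalks N k s x y = ∅ := by
  ext w
  simp only [Set.mem_empty_iff_false, iff_false]
  rintro ⟨-, -, h, -, h'⟩
  exact hy (h' ▸ h _)

lemma finite_pinnedWalks_of_self {p : ℕ} {N k : ℕ} (hk : k ≤ N) (s x : Fin p → ℤ)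
    (hfin : (pinnedWalks k k s x x).Finite) (y : Fin p → ℤ) :
    (pinnedWalks N k s x y).Finite := by
  induction N, hk using Nat.le_induction generalizing y with
  | base =>
    refine hfin.subset fun w hw => ?_
    have := hw.2.2.2.1 (Fin.last k) (by simp)
    exact ⟨hw.1, hw.2.1, hw.2.2.1, hw.2.2.2.1, this⟩
  | succ N hN ih =>
    by_cases hy : InChamber y
    · obtain ⟨e⟩ := exists_equiv_pinnedWalks_succ hN s x y hy
      have : ∀ ε, Finite (pinnedWalks N k s x (y - signStep ε)) := fun ε => ih _
      exact Finite.of_equiv _ e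
    · rw [pinnedWalks_eq_empty hy]; exact Set.finite_empty

/-- The Karlin–McGregor formula for the part of the walks after the time at which they are
pinned: the determinant satisfies the same recursion and vanishes on the boundary. -/
lemma card_pinnedWalks_of_self {p : ℕ} {N k : ℕ} (hk : k ≤ N) (s x : Fin p → ℤ)
    (hx : InChamber x) (hfin : (pinnedWalks k k s x x).Finite) (y : Fin p → ℤ)
    (hy : InChamber y) (hpar : ∀ i j, (2 : ℤ) ∣ y i - y j) :
    (Nat.card (pinnedWalks N k s x y) : ℤ) =
      Nat.card (pinnedWalks k k s x x) * starDet (N - k) x y := by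
  induction N, hk using Nat.le_induction generalizing y with
  | base =>
    rw [Nat.sub_self, starDet_zero hx hy]
    split_ifs with h
    · subst h; simp
    · have : pinnedWalks k k s x y = ∅ := by
        ext w
        simp only [Set.mem_empty_iff_false, iff_false]
        intro hw
        exact h ((hw.2.2.2.1 (Fin.last k) (by simp)).symm.trans hw.2.2.2.2)
      simp [this]
  | succ N hN ih =>
    obtain ⟨e⟩ := exists_equiv_pinnedWalks_succ hN s x y hy
    have : ∀ ε, Finite (pinnedWalks N k s x (y - signStep ε)) := fun ε =>
      finite_pinnedWalks_of_self hN s x hfin _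
    rw [← Nat.card_congr e, Nat.card_sigma, Nat.succ_sub hN, starDet_succ, Finset.mul_sum]
    push_cast
    refine Finset.sum_congr rfl fun ε _ => ?_
    by_cases hc : InChamber (y - signStep ε)
    · refine ih _ hc fun i j => ?_
      have h1 := hpar i j
      have h3 := signStep_eq ε i
      have h4 := signStep_eq ε j
      simp only [Pi.sub_apply]
      omega
    · rw [starDet_eq_zero_of_not_inChamber _ _ _ _ hy hpar hc, pinnedWalks_eq_empty hc]
      simp

lemma inChamber_startPoint (p : ℕ) : InChamber (startPoint p) := by
  refine ⟨fun i j hij => ?_, fun i => ?_⟩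
  · have : (i : ℕ) < j := hij
    simp only [startPoint]; omega
  · simp only [startPoint]; omega

lemma pinnedWalks_zero_self {p : ℕ} {s : Fin p → ℤ} (hs : InChamber s) :
    pinnedWalks 0 0 s s s = {fun _ => s} := by
  ext w
  simp only [Set.mem_singleton_iff]
  constructor
  · rintro ⟨h, -⟩
    funext j
    obtain rfl : j = 0 := by ext; have := j.2; simp only [Fin.val_zero]; omega
    exact h
  · rintro rfl
    exact ⟨rfl, fun j => j.elim0, fun _ => hs, fun _ _ => rfl, rfl⟩

/-- Pinning at time `0` to the starting point and pinning at time `N` to the end point are both void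
conditions. -/
lemma pinnedWalks_zero {p : ℕ} (N : ℕ) (s y : Fin p → ℤ) :
    pinnedWalks N 0 s s y = pinnedWalks N N s y y := by
  ext w
  constructor
  · rintro ⟨h0, hst, hch, hpin, hl⟩
    refine ⟨h0, hst, hch, fun j hj => ?_, hl⟩
    rw [← hl]; congr 1; ext; simpa using hj
  · rintro ⟨h0, hst, hch, hpin, hl⟩
    refine ⟨h0, hst, hch, fun j hj => ?_, hl⟩
    rw [← h0]; congr 1; ext; simpa using hj

lemma finite_pinnedWalks {p : ℕ} {N k : ℕ} (hk : k ≤ N) {s : Fin p → ℤ} (hs : InChamber s)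
    (x y : Fin p → ℤ) : (pinnedWalks N k s x y).Finite := by
  refine finite_pinnedWalks_of_self hk s x ?_ y
  rw [← pinnedWalks_zero]
  refine finite_pinnedWalks_of_self (Nat.zero_le k) s s ?_ x
  rw [pinnedWalks_zero_self hs]
  exact Set.finite_singleton _

/-- Splitting at the time `k`: the walks before and after this time are chosen independently. -/
lemma card_pinnedWalks {p : ℕ} {N k : ℕ} (hk : k ≤ N) {s x y : Fin p → ℤ} (hs : InChamber s)
    (hx : InChamber x) (hy : InChamber y) (hxpar : ∀ i j, (2 : ℤ) ∣ x i - x j)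
    (hypar : ∀ i j, (2 : ℤ) ∣ y i - y j) :
    (Nat.card (pinnedWalks N k s x y) : ℤ) = starDet k s x * starDet (N - k) x y := by
  rw [card_pinnedWalks_of_self hk s x hx (finite_pinnedWalks le_rfl hs x x) y hy hypar,
    ← pinnedWalks_zero, card_pinnedWalks_of_self (Nat.zero_le k) s s hs ?_ x hx hxpar,
    pinnedWalks_zero_self hs]
  · simp
  · rw [pinnedWalks_zero_self hs]
    exact Set.finite_singleton _

lemma watermelons_eq (p N : ℕ) :
    watermelons p N = pinnedWalks N 0 (startPoint p) (startPoint p) (startPoint p) := by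
  ext w
  constructor
  · rintro ⟨h0, hl, hst, hlt, hpos⟩
    refine ⟨funext h0, hst, fun j => ⟨hlt j, hpos j⟩, fun j hj => ?_, funext hl⟩
    obtain rfl : j = 0 := Fin.ext hj
    exact funext h0
  · rintro ⟨h0, hst, hch, -, hl⟩
    exact ⟨congrFun h0, congrFun hl, hst, fun k => (hch k).1, fun k => (hch k).2⟩

lemma watermelons_inter_eq (p N : ℕ) (k : Fin (N + 1)) (x : Fin p → ℤ) :
    watermelons p N ∩ {w | w k = x} = pinnedWalks N k (startPoint p) x (startPoint p) := by
  rw [watermelons_eq]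
  ext w
  constructor
  · rintro ⟨⟨h0, hst, hch, -, hl⟩, hk⟩
    exact ⟨h0, hst, hch, fun j hj => (Fin.ext hj : j = k) ▸ hk, hl⟩
  · rintro ⟨h0, hst, hch, hk, hl⟩
    exact ⟨⟨h0, hst, hch, fun j hj => (Fin.ext hj : j = 0) ▸ h0, hl⟩, hk k rfl⟩

lemma two_dvd_startPoint (p : ℕ) (i j : Fin p) : (2 : ℤ) ∣ startPoint p i - startPoint p j := by
  simp only [startPoint]; omega

lemma card_watermelons (p N : ℕ) :
    (Nat.card (watermelons p N) : ℤ) = starDet N (startPoint p) (startPoint p) := by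
  have hs := inChamber_startPoint p
  rw [watermelons_eq, card_pinnedWalks (Nat.zero_le N) hs hs hs (two_dvd_startPoint p)
    (two_dvd_startPoint p), starDet_zero hs hs]
  simp

lemma finite_watermelons (p N : ℕ) : (watermelons p N).Finite := by
  rw [watermelons_eq]
  exact finite_pinnedWalks (Nat.zero_le N) (inChamber_startPoint p) _ _

lemma card_watermelons_inter (p N : ℕ) (k : Fin (N + 1)) {x : Fin p → ℤ} (hx : InChamber x)
    (hpar : ∀ i j, (2 : ℤ) ∣ x i - x j) :
    (Nat.card ↥(watermelons p N ∩ {w | w k = x}) : ℤ) =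
      starDet k (startPoint p) x * starDet (N - k) (startPoint p) x := by
  have hs := inChamber_startPoint p
  rw [watermelons_inter_eq, card_pinnedWalks (Nat.lt_succ_iff.1 k.2) hs hx hs hpar
    (two_dvd_startPoint p), starDet_comm (N - k)]

/-! ### The product formula for the counting determinant -/

lemma walkCount_eq_zero {k : ℕ} {d : ℤ} (h : (k : ℤ) < |d|) : walkCount k d = 0 := by
  induction k generalizing d with
  | zero =>
    have : d ≠ 0 := by rintro rfl; simp at h
    simp [walkCount, this]
  | succ k ih =>
    push_cast at h
    have h' : ((k : ℤ) + 1 < d) ∨ ((k : ℤ) + 1 < -d) := lt_abs.1 h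
    rw [walkCount, ih, ih, add_zero]
    · apply lt_abs.2; omega
    · apply lt_abs.2; omega

lemma walkCount_eq_choose (k S : ℕ) : walkCount k (2 * S - k) = k.choose S := by
  induction k generalizing S with
  | zero =>
    cases S with
    | zero => simp [walkCount]
    | succ S =>
      rw [walkCount, if_neg (by push_cast; omega)]
      simp
  | succ k ih =>
    cases S with
    | zero =>
      rw [walkCount, walkCount_eq_zero, zero_add]
      · have := ih 0
        push_cast at this ⊢
        rw [show ((0 : ℤ) - ((k : ℤ) + 1) + 1) = 0 - k by ring, this]
        simp
      · apply lt_abs.2; push_cast; omega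
    | succ S =>
      rw [walkCount, Nat.choose_succ_succ]
      push_cast
      rw [← ih S, ← ih (S + 1)]
      push_cast
      ring_nf

/-- The straight walk is the only one that reaches the height `m` in `m` steps. -/
lemma wallCount_self (m : ℕ) : wallCount m 0 m = 1 := by
  have h := walkCount_eq_choose m m
  rw [show (2 * (m : ℤ) - m) = m by ring] at h
  rw [wallCount, sub_zero, h, walkCount_eq_zero]
  · simp
  · apply lt_abs.2; omega

lemma wallCount_eq_zero {m : ℕ} {x : ℤ} (h : (m : ℤ) < x) : wallCount m 0 x = 0 := by
  rw [wallCount, walkCount_eq_zero, walkCount_eq_zero, sub_zero] <;> apply lt_abs.2 <;> omega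

/-- In two steps, on the even sites, the transition operator is `4` plus a second difference. -/
lemma wallCount_add_two (k : ℕ) (y x : ℤ) : wallCount (k + 2) y (2 * x) =
    wallCount k y (2 * (x - 1)) + 2 * wallCount k y (2 * x) + wallCount k y (2 * (x + 1)) := by
  rw [wallCount_succ, wallCount_succ, wallCount_succ]
  ring_nf

/-- Summation by parts for the second difference with odd boundary condition. -/
lemma sum_mul_secondDiff_comm (e W : ℤ → ℤ) (K : ℕ) (he : e (-1) = -e 0) (hW : W (-1) = -W 0)
    (hK : e K = 0) (hK' : e (K - 1) = 0) :
    ∑ l ∈ Finset.range K, (e (l - 1) + 2 * e l + e (l + 1)) * W l =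
      ∑ l ∈ Finset.range K, e l * (W (l - 1) + 2 * W l + W (l + 1)) := by
  rw [← sub_eq_zero, ← Finset.sum_sub_distrib]
  have := Finset.sum_range_sub' (fun l : ℕ => e (l - 1) * W l - e l * W (l - 1)) K
  simp only [Nat.cast_zero, zero_sub, he, hW, hK, hK', Nat.cast_add, Nat.cast_one] at this
  rw [show (-e 0 * W 0 - e 0 * -W 0 - (0 * W K - 0 * W (K - 1))) = 0 by ring] at this
  rw [← this]
  refine Finset.sum_congr rfl fun l _ => ?_
  rw [add_sub_cancel_right]
  ring

/-- A walk from `0` is split at the time `2 * i`, at which it is at one of the even positions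
`2 * l`; those with `l ≤ i < p` are the only ones it can have reached. -/
lemma wallCount_zero_eq_sum (p i : ℕ) (hi : i < p) (k : ℕ) (x : ℤ) :
    wallCount (k + 2 * i) 0 x =
      ∑ l ∈ Finset.range p, wallCount (2 * i) 0 (2 * l) * wallCount k (2 * l) x := by
  induction i generalizing k with
  | zero =>
    have h0 : ∀ l : ℕ, wallCount (2 * 0) 0 (2 * l) = if l = 0 then 1 else 0 := by
      intro l
      simp only [wallCount, walkCount]
      rw [if_neg (show ¬ (2 * (l : ℤ) + 0 + 2 = 0) by omega)]
      by_cases h : l = 0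
      · simp [h]
      · rw [if_neg (by omega), if_neg h]; rfl
    simp only [h0, ite_mul, one_mul, zero_mul, Finset.sum_ite_eq', Finset.mem_range, hi, if_true]
    simp
  | succ i ih =>
    rw [show k + 2 * (i + 1) = (k + 2) + 2 * i by ring, ih (by omega) (k + 2)]
    have h2 : ∀ l : ℕ, wallCount (2 * (i + 1)) 0 (2 * l) = _ := fun l =>
      wallCount_add_two (2 * i) 0 l
    have h3 : ∀ l : ℕ, wallCount (k + 2) (2 * l) x = wallCount k (2 * ((l : ℤ) - 1)) x +
        2 * wallCount k (2 * (l : ℤ)) x + wallCount k (2 * ((l : ℤ) + 1)) x := by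
      intro l
      simp only [wallCount_comm _ _ x, wallCount_add_two]
    simp only [h2, h3]
    refine (sum_mul_secondDiff_comm (fun l => wallCount (2 * i) 0 (2 * l))
      (fun l => wallCount k (2 * l) x) p ?_ ?_ ?_ ?_).symm
    · simpa using wallCount_reflect (2 * i) 0 0
    · simpa [wallCount_comm _ _ x] using wallCount_reflect k x 0
    · apply wallCount_eq_zero; push_cast; omega
    · apply wallCount_eq_zero; push_cast; omega

/-- The starting points can be exchanged for starting times: the walks may all start at `0`, the one
with number `i` being `2 * i` steps longer. The change of rows is unitriangular. -/
lemma starDet_startPoint {p : ℕ} (k : ℕ) (x : Fin p → ℤ) :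
    starDet k (startPoint p) x =
      (Matrix.of fun i j : Fin p => wallCount (k + 2 * i) 0 (x j)).det := by
  let L : Matrix (Fin p) (Fin p) ℤ := Matrix.of fun i l => wallCount (2 * i) 0 (2 * (l : ℤ))
  have hmul : (Matrix.of fun i j : Fin p => wallCount (k + 2 * i) 0 (x j)) =
      L * Matrix.of fun l j : Fin p => wallCount k (startPoint p l) (x j) := by
    ext i j
    rw [Matrix.mul_apply, Matrix.of_apply, wallCount_zero_eq_sum p i i.2, Finset.sum_range]
    rfl
  have hL : L.det = 1 := by
    rw [Matrix.det_of_isLowerTriangular]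
    · refine Finset.prod_eq_one fun i _ => ?_
      have := wallCount_self (2 * i)
      push_cast at this
      exact this
    · intro i l h
      have : (i : ℕ) < l := h
      apply wallCount_eq_zero; push_cast; omega
  rw [hmul, Matrix.det_mul, hL, one_mul]
  rfl

/-- The ballot number: `S` steps up and `T` steps down. -/
lemma wallCount_eq_div (S T : ℕ) : (wallCount (S + T) 0 (S - T) : ℝ) =
    ((S : ℝ) - T + 1) * (S + T).factorial / ((S + 1).factorial * T.factorial) := by
  have h1 := walkCount_eq_choose (S + T) S
  have h2 := walkCount_eq_choose (S + T) (S + 1)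
  rw [show (2 * (S : ℤ) - (S + T : ℕ)) = S - T by push_cast; ring] at h1
  rw [show (2 * ((S + 1 : ℕ) : ℤ) - (S + T : ℕ)) = S - T + 2 by push_cast; ring] at h2
  rw [wallCount, sub_zero, add_zero, h1, h2]
  have h3 : ((S + T).choose S : ℝ) * (S.factorial * T.factorial) = (S + T).factorial := by
    have := Nat.add_choose_mul_factorial_mul_factorial T S
    rw [add_comm T S] at this
    rw [← this]; push_cast; ring
  have h4 : ((S + T).choose (S + 1) : ℝ) * (S + 1) = (S + T).choose S * T := by
    have := Nat.choose_succ_right_eq (S + T) S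
    rw [Nat.add_sub_cancel_left] at this
    exact_mod_cast this
  have hT : (T.factorial : ℝ) ≠ 0 := by positivity
  have hS : (S.factorial : ℝ) ≠ 0 := by positivity
  have hS1 : (S : ℝ) + 1 ≠ 0 := by positivity
  rw [eq_div_iff (by positivity), Nat.factorial_succ, ← h3]
  push_cast
  linear_combination -(S.factorial : ℝ) * T.factorial * h4

lemma factorial_mul_prod_Ico (n i p : ℕ) (h : i ≤ p) :
    ((n + i).factorial : ℝ) * ∏ m ∈ Finset.Ico i p, ((n : ℝ) + m + 1) = (n + p).factorial := by
  induction p, h using Nat.le_induction with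
  | base => simp
  | succ p hp ih =>
    rw [Finset.prod_Ico_succ_top hp, ← mul_assoc, ih, ← add_assoc, Nat.factorial_succ]
    push_cast; ring

lemma prod_Ioi_rev {p : ℕ} (f : Fin p → Fin p → ℝ) :
    ∏ i : Fin p, ∏ j ∈ Finset.Ioi i, f i.rev j.rev = ∏ i : Fin p, ∏ j ∈ Finset.Ioi i, f j i := by
  rw [Finset.prod_sigma', Finset.prod_sigma']
  refine Finset.prod_nbij' (fun q => ⟨q.2.rev, q.1.rev⟩) (fun q => ⟨q.2.rev, q.1.rev⟩)
    ?_ ?_ ?_ ?_ ?_ <;> simp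

open Polynomial in
/-- The determinant whose rows are the nested products `∏_{m > i} (z_j + d_m)` is a Vandermonde
determinant. -/
lemma det_prod_add_eq {p : ℕ} (z : Fin p → ℝ) (d : ℕ → ℝ) :
    (Matrix.of fun i j : Fin p => ∏ m ∈ Finset.Ico ((i : ℕ) + 1) p, (z j + d m)).det =
      ∏ i : Fin p, ∏ j ∈ Finset.Ioi i, (z i - z j) := by
  have h := Matrix.det_eval_matrixOfPolynomials_eq_det_vandermonde (fun i : Fin p => z i.rev)
    (fun l : Fin p => ∏ m ∈ Finset.Ico (p - (l : ℕ)) p, (X + C (d m)))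
    (fun l => by
      rw [natDegree_prod_of_monic _ _ fun m _ => monic_X_add_C _]
      simp only [natDegree_X_add_C, Finset.sum_const, Nat.card_Ico, smul_eq_mul, mul_one]
      omega)
    (fun l => monic_prod_of_monic _ _ fun m _ => monic_X_add_C _)
  rw [Matrix.det_vandermonde, prod_Ioi_rev (fun a b => z b - z a)] at h
  rw [h, ← Matrix.det_transpose, ← Matrix.det_submatrix_equiv_self Fin.revPerm]
  congr 1
  ext i j
  simp only [Matrix.submatrix_apply, Matrix.transpose_apply, Matrix.of_apply, eval_prod, eval_add,
    eval_X, eval_C, Fin.revPerm_apply, Fin.val_rev]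
  have hj := j.2
  rw [show p - ((j : ℕ) + 1) + 1 = p - j by omega]

/-- The product formula for the counting determinant, where `S j` and `T j` are the numbers of steps
up and down that lead from `0` to `x j` in `k` steps. After the common factors of the rows and of
the columns are removed, the entries are polynomials in `(x j + 1) ^ 2`. -/
lemma starDet_eq_prod {p k : ℕ} {x : Fin p → ℤ} (S T : Fin p → ℕ) (hk : ∀ j, k = S j + T j)
    (hx : ∀ j, x j = S j - T j) :
    (starDet k (startPoint p) x : ℝ) =
      (∏ j : Fin p, ((k + 2 * (j : ℕ)).factorial : ℝ) /
        ((S j + p).factorial * (T j + (p - 1)).factorial)) * (∏ j, ((x j : ℝ) + 1)) *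
        ∏ i : Fin p, ∏ j ∈ Finset.Ioi i, (((x j : ℝ) + 1) ^ 2 - ((x i : ℝ) + 1) ^ 2) / 4 := by
  have hent : ∀ i j : Fin p, (wallCount (k + 2 * i) 0 (x j) : ℝ) =
      ((k + 2 * (i : ℕ)).factorial : ℝ) * ((((x j : ℝ) + 1) /
        ((S j + p).factorial * (T j + (p - 1)).factorial)) *
        ∏ m ∈ Finset.Ico ((i : ℕ) + 1) p,
          (-(((x j : ℝ) + 1) / 2) ^ 2 + (((k : ℝ) + 1) / 2 + m) ^ 2)) := by
    intro i j
    have h1 := wallCount_eq_div (S j + i) (T j + i)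
    rw [show (S j + i + (T j + i)) = k + 2 * i by rw [hk j]; ring,
      show (((S j + i : ℕ) : ℤ) - (T j + i : ℕ)) = x j by rw [hx j]; push_cast; ring] at h1
    rw [h1]
    have hxr : (x j : ℝ) = S j - T j := by rw [hx j]; push_cast; ring
    have hkr : (k : ℝ) = S j + T j := by rw [hk j]; push_cast; ring
    have h2 := factorial_mul_prod_Ico (S j) (i + 1) p i.2
    have h3 : ((T j + i).factorial : ℝ) * ∏ m ∈ Finset.Ico ((i : ℕ) + 1) p, ((T j : ℝ) + m) =
        (T j + (p - 1)).factorial := by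
      rw [← factorial_mul_prod_Ico (T j) i (p - 1) (by omega)]
      congr 1
      have := Finset.prod_Ico_add' (fun m : ℕ => (T j : ℝ) + m) i (p - 1) 1
      rw [show p - 1 + 1 = p by have := i.2; omega] at this
      rw [← this]
      refine Finset.prod_congr rfl fun m _ => ?_
      push_cast; ring
    -- with `k = S + T` and `x = S - T` the difference of squares is `(S + m + 1) (T + m)`
    rw [show ∏ m ∈ Finset.Ico ((i : ℕ) + 1) p,
        (-(((x j : ℝ) + 1) / 2) ^ 2 + (((k : ℝ) + 1) / 2 + m) ^ 2) =
        (∏ m ∈ Finset.Ico ((i : ℕ) + 1) p, ((S j : ℝ) + m + 1)) *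
          ∏ m ∈ Finset.Ico ((i : ℕ) + 1) p, ((T j : ℝ) + m) by
      rw [← Finset.prod_mul_distrib]
      refine Finset.prod_congr rfl fun m _ => ?_
      rw [hxr, hkr]; ring]
    have hS : ((S j + i + 1).factorial : ℝ) ≠ 0 := by positivity
    have hT : ((T j + i).factorial : ℝ) ≠ 0 := by positivity
    have hS' : ((S j + p).factorial : ℝ) ≠ 0 := by positivity
    have hT' : ((T j + (p - 1)).factorial : ℝ) ≠ 0 := by positivity
    push_cast
    rw [hxr]
    rw [div_eq_iff (by positivity)]
    field_simp
    rw [← h2, ← h3, add_assoc (S j) i 1]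
    ring
  rw [starDet_startPoint, Int.cast_det]
  have hmat : (Matrix.of fun i j : Fin p => wallCount (k + 2 * i) 0 (x j)).map
      (Int.cast : ℤ → ℝ) = Matrix.of fun i j : Fin p =>
        ((k + 2 * (i : ℕ)).factorial : ℝ) * ((Matrix.of fun i j : Fin p =>
        (((x j : ℝ) + 1) / ((S j + p).factorial * (T j + (p - 1)).factorial)) *
        (Matrix.of fun i j : Fin p => ∏ m ∈ Finset.Ico ((i : ℕ) + 1) p,
          (-(((x j : ℝ) + 1) / 2) ^ 2 + (((k : ℝ) + 1) / 2 + m) ^ 2)) i j) i j) := by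
    ext i j
    simp only [Matrix.map_apply, Matrix.of_apply]
    exact hent i j
  rw [hmat, Matrix.det_mul_column, Matrix.det_mul_row,
    det_prod_add_eq (fun j : Fin p => -(((x j : ℝ) + 1) / 2) ^ 2)
      (fun m => (((k : ℝ) + 1) / 2 + m) ^ 2)]
  simp only [Finset.prod_div_distrib]
  rw [← mul_assoc]
  congr 1
  · field_simp
  · simp only [← Finset.prod_div_distrib]
    refine Finset.prod_congr rfl fun i _ => Finset.prod_congr rfl fun j _ => ?_
    ring

/-! ### A local limit theorem for binomial coefficients -/

lemma abs_one_sub_mul_log_le {x : ℝ} (hx : |x| ≤ 1 / 2) :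
    |(1 - x) * Real.log (1 - x) - (-x + x ^ 2 / 2 + x ^ 3 / 2)| ≤ 3 * |x| ^ 3 := by
  have h := Real.abs_log_sub_add_sum_range_le (x := x) (by linarith) 2
  norm_num [Finset.sum_range_succ] at h
  have h1 : |x| ^ 3 / (1 - |x|) ≤ 2 * |x| ^ 3 := by
    rw [div_le_iff₀ (by linarith)]
    nlinarith [pow_nonneg (abs_nonneg x) 3]
  have h2 : |1 - x| ≤ 3 / 2 := by
    rw [abs_le] at hx ⊢; constructor <;> linarith [hx.1, hx.2]
  calc _ = |1 - x| * |x + x ^ 2 / 2 + Real.log (1 - x)| := by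
        rw [← abs_mul]; congr 1; ring
    _ ≤ 3 / 2 * (2 * |x| ^ 3) := by gcongr; linarith
    _ = _ := by ring

/-- Second order expansion of the entropy of a Bernoulli variable near `1 / 2`. -/
lemma abs_entropy_sub_sq_le {d : ℝ} (hd : |d| ≤ 1 / 2) :
    |(1 + d) * Real.log (1 + d) + (1 - d) * Real.log (1 - d) - d ^ 2| ≤ 6 * |d| ^ 3 := by
  have h1 := abs_one_sub_mul_log_le hd
  have h2 := abs_one_sub_mul_log_le (x := -d) (by simpa using hd)
  rw [abs_neg] at h2
  calc _ = |((1 - d) * Real.log (1 - d) - (-d + d ^ 2 / 2 + d ^ 3 / 2)) +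
        ((1 - -d) * Real.log (1 - -d) - (- -d + (-d) ^ 2 / 2 + (-d) ^ 3 / 2))| := by
        congr 1; ring_nf
    _ ≤ _ := (abs_add_le _ _).trans (by linarith)

section BinomialLimit

variable {ι : Type*} {l : Filter ι}

/-- On the diffusive scale the numbers of steps up and down differ by less than any fixed proportion
of the total number. -/
lemma tendsto_of_tendsto_div_sqrt {S T : ι → ℕ} {ξ : ℝ}
    (hm : Tendsto (fun n => (S n + T n : ℝ)) l atTop)
    (hξ : Tendsto (fun n => ((S n : ℝ) - T n) / √(S n + T n)) l (𝓝 ξ)) :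
    Tendsto (fun n => ((S n : ℝ) - T n) / (S n + T n)) l (𝓝 0) := by
  have h1 : Tendsto (fun n => √(S n + T n : ℝ)) l atTop := Real.tendsto_sqrt_atTop.comp hm
  have h2 := hξ.mul h1.inv_tendsto_atTop
  rw [mul_zero] at h2
  refine h2.congr fun n => ?_
  have hnn : (0 : ℝ) ≤ S n + T n := by positivity
  simp only [Pi.inv_apply]
  rw [← div_eq_mul_inv, div_div, Real.mul_self_sqrt hnn]

lemma tendsto_fst_div {S T : ι → ℕ} {ξ : ℝ}
    (hm : Tendsto (fun n => (S n + T n : ℝ)) l atTop)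
    (hξ : Tendsto (fun n => ((S n : ℝ) - T n) / √(S n + T n)) l (𝓝 ξ)) :
    Tendsto (fun n => (S n : ℝ) / (S n + T n)) l (𝓝 (1 / 2)) := by
  have h := ((tendsto_of_tendsto_div_sqrt hm hξ).const_add 1).div_const 2
  rw [add_zero] at h
  refine h.congr' ?_
  filter_upwards [hm.eventually_gt_atTop 0] with n hn
  field_simp
  ring

lemma tendsto_snd_div {S T : ι → ℕ} {ξ : ℝ}
    (hm : Tendsto (fun n => (S n + T n : ℝ)) l atTop)
    (hξ : Tendsto (fun n => ((S n : ℝ) - T n) / √(S n + T n)) l (𝓝 ξ)) :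
    Tendsto (fun n => (T n : ℝ) / (S n + T n)) l (𝓝 (1 / 2)) := by
  have h := ((tendsto_of_tendsto_div_sqrt hm hξ).const_sub 1).div_const 2
  rw [sub_zero] at h
  refine h.congr' ?_
  filter_upwards [hm.eventually_gt_atTop 0] with n hn
  field_simp
  ring

lemma tendsto_fst_atTop {S T : ι → ℕ} {ξ : ℝ}
    (hm : Tendsto (fun n => (S n + T n : ℝ)) l atTop)
    (hξ : Tendsto (fun n => ((S n : ℝ) - T n) / √(S n + T n)) l (𝓝 ξ)) :
    Tendsto S l atTop := by
  have h := (tendsto_fst_div hm hξ).pos_mul_atTop (by norm_num) hm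
  refine tendsto_natCast_atTop_iff.1 (h.congr' ?_)
  filter_upwards [hm.eventually_gt_atTop 0] with n hn
  field_simp

lemma tendsto_snd_atTop {S T : ι → ℕ} {ξ : ℝ}
    (hm : Tendsto (fun n => (S n + T n : ℝ)) l atTop)
    (hξ : Tendsto (fun n => ((S n : ℝ) - T n) / √(S n + T n)) l (𝓝 ξ)) :
    Tendsto T l atTop := by
  have h := (tendsto_snd_div hm hξ).pos_mul_atTop (by norm_num) hm
  refine tendsto_natCast_atTop_iff.1 (h.congr' ?_)
  filter_upwards [hm.eventually_gt_atTop 0] with n hn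
  field_simp

/-- The exponential factor in Stirling's approximation of a binomial coefficient. -/
lemma tendsto_pow_div_pow {S T : ι → ℕ} {ξ : ℝ}
    (hm : Tendsto (fun n => (S n + T n : ℝ)) l atTop)
    (hξ : Tendsto (fun n => ((S n : ℝ) - T n) / √(S n + T n)) l (𝓝 ξ)) :
    Tendsto (fun n => (((S n + T n : ℝ)) / 2) ^ (S n + T n) / ((S n : ℝ) ^ S n * (T n : ℝ) ^ T n))
      l (𝓝 (Real.exp (-ξ ^ 2 / 2))) := by
  have hδ := tendsto_of_tendsto_div_sqrt hm hξ
  set d : ι → ℝ := fun n => ((S n : ℝ) - T n) / (S n + T n) with hd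
  have hmd : Tendsto (fun n => (S n + T n : ℝ) * d n ^ 2) l (𝓝 (ξ ^ 2)) := by
    refine (hξ.pow 2).congr' ?_
    filter_upwards [hm.eventually_gt_atTop 0] with n hn
    simp only [hd]
    rw [div_pow, Real.sq_sqrt hn.le]
    field_simp
  have herr : Tendsto (fun n => (S n + T n : ℝ) * ((1 + d n) * Real.log (1 + d n) +
      (1 - d n) * Real.log (1 - d n) - d n ^ 2)) l (𝓝 0) := by
    have h3 : Tendsto (fun n => 6 * (((S n + T n : ℝ) * d n ^ 2) * |d n|)) l (𝓝 0) := by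
      have := (hmd.mul hδ.abs).const_mul 6
      simpa using this
    refine squeeze_zero_norm' ?_ h3
    have hsmall : ∀ᶠ n in l, |d n| ≤ 1 / 2 := by
      have := hδ.abs
      rw [abs_zero] at this
      exact this.eventually_le_const (by norm_num)
    filter_upwards [hsmall] with n hn
    rw [norm_mul, Real.norm_of_nonneg (by positivity : (0 : ℝ) ≤ S n + T n), Real.norm_eq_abs]
    calc _ ≤ (S n + T n : ℝ) * (6 * |d n| ^ 3) := by
          gcongr; exact abs_entropy_sub_sq_le hn
      _ = _ := by rw [← sq_abs (d n)]; ring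
  have hlim : Tendsto (fun n => -((S n + T n : ℝ) * ((1 + d n) * Real.log (1 + d n) +
      (1 - d n) * Real.log (1 - d n))) / 2) l (𝓝 (-ξ ^ 2 / 2)) := by
    have := ((herr.add hmd).neg).div_const 2
    rw [zero_add] at this
    refine this.congr fun n => ?_
    ring
  refine ((Real.continuous_exp.tendsto _).comp hlim).congr' ?_
  filter_upwards [hm.eventually_gt_atTop 0, (tendsto_fst_atTop hm hξ).eventually_gt_atTop 0,
    (tendsto_snd_atTop hm hξ).eventually_gt_atTop 0] with n hn hS hT
  have hS' : (0 : ℝ) < S n := by exact_mod_cast hS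
  have hT' : (0 : ℝ) < T n := by exact_mod_cast hT
  have e1 : 1 + d n = S n / ((S n + T n) / 2) := by
    simp only [hd]; field_simp; ring
  have e2 : 1 - d n = T n / ((S n + T n) / 2) := by
    simp only [hd]; field_simp; ring
  have key : -((S n + T n : ℝ) * ((1 + d n) * Real.log (1 + d n) +
      (1 - d n) * Real.log (1 - d n))) / 2 = Real.log ((((S n + T n : ℝ)) / 2) ^ (S n + T n) /
        ((S n : ℝ) ^ S n * (T n : ℝ) ^ T n)) := by
    have hM : (S n + T n : ℝ) / 2 ≠ 0 := by positivity
    rw [e1, e2, Real.log_div hS'.ne' hM, Real.log_div hT'.ne' hM,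
      Real.log_div (pow_ne_zero _ hM) (by positivity),
      Real.log_mul (by positivity) (by positivity), Real.log_pow, Real.log_pow, Real.log_pow]
    push_cast
    field_simp
    ring
  simp only [Function.comp]
  rw [key, Real.exp_log (by positivity)]

lemma factorial_eq_stirlingSeq {n : ℕ} (hn : n ≠ 0) :
    (n.factorial : ℝ) = Stirling.stirlingSeq n * (√(2 * n) * (n / Real.exp 1) ^ n) := by
  have : (0 : ℝ) < n := by positivity
  rw [Stirling.stirlingSeq, div_mul_cancel₀]
  positivity

/-- Local limit theorem for the symmetric binomial law. -/
lemma tendsto_binomial_local {S T : ι → ℕ} {ξ : ℝ}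
    (hm : Tendsto (fun n => (S n + T n : ℝ)) l atTop)
    (hξ : Tendsto (fun n => ((S n : ℝ) - T n) / √(S n + T n)) l (𝓝 ξ)) :
    Tendsto (fun n => ((S n + T n).factorial : ℝ) / ((S n).factorial * (T n).factorial) /
      2 ^ (S n + T n) * √(S n + T n)) l (𝓝 (√(2 / Real.pi) * Real.exp (-ξ ^ 2 / 2))) := by
  have hS := tendsto_fst_atTop hm hξ
  have hT := tendsto_snd_atTop hm hξ
  have hst := Stirling.tendsto_stirlingSeq_sqrt_pi
  have hpi : √Real.pi ≠ 0 := by positivity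
  have h1 := ((hst.comp (tendsto_atTop_mono (fun n => Nat.le_add_right (S n) (T n)) hS)).div
    ((hst.comp hS).mul (hst.comp hT)) (by positivity)).mul
    (((tendsto_fst_div hm hξ).mul (tendsto_snd_div hm hξ)).sqrt.inv₀ (by positivity))
  have h2 := (h1.div_const (√2)).mul (tendsto_pow_div_pow hm hξ)
  convert h2.congr' ?_ using 2
  · rw [Real.sqrt_div (by norm_num), show (1 / 2 * (1 / 2) : ℝ) = (1 / 2) ^ 2 by norm_num,
      Real.sqrt_sq (by norm_num)]
    have : √2 * √2 = (2 : ℝ) := Real.mul_self_sqrt (by norm_num)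
    field_simp
    linear_combination this
  · filter_upwards [hS.eventually_gt_atTop 0, hT.eventually_gt_atTop 0] with n hS hT
    have hS' : (0 : ℝ) < S n := by exact_mod_cast hS
    have hT' : (0 : ℝ) < T n := by exact_mod_cast hT
    rw [factorial_eq_stirlingSeq (show S n + T n ≠ 0 by omega), factorial_eq_stirlingSeq hS.ne',
      factorial_eq_stirlingSeq hT.ne']
    have sS : Stirling.stirlingSeq (S n) ≠ 0 := by
      rw [Stirling.stirlingSeq]; positivity
    have sT : Stirling.stirlingSeq (T n) ≠ 0 := by
      rw [Stirling.stirlingSeq]; positivity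
    simp only [Function.comp, Pi.div_apply]
    push_cast
    rw [Real.sqrt_mul (show (0 : ℝ) ≤ S n / (S n + T n) by positivity),
      Real.sqrt_mul (show (0 : ℝ) ≤ 2 by norm_num), Real.sqrt_mul (show (0 : ℝ) ≤ 2 by norm_num),
      Real.sqrt_mul (show (0 : ℝ) ≤ 2 by norm_num), Real.sqrt_div (by positivity),
      Real.sqrt_div (by positivity)]
    simp only [div_pow, pow_add]
    have : √(S n + T n : ℝ) * √(S n + T n : ℝ) = S n + T n := Real.mul_self_sqrt (by positivity)
    field_simp

lemma tendsto_factorial_add_div (a : ℕ) :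
    Tendsto (fun n : ℕ => ((n + a).factorial : ℝ) / (n.factorial * (n : ℝ) ^ a)) atTop (𝓝 1) := by
  induction a with
  | zero =>
    refine tendsto_const_nhds.congr fun n => ?_
    rw [add_zero, pow_zero, mul_one, div_self (by positivity)]
  | succ a ih =>
    have h1 : Tendsto (fun n : ℕ => 1 + ((a : ℝ) + 1) / n) atTop (𝓝 (1 + 0)) :=
      (tendsto_const_nhds.div_atTop tendsto_natCast_atTop_atTop).const_add 1
    have h2 := ih.mul h1
    rw [add_zero, mul_one] at h2
    refine h2.congr' ?_
    filter_upwards [eventually_gt_atTop 0] with n hn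
    have hn' : (0 : ℝ) < n := by exact_mod_cast hn
    rw [← add_assoc, Nat.factorial_succ]
    push_cast
    field_simp
    ring

/-- The factor of index `i` in the product formula differs from a binomial probability by bounded
shifts in the factorials, which contribute powers of the arguments. -/
lemma tendsto_starFactor {S T : ι → ℕ} {ξ : ℝ}
    (hm : Tendsto (fun n => (S n + T n : ℝ)) l atTop)
    (hξ : Tendsto (fun n => ((S n : ℝ) - T n) / √(S n + T n)) l (𝓝 ξ)) (p i : ℕ) (hp : 1 ≤ p) :
    Tendsto (fun n => ((S n + T n + 2 * i).factorial : ℝ) /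
      ((S n + p).factorial * (T n + (p - 1)).factorial) / 2 ^ (S n + T n) *
        (√(S n + T n) * (S n + T n : ℝ) ^ (2 * p - 1) / (S n + T n : ℝ) ^ (2 * i))) l
      (𝓝 (√(2 / Real.pi) * 2 ^ (2 * p - 1) * Real.exp (-ξ ^ 2 / 2))) := by
  have hS := tendsto_fst_atTop hm hξ
  have hT := tendsto_snd_atTop hm hξ
  have h1 := (tendsto_factorial_add_div (2 * i)).comp
    (tendsto_atTop_mono (fun n => Nat.le_add_right (S n) (T n)) hS)
  have h2 := (tendsto_factorial_add_div p).comp hS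
  have h3 := (tendsto_factorial_add_div (p - 1)).comp hT
  have h4 := ((h1.div (h2.mul h3) (by norm_num)).mul (tendsto_binomial_local hm hξ)).div
    (((tendsto_fst_div hm hξ).pow p).mul ((tendsto_snd_div hm hξ).pow (p - 1))) (by positivity)
  convert h4.congr' ?_ using 2
  · rw [← pow_add, show p + (p - 1) = 2 * p - 1 by omega]
    simp only [one_div, inv_pow]
    rw [div_inv_eq_mul]
    ring
  · filter_upwards [hS.eventually_gt_atTop 0, hT.eventually_gt_atTop 0] with n hS hT
    have hS' : (0 : ℝ) < S n := by exact_mod_cast hS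
    have hT' : (0 : ℝ) < T n := by exact_mod_cast hT
    simp only [Function.comp, Pi.div_apply]
    rw [show 2 * p - 1 = p + (p - 1) by omega, pow_add (S n + T n : ℝ)]
    push_cast
    simp only [div_pow]
    field_simp

/-- There are `p (p - 1) / 2` pairs `i < j`. -/
lemma prod_Ioi_const_sq_mul (p : ℕ) (c : ℝ) :
    (∏ i : Fin p, ∏ _j ∈ Finset.Ioi i, c) ^ 2 * c ^ p = c ^ (p ^ 2) := by
  simp only [Finset.prod_const, Fin.card_Ioi]
  rw [Finset.prod_pow_eq_pow_sum, ← pow_mul, ← pow_add]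
  congr 1
  rw [Fin.sum_univ_eq_sum_range (fun i => p - 1 - i) p, Finset.sum_range_reflect (fun i => i) p,
    Finset.sum_range_id_mul_two]
  cases p with
  | zero => rfl
  | succ p => simp; ring

/-- Asymptotics of the factorials in the product formula for the counting determinant. -/
lemma tendsto_prod_starFactor {p : ℕ} (hp : 1 ≤ p) {k : ι → ℕ} {S T : ι → Fin p → ℕ}
    (hk : ∀ᶠ n in l, ∀ j, k n = S n j + T n j) {ξ : Fin p → ℝ} (hm : Tendsto k l atTop)
    (hξ : ∀ j, Tendsto (fun n => ((S n j : ℝ) - T n j) / √(k n)) l (𝓝 (ξ j))) :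
    Tendsto (fun n => (∏ j : Fin p, ((k n + 2 * (j : ℕ)).factorial : ℝ) /
        ((S n j + p).factorial * (T n j + (p - 1)).factorial)) / 2 ^ (k n * p) *
        (√(k n) ^ p * (k n : ℝ) ^ (p ^ 2))) l
      (𝓝 ((√(2 / Real.pi) * 2 ^ (2 * p - 1)) ^ p * Real.exp (-(∑ j, ξ j ^ 2) / 2))) := by
  have hkj : ∀ j, ∀ᶠ n in l, (S n j : ℝ) + T n j = k n := fun j => by
    filter_upwards [hk] with n hn
    rw [hn j]; push_cast; rfl
  have h1 : ∀ j : Fin p, _ := fun j => tendsto_starFactor (S := fun n => S n j)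
    (T := fun n => T n j) (ξ := ξ j) (l := l)
    ((tendsto_natCast_atTop_atTop.comp hm).congr' (by
      filter_upwards [hkj j] with n hn; simp [hn]))
    ((hξ j).congr' (by filter_upwards [hkj j] with n hn; rw [hn])) p j hp
  have h2 := tendsto_finsetProd Finset.univ fun j _ => h1 j
  convert h2.congr' ?_ using 2
  · rw [Finset.prod_mul_distrib, Finset.prod_const, Finset.card_univ, Fintype.card_fin,
      ← Real.exp_sum, ← Finset.sum_div, Finset.sum_neg_distrib]
  · filter_upwards [hk, hm.eventually_gt_atTop 0] with n hn hpos
    have hpos' : (0 : ℝ) < k n := by exact_mod_cast hpos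
    have e : ∀ j, (S n j : ℝ) + T n j = k n := fun j => by rw [hn j]; push_cast; rfl
    simp only [e, ← hn]
    rw [Finset.prod_mul_distrib, Finset.prod_div_distrib (g := fun _ => (2 : ℝ) ^ k n),
      Finset.prod_div_distrib (f := fun _ => √(k n : ℝ) * (k n : ℝ) ^ (2 * p - 1)),
      Finset.prod_const, Finset.prod_const, Finset.card_univ, Fintype.card_fin, ← pow_mul,
      Finset.prod_pow_eq_pow_sum, mul_pow, ← Finset.mul_sum, ← pow_mul]
    congr 1
    rw [mul_div_assoc]
    congr 1
    rw [div_eq_iff (by positivity), ← pow_add]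
    congr 1
    rw [Fin.sum_univ_eq_sum_range (fun i => i) p, mul_comm 2 (∑ i ∈ Finset.range p, i),
      Finset.sum_range_id_mul_two]
    obtain ⟨q, rfl⟩ : ∃ q, p = q + 1 := ⟨p - 1, by omega⟩
    simp only [Nat.add_sub_cancel, show 2 * (q + 1) - 1 = 2 * q + 1 by omega]
    ring

end BinomialLimit

/-! ### The limit of the one-time probabilities -/

/-- The `x`-dependent part, outside of the factorials, of the counting determinant. -/
noncomputable def chamberWeight {p : ℕ} (x : Fin p → ℝ) : ℝ :=
  (∏ j, x j) * ∏ i : Fin p, ∏ j ∈ Finset.Ioi i, (x j ^ 2 - x i ^ 2) / 4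

lemma chamberWeight_smul_sq {p : ℕ} {c : ℝ} (x : Fin p → ℝ) :
    chamberWeight (fun j => c * x j) ^ 2 = (c ^ 2) ^ (p ^ 2) * chamberWeight x ^ 2 := by
  have h : ∏ i : Fin p, ∏ j ∈ Finset.Ioi i, ((c * x j) ^ 2 - (c * x i) ^ 2) / 4 =
      (∏ i : Fin p, ∏ j ∈ Finset.Ioi i, c ^ 2) *
        ∏ i : Fin p, ∏ j ∈ Finset.Ioi i, (x j ^ 2 - x i ^ 2) / 4 := by
    simp only [← Finset.prod_mul_distrib]
    refine Finset.prod_congr rfl fun i _ => Finset.prod_congr rfl fun j _ => ?_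
    ring
  rw [chamberWeight, chamberWeight, h, Finset.prod_mul_distrib, Finset.prod_const,
    Finset.card_univ, Fintype.card_fin, ← prod_Ioi_const_sq_mul p (c ^ 2)]
  ring

lemma continuous_chamberWeight {p : ℕ} : Continuous (chamberWeight (p := p)) := by
  unfold chamberWeight
  fun_prop

/-- The normalization under which the counting determinant in `m` steps has a limit. -/
noncomputable def starNorm (p : ℕ) (m : ℝ) : ℝ := √m ^ p * m ^ (p ^ 2)

lemma starNorm_pos (p : ℕ) {m : ℝ} (hm : 0 < m) : 0 < starNorm p m := by
  unfold starNorm; positivity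

lemma starNorm_mul (p : ℕ) {a b : ℝ} (ha : 0 ≤ a) :
    starNorm p (a * b) = starNorm p a * starNorm p b := by
  unfold starNorm
  rw [Real.sqrt_mul ha, mul_pow, mul_pow]
  ring

/-- Asymptotics of the counting determinant in the diffusive scaling: up to the explicit factor
`chamberWeight` it is a product of Gaussian densities. -/
lemma exists_tendsto_starDet {ι : Type*} {l : Filter ι} {p : ℕ} (hp : 1 ≤ p)
    {k : ι → ℕ} {y : ι → Fin p → ℤ} (hpar : ∀ n j, (2 : ℤ) ∣ y n j - k n)
    (hk : Tendsto k l atTop) {ξ : Fin p → ℝ}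
    (hy : ∀ j, Tendsto (fun n => (y n j : ℝ) / √(k n)) l (𝓝 (ξ j))) :
    ∃ A : ι → ℝ, Tendsto A l (𝓝 ((√(2 / Real.pi) * 2 ^ (2 * p - 1)) ^ p *
      Real.exp (-(∑ j, ξ j ^ 2) / 2))) ∧
      ∀ᶠ n in l, (starDet (k n) (startPoint p) (y n) : ℝ) =
        A n * 2 ^ (k n * p) / starNorm p (k n) * chamberWeight (fun j => (y n j : ℝ) + 1) := by
  have hkr : Tendsto (fun n => (k n : ℝ)) l atTop := tendsto_natCast_atTop_atTop.comp hk
  have hle : ∀ j, ∀ᶠ n in l, |y n j| ≤ k n := by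
    intro j
    have h1 : Tendsto (fun n => (y n j : ℝ) / k n) l (𝓝 0) := by
      have h2 := (hy j).mul (Real.tendsto_sqrt_atTop.comp hkr).inv_tendsto_atTop
      rw [mul_zero] at h2
      refine h2.congr fun n => ?_
      simp only [Pi.inv_apply, Function.comp]
      rw [← div_eq_mul_inv, div_div, Real.mul_self_sqrt (Nat.cast_nonneg _)]
    have h3 := h1.abs
    rw [abs_zero] at h3
    filter_upwards [h3.eventually_le_const (show (0 : ℝ) < 1 by norm_num),
      hk.eventually_gt_atTop 0] with n hn hpos
    have hpos' : (0 : ℝ) < k n := by exact_mod_cast hpos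
    rw [abs_div, abs_of_pos hpos', div_le_one hpos'] at hn
    exact_mod_cast hn
  have hle' : ∀ᶠ n in l, ∀ j, |y n j| ≤ k n := eventually_all.2 hle
  -- the numbers of steps up and down; the truncation to `ℕ` is harmless for large `n`, by `hle'`
  let S : ι → Fin p → ℕ := fun n j => ((k n + y n j) / 2).toNat
  let T : ι → Fin p → ℕ := fun n j => ((k n - y n j) / 2).toNat
  have hST : ∀ᶠ n in l, ∀ j, k n = S n j + T n j ∧ y n j = S n j - T n j := by
    filter_upwards [hle'] with n hn j
    have h1 := hpar n j
    have h2 := abs_le.1 (hn j)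
    simp only [S, T]
    omega
  have hS : ∀ᶠ n in l, ∀ j, k n = S n j + T n j := hST.mono fun n hn j => (hn j).1
  have hξ : ∀ j, Tendsto (fun n => ((S n j : ℝ) - T n j) / √(k n)) l (𝓝 (ξ j)) := by
    intro j
    refine (hy j).congr' ?_
    filter_upwards [hST] with n hn
    congr 1
    rw [(hn j).2]; push_cast; rfl
  refine ⟨_, tendsto_prod_starFactor hp hS hk hξ, ?_⟩
  filter_upwards [hST, hk.eventually_gt_atTop 0] with n hn hpos
  have hpos' : (0 : ℝ) < k n := by exact_mod_cast hpos
  have hB := (starNorm_pos p hpos').ne'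
  rw [starDet_eq_prod (S n) (T n) (fun j => (hn j).1) (fun j => (hn j).2)]
  rw [show √(k n : ℝ) ^ p * (k n : ℝ) ^ (p ^ 2) = starNorm p (k n) from rfl, chamberWeight]
  field_simp

/-- The one-time density at an interior point of the chamber, as it comes out of the counting
formula. -/
noncomputable def limitDensity (p : ℕ) (t : ℝ) (x : Fin p → ℝ) : ℝ :=
  (√(2 / Real.pi) * 2 ^ (2 * p - 1)) ^ p * Real.exp (-(∑ j, x j ^ 2) / (2 * t * (1 - t))) /
    starNorm p (t * (1 - t)) * chamberWeight x ^ 2 /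
      chamberWeight (fun j : Fin p => 2 * (j : ℝ) + 1) / 2 ^ p

lemma chamberWeight_start_pos (p : ℕ) : 0 < chamberWeight (fun j : Fin p => 2 * (j : ℝ) + 1) := by
  unfold chamberWeight
  refine mul_pos (Finset.prod_pos fun j _ => by positivity)
    (Finset.prod_pos fun i _ => Finset.prod_pos fun j hj => ?_)
  have hij : (i : ℕ) < j := Fin.lt_def.1 (Finset.mem_Ioi.1 hj)
  have h1 : (i : ℝ) < j := by exact_mod_cast hij
  have h2 : (0 : ℝ) ≤ i := by positivity
  have : 0 < (2 * (j : ℝ) + 1) ^ 2 - (2 * (i : ℝ) + 1) ^ 2 := by nlinarith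
  positivity

/-- The local limit theorem for watermelons: the probability of being at `y n` at time `k n`, times
the number `(√(2n) / 2) ^ p` of lattice points per unit volume. -/
lemma tendsto_starDet_mul_div {p : ℕ} (hp : 1 ≤ p) {k : ℕ → ℕ} (hk : ∀ n, k n ≤ 2 * n)
    {y : ℕ → Fin p → ℤ} (hpar : ∀ n j, (2 : ℤ) ∣ y n j - k n) {t : ℝ} (ht0 : 0 < t) (ht1 : t < 1)
    {x : Fin p → ℝ} (hkt : Tendsto (fun n => (k n : ℝ) / (2 * n : ℕ)) atTop (𝓝 t))
    (hy : ∀ j, Tendsto (fun n => (y n j : ℝ) / √((2 * n : ℕ) : ℝ)) atTop (𝓝 (x j))) :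
    Tendsto (fun n => (starDet (k n) (startPoint p) (y n) : ℝ) *
      starDet (2 * n - k n) (startPoint p) (y n) /
        starDet (2 * n) (startPoint p) (startPoint p) * (√((2 * n : ℕ) : ℝ) / 2) ^ p) atTop
      (𝓝 (limitDensity p t x)) := by
  have hN : Tendsto (fun n : ℕ => 2 * n) atTop atTop :=
    tendsto_atTop_mono (fun n => by simp only [id]; omega) tendsto_id
  have hNr : Tendsto (fun n : ℕ => ((2 * n : ℕ) : ℝ)) atTop atTop :=
    tendsto_natCast_atTop_atTop.comp hN
  have hkt' : Tendsto (fun n => ((2 * n - k n : ℕ) : ℝ) / (2 * n : ℕ)) atTop (𝓝 (1 - t)) := by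
    refine (hkt.const_sub 1).congr' ?_
    filter_upwards [hNr.eventually_gt_atTop 0] with n hn
    rw [Nat.cast_sub (hk n), sub_div, div_self hn.ne']
  -- both factors of the numerator are in the diffusive scaling, with times `t` and `1 - t`
  have aux : ∀ {m : ℕ → ℕ} {τ : ℝ}, 0 < τ →
      Tendsto (fun n => (m n : ℝ) / (2 * n : ℕ)) atTop (𝓝 τ) →
      Tendsto m atTop atTop ∧
        ∀ j, Tendsto (fun n => (y n j : ℝ) / √(m n)) atTop (𝓝 (x j / √τ)) := by
    intro m τ hτ hm
    constructor
    · have h := hm.pos_mul_atTop hτ hNr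
      refine tendsto_natCast_atTop_iff.1 (h.congr' ?_)
      filter_upwards [hNr.eventually_gt_atTop 0] with n hn
      rw [div_mul_cancel₀ _ hn.ne']
    · intro j
      refine ((hy j).div hm.sqrt (Real.sqrt_pos.2 hτ).ne').congr' ?_
      filter_upwards [hNr.eventually_gt_atTop 0] with n hn
      simp only [Pi.div_apply]
      rw [Real.sqrt_div (Nat.cast_nonneg _), div_div_div_cancel_right₀ (Real.sqrt_pos.2 hn).ne']
  obtain ⟨hk1, hy1⟩ := aux ht0 hkt
  obtain ⟨hk2, hy2⟩ := aux (sub_pos.2 ht1) hkt'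
  obtain ⟨A1, hA1, hD1⟩ := exists_tendsto_starDet hp hpar hk1 hy1
  obtain ⟨A2, hA2, hD2⟩ := exists_tendsto_starDet hp (k := fun n => 2 * n - k n) (y := y)
    (fun n j => by have := hpar n j; have := hk n; omega) hk2 hy2
  obtain ⟨A3, hA3, hD3⟩ := exists_tendsto_starDet hp (k := fun n => 2 * n)
    (y := fun _ => startPoint p) (l := atTop) (ξ := fun _ => 0)
    (fun n j => by simp only [startPoint]; omega) hN
    (fun j => tendsto_const_nhds.div_atTop (Real.tendsto_sqrt_atTop.comp hNr))
  have hη : Tendsto (fun n => chamberWeight (fun j => ((y n j : ℝ) + 1) / √((2 * n : ℕ) : ℝ)))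
      atTop (𝓝 (chamberWeight x)) := by
    refine (continuous_chamberWeight.tendsto x).comp (tendsto_pi_nhds.2 fun j => ?_)
    have := (hy j).add ((tendsto_const_nhds (x := (1 : ℝ))).div_atTop
      (Real.tendsto_sqrt_atTop.comp hNr))
    rw [add_zero] at this
    refine this.congr fun n => ?_
    simp only [Function.comp]
    rw [add_div]
  have hBn : Tendsto (fun n => starNorm p ((k n : ℝ) / (2 * n : ℕ) *
      (((2 * n - k n : ℕ) : ℝ) / (2 * n : ℕ)))) atTop (𝓝 (starNorm p (t * (1 - t)))) := by
    have : Continuous (starNorm p) := by unfold starNorm; fun_prop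
    exact (this.tendsto _).comp (hkt.mul hkt')
  have ht' : 0 < t * (1 - t) := mul_pos ht0 (sub_pos.2 ht1)
  have hC : (0 : ℝ) < (√(2 / Real.pi) * 2 ^ (2 * p - 1)) ^ p := by positivity
  have hW0 := chamberWeight_start_pos p
  have hlim := ((((hA1.mul hA2).div hA3 (by positivity)).div hBn (starNorm_pos p ht').ne').mul
    (hη.pow 2)).div_const (chamberWeight (fun j : Fin p => 2 * (j : ℝ) + 1)) |>.div_const (2 ^ p)
  have hval : (√(2 / Real.pi) * 2 ^ (2 * p - 1)) ^ p *
      Real.exp (-(∑ j, (x j / √t) ^ 2) / 2) * ((√(2 / Real.pi) * 2 ^ (2 * p - 1)) ^ p *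
      Real.exp (-(∑ j, (x j / √(1 - t)) ^ 2) / 2)) / ((√(2 / Real.pi) * 2 ^ (2 * p - 1)) ^ p *
      Real.exp (-(∑ j : Fin p, (0 : ℝ) ^ 2) / 2)) = (√(2 / Real.pi) * 2 ^ (2 * p - 1)) ^ p *
        Real.exp (-(∑ j, x j ^ 2) / (2 * t * (1 - t))) := by
    have e1 : ∑ j, (x j / √t) ^ 2 = (∑ j, x j ^ 2) / t := by
      rw [Finset.sum_div]; simp only [div_pow, Real.sq_sqrt ht0.le]
    have e2 : ∑ j, (x j / √(1 - t)) ^ 2 = (∑ j, x j ^ 2) / (1 - t) := by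
      rw [Finset.sum_div]; simp only [div_pow, Real.sq_sqrt (sub_pos.2 ht1).le]
    have e3 : -(∑ j, x j ^ 2) / (2 * t * (1 - t)) =
        -((∑ j, x j ^ 2) / t) / 2 + -((∑ j, x j ^ 2) / (1 - t)) / 2 := by
      have : 1 - t ≠ 0 := (sub_pos.2 ht1).ne'
      field_simp
      ring
    rw [e1, e2, e3, Real.exp_add]
    simp only [ne_eq, OfNat.ofNat_ne_zero, not_false_eq_true, zero_pow, Finset.sum_const_zero,
      neg_zero, zero_div, Real.exp_zero, mul_one]
    field_simp
  rw [hval] at hlim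
  refine hlim.congr' ?_
  filter_upwards [hD1, hD2, hD3, hNr.eventually_gt_atTop 0, hk1.eventually_gt_atTop 0,
    hk2.eventually_gt_atTop 0] with n h1 h2 h3 hn hkn1 hkn2
  have hk1' : (0 : ℝ) < k n := by exact_mod_cast hkn1
  have hk2' : (0 : ℝ) < (2 * n - k n : ℕ) := by exact_mod_cast hkn2
  simp only [Pi.div_apply]
  have hs : (chamberWeight fun j => (y n j : ℝ) + 1) ^ 2 = ((2 * n : ℕ) : ℝ) ^ (p ^ 2) *
      chamberWeight (fun j => ((y n j : ℝ) + 1) / √((2 * n : ℕ) : ℝ)) ^ 2 := by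
    have := chamberWeight_smul_sq (c := √((2 * n : ℕ) : ℝ))
      (fun j => ((y n j : ℝ) + 1) / √((2 * n : ℕ) : ℝ))
    rw [Real.sq_sqrt hn.le] at this
    rw [← this]
    congr 2
    funext j
    rw [mul_div_cancel₀ _ (Real.sqrt_pos.2 hn).ne']
  have hstart : (chamberWeight fun j => ((startPoint p j : ℤ) : ℝ) + 1) =
      chamberWeight (fun j : Fin p => 2 * (j : ℝ) + 1) := by
    congr 1; funext j; simp [startPoint]
  have hpow : (2 : ℝ) ^ (k n * p) * 2 ^ ((2 * n - k n) * p) = 2 ^ (2 * n * p) := by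
    rw [← pow_add, ← add_mul, Nat.add_sub_cancel' (hk n)]
  have hBmul : starNorm p ((2 * n : ℕ) : ℝ) * ((2 * n : ℕ) : ℝ) ^ (p ^ 2) *
      √((2 * n : ℕ) : ℝ) ^ p = starNorm p ((2 * n : ℕ) : ℝ) * starNorm p ((2 * n : ℕ) : ℝ) := by
    simp only [starNorm]; ring
  rw [h1, h2, h3, hstart, starNorm_mul p (by positivity), div_eq_mul_inv (k n : ℝ),
    div_eq_mul_inv ((2 * n - k n : ℕ) : ℝ), starNorm_mul p hk1'.le, starNorm_mul p hk2'.le]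
  have hinv : starNorm p (((2 * n : ℕ) : ℝ)⁻¹) = (starNorm p ((2 * n : ℕ) : ℝ))⁻¹ := by
    simp only [starNorm, Real.sqrt_inv, inv_pow, mul_inv]
  rw [hinv]
  have b1 := (starNorm_pos p hk1').ne'
  have b2 := (starNorm_pos p hk2').ne'
  have b3 := (starNorm_pos p hn).ne'
  have hW0' := hW0.ne'
  set V := chamberWeight (fun j => (y n j : ℝ) + 1)
  set V' := chamberWeight (fun j => ((y n j : ℝ) + 1) / √((2 * n : ℕ) : ℝ))
  set V0 := chamberWeight (fun j : Fin p => 2 * (j : ℝ) + 1)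
  set B1 := starNorm p (k n)
  set B2 := starNorm p ((2 * n - k n : ℕ) : ℝ)
  set B3 := starNorm p ((2 * n : ℕ) : ℝ)
  rw [div_pow]
  trans (A1 n * A2 n / A3 n) * (B3 * (((2 * n : ℕ) : ℝ) ^ (p ^ 2) * √((2 * n : ℕ) : ℝ) ^ p)) *
    V' ^ 2 / (B1 * B2 * V0 * 2 ^ p)
  · rw [← mul_assoc B3, hBmul]
    field_simp
  · trans (A1 n * A2 n / A3 n) * (B3 * √((2 * n : ℕ) : ℝ) ^ p) * (V ^ 2) *
      ((2 : ℝ) ^ (k n * p) * 2 ^ ((2 * n - k n) * p) / 2 ^ (2 * n * p)) / (B1 * B2 * V0 * 2 ^ p)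
    · rw [hs, hpow, div_self (by positivity)]
      ring
    · rcases eq_or_ne (A3 n) 0 with h0 | h0
      · simp [h0]
      · field_simp

/-! ### The limit density in closed form -/

lemma prod_odd_mul (p : ℕ) :
    (∏ j : Fin p, (2 * (j : ℝ) + 1)) * (2 ^ p * p.factorial) = (2 * p).factorial := by
  rw [Fin.prod_univ_eq_prod_range (fun j : ℕ => 2 * (j : ℝ) + 1) p]
  induction p with
  | zero => simp
  | succ p ih =>
    rw [Finset.prod_range_succ, show 2 * (p + 1) = 2 * p + 1 + 1 by ring,
      Nat.factorial_succ (2 * p + 1), Nat.factorial_succ (2 * p), Nat.factorial_succ p, pow_succ]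
    push_cast
    rw [← ih]
    ring

lemma starNorm_eq_rpow (p : ℕ) {m : ℝ} (hm : 0 < m) :
    starNorm p m = m ^ ((p : ℝ) ^ 2 + (p : ℝ) / 2) := by
  rw [starNorm, Real.rpow_add hm, Real.sqrt_eq_rpow, ← Real.rpow_natCast, ← Real.rpow_mul hm.le,
    ← Real.rpow_natCast]
  push_cast
  ring_nf

/-- The powers of `2` and of `π` in the normalization. -/
lemma limitDensity_const {p : ℕ} (hp : 1 ≤ p) :
    (√(2 / Real.pi) * 2 ^ (2 * p - 1)) ^ p = 4 ^ (p ^ 2) / 4 ^ p *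
      ((2 : ℝ) ^ (3 * (p : ℝ) / 2) / Real.pi ^ ((p : ℝ) / 2)) := by
  have h1 : (2 : ℝ) ^ (3 * (p : ℝ) / 2) = 2 ^ p * √2 ^ p := by
    rw [Real.sqrt_eq_rpow, ← Real.rpow_natCast, ← Real.rpow_natCast, ← Real.rpow_mul (by norm_num),
      ← Real.rpow_add (by norm_num)]
    ring_nf
  have h2 : Real.pi ^ ((p : ℝ) / 2) = √Real.pi ^ p := by
    rw [Real.sqrt_eq_rpow, ← Real.rpow_natCast, ← Real.rpow_mul Real.pi_pos.le]
    ring_nf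
  have h3 : (2 : ℝ) ^ ((2 * p - 1) * p) * 4 ^ p = 4 ^ (p ^ 2) * 2 ^ p := by
    rw [show (4 : ℝ) = 2 ^ 2 by norm_num, ← pow_mul, ← pow_mul, ← pow_add, ← pow_add]
    congr 1
    obtain ⟨q, rfl⟩ : ∃ q, p = q + 1 := ⟨p - 1, by omega⟩
    rw [show 2 * (q + 1) - 1 = 2 * q + 1 by omega]
    ring
  rw [h1, h2, Real.sqrt_div (by norm_num), mul_pow, div_pow, ← pow_mul]
  have hpi : √Real.pi ^ p ≠ 0 := by positivity
  field_simp
  linear_combination h3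

lemma density_eq_limitDensity {p : ℕ} (hp : 1 ≤ p) {t : ℝ} (ht0 : 0 < t) (ht1 : t < 1)
    {x : EuclideanSpace ℝ (Fin p)} (hx0 : ∀ i, 0 ≤ x i) (hx : ∀ i j, i ≤ j → x i ≤ x j) :
    density p t x = limitDensity p t x := by
  rw [density, if_pos ⟨hx0, hx⟩, limitDensity, limitDensity_const hp,
    starNorm_eq_rpow p (mul_pos ht0 (sub_pos.2 ht1)), EuclideanSpace.real_norm_sq_eq, densityConst]
  have hV0 : chamberWeight (fun j : Fin p => 2 * (j : ℝ) + 1) =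
      (2 * p).factorial / (2 ^ p * p.factorial) * ∏ i : Fin p, ∏ j ∈ Finset.Ioi i,
        (((j : ℕ) : ℝ) - ((i : ℕ) : ℝ)) * (((j : ℕ) : ℝ) + ((i : ℕ) : ℝ) + 1) := by
    rw [chamberWeight, ← prod_odd_mul p, mul_div_cancel_right₀ _ (by positivity)]
    congr 1
    refine Finset.prod_congr rfl fun i _ => Finset.prod_congr rfl fun j _ => ?_
    ring
  have hV : chamberWeight x ^ 2 * 4 ^ (p ^ 2) = (∏ i : Fin p, ∏ j ∈ Finset.Ioi i,
      (x j ^ 2 - x i ^ 2) ^ 2) * (∏ i : Fin p, x i ^ 2) * 4 ^ p := by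
    rw [chamberWeight, mul_pow, ← Finset.prod_pow, ← prod_Ioi_const_sq_mul p 4]
    rw [show ∀ a b c : ℝ, a * b ^ 2 * (c ^ 2 * 4 ^ p) = (b * c) ^ 2 * a * 4 ^ p by
      intros; ring]
    congr 2
    simp only [← Finset.prod_mul_distrib, ← Finset.prod_pow]
    refine Finset.prod_congr rfl fun i _ => Finset.prod_congr rfl fun j _ => ?_
    ring
  have hpos := chamberWeight_start_pos p
  rw [hV0] at hpos ⊢
  have hP := (pos_iff_pos_of_mul_pos hpos).1 (by positivity)
  set Q := ∏ i : Fin p, ∏ j ∈ Finset.Ioi i,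
        (((j : ℕ) : ℝ) - ((i : ℕ) : ℝ)) * (((j : ℕ) : ℝ) + ((i : ℕ) : ℝ) + 1)
  have hV' : (∏ i : Fin p, ∏ j ∈ Finset.Ioi i, (x j ^ 2 - x i ^ 2) ^ 2) * (∏ i : Fin p, x i ^ 2) =
      chamberWeight x ^ 2 * 4 ^ (p ^ 2) / 4 ^ p := by
    rw [hV, mul_div_cancel_right₀ _ (by positivity)]
  rw [mul_assoc _ (∏ i : Fin p, ∏ j ∈ Finset.Ioi i, (x j ^ 2 - x i ^ 2) ^ 2)
    (∏ i : Fin p, x i ^ 2), hV']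
  field_simp

/-! ### Convergence in distribution from the local limit -/

lemma uniformOn_apply_eq_card_div {α : Type*} [MeasurableSpace α] [MeasurableSingletonClass α]
    {s : Set α} (hs : s.Finite) (t : Set α) :
    uniformOn s t = ENNReal.ofReal ((Nat.card ↥(s ∩ t) : ℝ) / Nat.card s) := by
  classical
  rcases s.eq_empty_or_nonempty with rfl | hne
  · simp
  have hcard : 0 < Nat.card s := by
    have := hne.to_subtype
    have := hs.to_subtype
    exact Nat.card_pos
  rw [uniformOn, cond_apply hs.measurableSet, Measure.count_apply_finite _ hs,
    Measure.count_apply_finite _ (hs.inter_of_left t), ENNReal.ofReal_div_of_pos (by positivity),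
    ENNReal.ofReal_natCast, ENNReal.ofReal_natCast, Nat.card_eq_card_finite_toFinset hs,
    Nat.card_eq_card_finite_toFinset (hs.inter_of_left t), div_eq_mul_inv, mul_comm]

/-- The point of the lattice of positions at time `k`, scaled by `1 / N`, that lies just below
`x`. -/
noncomputable def latticeFloor {p : ℕ} (k : ℕ) (N : ℝ) (x : Fin p → ℝ) : Fin p → ℤ :=
  fun j => k + 2 * ⌊(x j * N - k) / 2⌋

lemma latticeFloor_le {p : ℕ} (k : ℕ) (N : ℝ) (x : Fin p → ℝ) (j : Fin p) :
    (latticeFloor k N x j : ℝ) ≤ x j * N := by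
  have := Int.floor_le ((x j * N - k) / 2)
  simp only [latticeFloor]
  push_cast
  linarith

lemma lt_latticeFloor {p : ℕ} (k : ℕ) (N : ℝ) (x : Fin p → ℝ) (j : Fin p) :
    x j * N < latticeFloor k N x j + 2 := by
  have := Int.lt_floor_add_one ((x j * N - k) / 2)
  simp only [latticeFloor]
  push_cast
  linarith

lemma measurable_latticeFloor {p : ℕ} (k : ℕ) (N : ℝ) :
    Measurable (latticeFloor (p := p) k N) := by
  refine measurable_pi_lambda _ fun j => ?_
  have h : Measurable fun x : Fin p → ℝ => ⌊(x j * N - k) / 2⌋ :=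
    Int.measurable_floor.comp (by fun_prop)
  exact (measurable_of_countable (fun m : ℤ => (k : ℤ) + 2 * m)).comp h

/-- The points that are rounded down to a given lattice point lie in a cube of side `2 / N`. -/
lemma volume_latticeFloor_preimage_le {p : ℕ} (k : ℕ) {N : ℝ} (hN : 0 < N) (y : Fin p → ℤ) :
    volume (latticeFloor k N ⁻¹' {y}) ≤ ENNReal.ofReal ((N / 2) ^ p)⁻¹ := by
  have hsub : latticeFloor k N ⁻¹' {y} ⊆
      Set.pi Set.univ fun j => Set.Ico ((y j : ℝ) / N) ((y j + 2) / N) := by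
    rintro x rfl j -
    exact ⟨(div_le_iff₀ hN).2 (latticeFloor_le k N x j),
      (lt_div_iff₀ hN).2 (lt_latticeFloor k N x j)⟩
  refine (measure_mono hsub).trans_eq ?_
  rw [Real.volume_pi_Ico, ← ENNReal.ofReal_prod_of_nonneg]
  · congr 1
    rw [← inv_pow, inv_div]
    have : ∀ j, ((y j : ℝ) + 2) / N - y j / N = 2 / N := fun j => by ring
    simp [this, div_pow]
  · intro j _
    have : ((y j : ℝ) + 2) / N - y j / N = 2 / N := by ring
    rw [this]; positivity

lemma tendsto_latticeFloor_div {p : ℕ} {k : ℕ → ℕ} {N : ℕ → ℝ} (hN : Tendsto N atTop atTop)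
    (x : Fin p → ℝ) (j : Fin p) :
    Tendsto (fun n => (latticeFloor (k n) (N n) x j : ℝ) / N n) atTop (𝓝 (x j)) := by
  have h1 : Tendsto (fun n => x j - 2 / N n) atTop (𝓝 (x j - 0)) :=
    (tendsto_const_nhds.div_atTop hN).const_sub _
  rw [sub_zero] at h1
  refine tendsto_of_tendsto_of_tendsto_of_le_of_le' h1 tendsto_const_nhds ?_ ?_
  · filter_upwards [hN.eventually_gt_atTop 0] with n hn
    rw [le_div_iff₀ hn, sub_mul, div_mul_cancel₀ _ hn.ne']
    linarith [lt_latticeFloor (k n) (N n) x j]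
  · filter_upwards [hN.eventually_gt_atTop 0] with n hn
    rw [div_le_iff₀ hn]
    exact latticeFloor_le (k n) (N n) x j

lemma measurableSet_walks {p N : ℕ} (s : Set (Fin (N + 1) → Fin p → ℤ)) : MeasurableSet s :=
  s.to_countable.measurableSet

/-- The probability of being in `G` dominates the integral over `G` of the rescaled one-time
probabilities, as every cell of the lattice has the volume `(2 / √(2n)) ^ p`. -/
lemma lintegral_latticeFloor_le {p n : ℕ} (hn : 0 < n) (t : unitInterval)
    (G : Set (EuclideanSpace ℝ (Fin p))) :
    ∫⁻ x : Fin p → ℝ, ENNReal.ofReal ((√((2 * n : ℕ) : ℝ) / 2) ^ p) *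
      uniformOn (watermelons p (2 * n)) {w | renormalize w t ∈ G ∧
        w (timeIndex n t) = latticeFloor (timeIndex n t) √((2 * n : ℕ) : ℝ) x} ≤
      uniformOn (watermelons p (2 * n)) {w | renormalize w t ∈ G} := by
  have hN : (0 : ℝ) < √((2 * n : ℕ) : ℝ) := Real.sqrt_pos.2 (by exact_mod_cast (by omega))
  set μ := uniformOn (watermelons p (2 * n))
  set c := ENNReal.ofReal ((√((2 * n : ℕ) : ℝ) / 2) ^ p)
  let ℓ := latticeFloor (p := p) (timeIndex n t) √((2 * n : ℕ) : ℝ)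
  let F : (Fin p → ℤ) → ℝ≥0∞ := fun y => μ {w | renormalize w t ∈ G ∧ w (timeIndex n t) = y}
  have hF : Measurable F := measurable_of_countable F
  calc ∫⁻ x : Fin p → ℝ, c * F (ℓ x)
      = c * ∫⁻ y, F y ∂(Measure.map ℓ volume) := by
        rw [lintegral_const_mul c (f := fun x => F (ℓ x))
          (hF.comp (measurable_latticeFloor _ _)), lintegral_map hF (measurable_latticeFloor _ _)]
    _ = c * ∑' y, F y * (Measure.map ℓ volume) {y} := by rw [lintegral_countable']
    _ ≤ c * ∑' y, F y * c⁻¹ := by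
        gcongr with y
        rw [Measure.map_apply (measurable_latticeFloor _ _) (MeasurableSet.singleton y)]
        refine (volume_latticeFloor_preimage_le _ hN y).trans_eq ?_
        rw [ENNReal.ofReal_inv_of_pos (by positivity)]
    _ = ∑' y, F y := by
        rw [ENNReal.tsum_mul_right, mul_left_comm, ENNReal.mul_inv_cancel, mul_one]
        · exact (ENNReal.ofReal_pos.2 (by positivity)).ne'
        · exact ENNReal.ofReal_ne_top
    _ = μ (⋃ y, {w | renormalize w t ∈ G ∧ w (timeIndex n t) = y}) := by
        rw [measure_iUnion]
        · intro y y' hne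
          rw [Function.onFun, Set.disjoint_left]
          rintro w ⟨-, h⟩ ⟨-, h'⟩
          exact hne (h.symm.trans h')
        · exact fun y => measurableSet_walks _
    _ = _ := by
        congr 1
        ext w
        simp

lemma tendsto_timeIndex_div (t : unitInterval) :
    Tendsto (fun n : ℕ => ((timeIndex n t : ℕ) : ℝ) / (2 * n : ℕ)) atTop (𝓝 (t : ℝ)) := by
  have hN : Tendsto (fun n : ℕ => ((2 * n : ℕ) : ℝ)) atTop atTop :=
    tendsto_natCast_atTop_atTop.comp (tendsto_atTop_mono (fun n => by simp only [id]; omega)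
      tendsto_id)
  have := (tendsto_nat_floor_mul_div_atTop (R := ℝ) (a := (t : ℝ)) t.2.1).comp hN
  refine this.congr fun n => ?_
  simp only [Function.comp, timeIndex]
  push_cast
  rw [mul_comm (t : ℝ)]

/-- The one-time probabilities as quotients of counting determinants. -/
lemma uniformOn_watermelons_apply {p N : ℕ} (k : Fin (N + 1)) {y : Fin p → ℤ} (hy : InChamber y)
    (hpar : ∀ i j, (2 : ℤ) ∣ y i - y j) :
    uniformOn (watermelons p N) {w | w k = y} = ENNReal.ofReal
      ((starDet k (startPoint p) y : ℝ) * starDet (N - k) (startPoint p) y /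
        starDet N (startPoint p) (startPoint p)) := by
  rw [uniformOn_apply_eq_card_div (finite_watermelons p N)]
  have h1 := card_watermelons_inter p N k hy hpar
  have h2 := card_watermelons p N
  rw [show (Nat.card ↥(watermelons p N ∩ {w | w k = y}) : ℝ) =
      ((Nat.card ↥(watermelons p N ∩ {w | w k = y}) : ℤ) : ℝ) by simp, h1,
    show (Nat.card (watermelons p N) : ℝ) = ((Nat.card (watermelons p N) : ℤ) : ℝ) by simp, h2]
  push_cast
  rfl

/-- The density vanishes on the boundary of the chamber. -/
lemma pos_and_lt_of_density_ne_zero {p : ℕ} {t : ℝ} {x : EuclideanSpace ℝ (Fin p)}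
    (h : density p t x ≠ 0) : (∀ i, 0 < x i) ∧ ∀ i j, i < j → x i < x j := by
  rw [density] at h
  split_ifs at h with hx
  · have h1 := left_ne_zero_of_mul h
    have h2 := right_ne_zero_of_mul h1
    have h3 := right_ne_zero_of_mul (left_ne_zero_of_mul h1)
    refine ⟨fun i => (hx.1 i).lt_of_ne fun h0 => ?_, fun i j hij =>
      (hx.2 i j hij.le).lt_of_ne fun h0 => ?_⟩
    · exact h2 (Finset.prod_eq_zero (Finset.mem_univ i) (by rw [← h0]; ring))
    · exact h3 (Finset.prod_eq_zero (Finset.mem_univ i)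
        (Finset.prod_eq_zero (Finset.mem_Ioi.2 hij) (by rw [h0]; ring)))
  · exact absurd rfl h

/-- Pointwise convergence of the rescaled one-time probabilities. The event `renormalize w t ∈ G` is
eventually implied, as `G` is open, and on the boundary of the chamber the density vanishes. -/
lemma ofReal_density_le_liminf {p : ℕ} (hp : 1 ≤ p) (t : unitInterval) (ht0 : 0 < (t : ℝ))
    (ht1 : (t : ℝ) < 1) {G : Set (EuclideanSpace ℝ (Fin p))} (hG : IsOpen G) (x : Fin p → ℝ) :
    G.indicator (fun x => ENNReal.ofReal (density p t x)) (WithLp.toLp 2 x) ≤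
      liminf (fun n : ℕ => ENNReal.ofReal ((√((2 * n : ℕ) : ℝ) / 2) ^ p) *
        uniformOn (watermelons p (2 * n)) {w | renormalize w t ∈ G ∧
          w (timeIndex n t) = latticeFloor (timeIndex n t) √((2 * n : ℕ) : ℝ) x}) atTop := by
  by_cases hxG : WithLp.toLp 2 x ∈ G
  swap
  · simp [hxG]
  rw [Set.indicator_of_mem hxG]
  by_cases hd : density p t (WithLp.toLp 2 x) = 0
  · simp [hd]
  obtain ⟨hpos, hlt⟩ := pos_and_lt_of_density_ne_zero hd
  simp only at hpos hlt
  have hNr : Tendsto (fun n : ℕ => ((2 * n : ℕ) : ℝ)) atTop atTop :=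
    tendsto_natCast_atTop_atTop.comp (tendsto_atTop_mono (fun n => by simp only [id]; omega)
      tendsto_id)
  have hN : Tendsto (fun n : ℕ => √((2 * n : ℕ) : ℝ)) atTop atTop :=
    Real.tendsto_sqrt_atTop.comp hNr
  let y : ℕ → Fin p → ℤ := fun n => latticeFloor (timeIndex n t) √((2 * n : ℕ) : ℝ) x
  have hy : ∀ j, Tendsto (fun n => (y n j : ℝ) / √((2 * n : ℕ) : ℝ)) atTop (𝓝 (x j)) :=
    fun j => tendsto_latticeFloor_div hN x j
  have hlim := tendsto_starDet_mul_div hp (k := fun n => timeIndex n t)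
    (fun n => Nat.lt_succ_iff.1 (timeIndex n t).2) (y := y)
    (fun n j => by simp only [y, latticeFloor]; omega) ht0 ht1 (tendsto_timeIndex_div t) hy
  rw [← show density p t (WithLp.toLp 2 x) = limitDensity p t x from
    density_eq_limitDensity hp ht0 ht1 (x := WithLp.toLp 2 x) (fun i => (hpos i).le)
      (fun i j hij => by
        rcases hij.eq_or_lt with rfl | h
        · exact le_rfl
        · exact (hlt i j h).le)] at hlim
  have hlim' := (ENNReal.continuous_ofReal.tendsto _).comp hlim
  refine (hlim'.congr' ?_).liminf_eq.ge
  have hcG : ∀ᶠ n in atTop, (WithLp.toLp 2 fun j => (y n j : ℝ) / √((2 * n : ℕ) : ℝ)) ∈ G := by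
    have : Tendsto (fun n => WithLp.toLp 2 fun j => (y n j : ℝ) / √((2 * n : ℕ) : ℝ)) atTop
        (𝓝 (WithLp.toLp 2 x)) :=
      ((PiLp.continuous_toLp 2 _).tendsto x).comp (tendsto_pi_nhds.2 hy)
    exact this.eventually (hG.mem_nhds hxG)
  have hch : ∀ᶠ n in atTop, InChamber (y n) := by
    have h1 : ∀ᶠ n in atTop, ∀ i j, i < j → y n i < y n j := by
      rw [eventually_all]; intro i
      rw [eventually_all]; intro j
      by_cases hij : i < j
      · filter_upwards [(hy i).eventually_lt (hy j) (hlt i j hij), hN.eventually_gt_atTop 0]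
          with n hn hpos _
        rw [div_lt_div_iff_of_pos_right hpos] at hn
        exact_mod_cast hn
      · exact Eventually.of_forall fun n h => absurd h hij
    have h2 : ∀ᶠ n in atTop, ∀ i, 0 ≤ y n i := by
      rw [eventually_all]; intro i
      filter_upwards [(hy i).eventually_const_lt (hpos i), hN.eventually_gt_atTop 0] with n hn hpos
      have := (div_pos_iff_of_pos_right hpos).1 hn
      exact_mod_cast this.le
    filter_upwards [h1, h2] with n a b using ⟨a, b⟩
  filter_upwards [hcG, hch] with n h1 h2
  have hset : {w : Fin (2 * n + 1) → Fin p → ℤ | renormalize w t ∈ G ∧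
      w (timeIndex n t) = latticeFloor (timeIndex n t) √((2 * n : ℕ) : ℝ) x} =
      {w | w (timeIndex n t) = y n} := by
    ext w
    simp only [Set.mem_ofPred_eq]
    refine ⟨fun h => h.2, fun h => ⟨?_, h⟩⟩
    rw [renormalize, h]
    push_cast at h1
    exact h1
  rw [hset, uniformOn_watermelons_apply _ h2 (fun i j => by simp only [y, latticeFloor]; omega),
    ← ENNReal.ofReal_mul (by positivity), Function.comp, mul_comm]

/-- The liminf condition of the portmanteau theorem, by Fatou's lemma. -/
lemma withDensity_le_liminf {p : ℕ} (hp : 1 ≤ p) (t : unitInterval) (ht0 : 0 < (t : ℝ))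
    (ht1 : (t : ℝ) < 1) {G : Set (EuclideanSpace ℝ (Fin p))} (hG : IsOpen G) :
    (volume.withDensity fun x => ENNReal.ofReal (density p t x)) G ≤
      liminf (fun n : ℕ => uniformOn (watermelons p (2 * n)) {w | renormalize w t ∈ G}) atTop := by
  rw [withDensity_apply _ hG.measurableSet, ← lintegral_indicator hG.measurableSet,
    ← (PiLp.volume_preserving_toLp (Fin p)).lintegral_comp_emb
      (MeasurableEquiv.toLp 2 (Fin p → ℝ)).measurableEmbedding]
  refine (lintegral_mono fun x => ofReal_density_le_liminf hp t ht0 ht1 hG x).trans ?_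
  refine (lintegral_liminf_le fun n => ?_).trans ?_
  · refine Measurable.const_mul ?_ _
    exact (measurable_of_countable (fun y : Fin p → ℤ => uniformOn (watermelons p (2 * n))
      {w | renormalize w t ∈ G ∧ w (timeIndex n t) = y})).comp (measurable_latticeFloor _ _)
  · refine liminf_le_liminf ?_
    filter_upwards [eventually_gt_atTop 0] with n hn
    exact lintegral_latticeFloor_le hn t G

/-- All the branches can alternate between `2i - 2` and `2i - 1`. -/
lemma watermelons_nonempty (p n : ℕ) : (watermelons p (2 * n)).Nonempty := by
  refine ⟨fun k i => 2 * (i : ℤ) + (k : ℕ) % 2, ?_, ?_, ?_, ?_, ?_⟩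
  · intro i; simp
  · intro i; simp
  · intro k i; simp; omega
  · intro k i j hij
    have : (i : ℕ) < j := hij
    simp only; omega
  · intro k i; simp only; omega

lemma measurable_renormalize {p n : ℕ} (t : unitInterval) :
    Measurable fun w : Fin (2 * n + 1) → Fin p → ℤ => renormalize w t :=
  measurable_of_countable _

lemma map_renormalize_apply {p n : ℕ} {Ω : Type*} [MeasurableSpace Ω] {P : Measure Ω}
    {W : Ω → Fin (2 * n + 1) → Fin p → ℤ} (hW : HasLaw W (uniformOn (watermelons p (2 * n))) P)
    (t : unitInterval) {G : Set (EuclideanSpace ℝ (Fin p))} (hG : MeasurableSet G) :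
    (P.map fun ω => renormalize (W ω) t) G =
      uniformOn (watermelons p (2 * n)) {w | renormalize w t ∈ G} := by
  rw [← hW.map_eq, Measure.map_apply_of_aemeasurable hW.aemeasurable (measurableSet_walks _)]
  exact Measure.map_apply_of_aemeasurable
    ((measurable_renormalize t).comp_aemeasurable hW.aemeasurable) hG

/-- Convergence in distribution of the watermelon at a time in `(0, 1)`, towards any variable whose
law has the density `density p t`. -/
lemma tendstoInDistribution_renormalize {p : ℕ} (hp : 1 ≤ p)
    {Ω : ℕ → Type*} [∀ n, MeasurableSpace (Ω n)] (P : ∀ n, Measure (Ω n))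
    [∀ n, IsProbabilityMeasure (P n)]
    (W : ∀ n, Ω n → Fin (2 * n + 1) → Fin p → ℤ)
    (hW : ∀ n, HasLaw (W n) (uniformOn (watermelons p (2 * n))) (P n))
    {Ω' : Type*} [MeasurableSpace Ω'] (Q : Measure Ω') [IsProbabilityMeasure Q]
    (t : unitInterval) (ht0 : 0 < (t : ℝ)) (ht1 : (t : ℝ) < 1)
    {Z : Ω' → EuclideanSpace ℝ (Fin p)}
    (hZ : HasLaw Z (volume.withDensity fun x => ENNReal.ofReal (density p t x)) Q) :
    TendstoInDistribution (fun n ω => renormalize (W n ω) t) atTop Z P Q where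
  forall_aemeasurable n := (measurable_renormalize t).comp_aemeasurable (hW n).aemeasurable
  aemeasurable_limit := hZ.aemeasurable
  tendsto := by
    refine tendsto_of_forall_isOpen_le_liminf' fun G hG => ?_
    simp only [ProbabilityMeasure.coe_mk]
    rw [hZ.map_eq]
    refine (withDensity_le_liminf hp t ht0 ht1 hG).trans_eq ?_
    congr 1
    funext n
    exact (map_renormalize_apply (hW n) t hG.measurableSet).symm

/-- At the times `0` and `1` the rescaled watermelon is deterministic and of order `1 / √n`. -/
lemma tendstoInDistribution_renormalize_endpoint {p : ℕ}
    {Ω : ℕ → Type*} [∀ n, MeasurableSpace (Ω n)] (P : ∀ n, Measure (Ω n))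
    [∀ n, IsProbabilityMeasure (P n)]
    (W : ∀ n, Ω n → Fin (2 * n + 1) → Fin p → ℤ)
    (hW : ∀ n, HasLaw (W n) (uniformOn (watermelons p (2 * n))) (P n))
    {Ω' : Type*} [MeasurableSpace Ω'] (Q : Measure Ω') [IsProbabilityMeasure Q]
    (t : unitInterval) (ht : t = 0 ∨ t = 1) :
    TendstoInDistribution (fun n ω => renormalize (W n ω) t) atTop
      (fun _ : Ω' => (0 : EuclideanSpace ℝ (Fin p))) P Q where
  forall_aemeasurable n := (measurable_renormalize t).comp_aemeasurable (hW n).aemeasurable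
  aemeasurable_limit := aemeasurable_const
  tendsto := by
    refine tendsto_of_forall_isOpen_le_liminf' fun G hG => ?_
    simp only [ProbabilityMeasure.coe_mk]
    rw [Measure.map_apply measurable_const hG.measurableSet]
    by_cases h0 : (0 : EuclideanSpace ℝ (Fin p)) ∈ G
    swap
    · simp [h0]
    have hlim : Tendsto (fun n : ℕ => WithLp.toLp 2 fun i : Fin p =>
        (startPoint p i : ℝ) / √(2 * (n : ℝ))) atTop (𝓝 (0 : EuclideanSpace ℝ (Fin p))) := by
      refine ((PiLp.continuous_toLp 2 _).tendsto (0 : Fin p → ℝ)).comp (tendsto_pi_nhds.2 fun j =>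
        tendsto_const_nhds.div_atTop (Real.tendsto_sqrt_atTop.comp ?_))
      exact tendsto_natCast_atTop_atTop.const_mul_atTop (by norm_num)
    refine le_of_eq_of_le ?_ (le_liminf_of_le (a := 1) (by isBoundedDefault) ?_)
    · simp [h0]
    filter_upwards [hlim.eventually (hG.mem_nhds h0)] with n hn
    refine le_of_eq ((map_renormalize_apply (hW n) t hG.measurableSet).trans ?_).symm
    refine uniformOn_eq_one_of (finite_watermelons p (2 * n)) (watermelons_nonempty p n)
      fun w hw => ?_
    have hwt : w (timeIndex n t) = startPoint p := by
      rcases ht with rfl | rfl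
      · rw [show timeIndex n 0 = 0 by ext; simp [timeIndex]]
        exact funext hw.1
      · rw [show timeIndex n 1 = Fin.last (2 * n) by
          ext
          simp only [timeIndex, Set.Icc.coe_one, mul_one, Fin.val_last]
          exact_mod_cast Nat.floor_natCast (R := ℝ) (2 * n)]
        exact funext hw.2.1
    simp only [Set.mem_ofPred_eq, renormalize, hwt]
    exact hn

/-! ### Interlacing sequences as coordinates for the weights of a rational function -/

section Interlacing

variable {m : ℕ}

/-- The Vandermonde product. -/
noncomputable def vand (x : Fin m → ℝ) : ℝ := ∏ i : Fin m, ∏ j ∈ Finset.Ioi i, (x j - x i)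

/-- The sequences `b` with `c 0 < b 0 < c 1 < b 1 < ...`; the last term of `b` is not bounded
above. -/
def interlaceSet (c : Fin m → ℝ) : Set (Fin m → ℝ) :=
  {b | (∀ k, c k < b k) ∧ ∀ k l, k < l → b k < c l}

/-- The weights `w` for which the rational function `1 - ∑ w k / (y - c k)` has the zeros `b`. They
are written so that each factor is visibly positive when `b` interlaces with `c`. -/
noncomputable def interlaceWeight (c b : Fin m → ℝ) (k : Fin m) : ℝ :=
  (b k - c k) * ∏ j ∈ Finset.univ.erase k, (c k - b j) / (c k - c j)

open Polynomial in
/-- The numerator of `1 - ∑ w k / (y - c k)`. -/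
noncomputable def secularPoly (c w : Fin m → ℝ) : ℝ[X] :=
  ∏ j, (X - C (c j)) - ∑ k, C (w k) * ∏ j ∈ Finset.univ.erase k, (X - C (c j))

lemma vand_eq_det (x : Fin m → ℝ) : vand x = (Matrix.vandermonde x).det := by
  rw [Matrix.det_vandermonde, vand]

lemma vand_pos {x : Fin m → ℝ} (hx : StrictMono x) : 0 < vand x :=
  Finset.prod_pos fun _ _ => Finset.prod_pos fun _ hj => sub_pos.2 (hx (Finset.mem_Ioi.1 hj))

lemma strictMono_of_mem_interlaceSet {c b : Fin m → ℝ} (hb : b ∈ interlaceSet c) :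
    StrictMono b := fun k l h => (hb.2 k l h).trans (hb.1 l)

lemma interlaceWeight_pos {c b : Fin m → ℝ} (hc : StrictMono c) (hb : b ∈ interlaceSet c)
    (k : Fin m) : 0 < interlaceWeight c b k := by
  refine mul_pos (sub_pos.2 (hb.1 k)) (Finset.prod_pos fun j hj => ?_)
  rcases lt_or_gt_of_ne (Finset.ne_of_mem_erase hj) with h | h
  · exact div_pos (sub_pos.2 (hb.2 j k h)) (sub_pos.2 (hc h))
  · exact div_pos_of_neg_of_neg (sub_neg.2 ((hc h).trans (hb.1 j))) (sub_neg.2 (hc h))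

lemma prod_erase_sub_ne_zero {c : Fin m → ℝ} (hc : Function.Injective c) (k : Fin m) :
    ∏ j ∈ Finset.univ.erase k, (c k - c j) ≠ 0 :=
  Finset.prod_ne_zero_iff.2 fun _ hj => sub_ne_zero.2 (hc.ne (Finset.ne_of_mem_erase hj).symm)

/-- The weights are the residues of the quotient of the polynomials with roots `b` and `c`. -/
lemma interlaceWeight_eq (c b : Fin m → ℝ) (k : Fin m) :
    interlaceWeight c b k =
      -(∏ j, (c k - b j)) / ∏ j ∈ Finset.univ.erase k, (c k - c j) := by
  rw [interlaceWeight, Finset.prod_div_distrib,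
    ← Finset.mul_prod_erase Finset.univ (fun j => c k - b j) (Finset.mem_univ k)]
  ring

open Polynomial in
lemma monic_secularPoly (c w : Fin m → ℝ) :
    (secularPoly c w).Monic ∧ (secularPoly c w).natDegree = m := by
  have hmon : (∏ j, (X - C (c j)) : ℝ[X]).Monic :=
    monic_prod_of_monic _ _ fun j _ => monic_X_sub_C _
  have hdeg : (∏ j, (X - C (c j)) : ℝ[X]).degree = m := by simp [degree_prod]
  have hlt : (∑ k, C (w k) * ∏ j ∈ Finset.univ.erase k, (X - C (c j)) : ℝ[X]).degree <
      (∏ j, (X - C (c j)) : ℝ[X]).degree := by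
    rw [hdeg]
    refine (degree_sum_le _ _).trans_lt ((Finset.sup_lt_iff ?_).2 fun k _ => ?_)
    · exact WithBot.bot_lt_coe _
    · refine (degree_mul_le _ _).trans_lt ((add_le_add degree_C_le le_rfl).trans_lt ?_)
      rw [zero_add, degree_prod]
      simp only [degree_X_sub_C, Finset.sum_const, Finset.card_erase_of_mem (Finset.mem_univ k),
        Finset.card_univ, Fintype.card_fin, nsmul_eq_mul, mul_one]
      have := k.2
      exact_mod_cast (by omega : m - 1 < m)
  refine ⟨hmon.sub_of_left hlt, natDegree_eq_of_degree_eq_some ?_⟩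
  rw [secularPoly, degree_sub_eq_left_of_degree_lt hlt, hdeg]

open Polynomial in
lemma eval_secularPoly_node (c w : Fin m → ℝ) (k : Fin m) :
    (secularPoly c w).eval (c k) = -(w k * ∏ j ∈ Finset.univ.erase k, (c k - c j)) := by
  rw [secularPoly, eval_sub, eval_prod, eval_finsetSum,
    Finset.prod_eq_zero (Finset.mem_univ k) (by simp), zero_sub,
    Finset.sum_eq_single k]
  · simp [eval_prod]
  · intro l _ hl
    rw [eval_mul, eval_prod, Finset.prod_eq_zero (i := k) (by simp [hl.symm]) (by simp), mul_zero]
  · simp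

open Polynomial in
/-- Two monic polynomials of degree `m` that agree at `m` points are equal. -/
lemma eq_of_monic_of_eval_eq {P Q : ℝ[X]} (hP : P.Monic ∧ P.natDegree = m)
    (hQ : Q.Monic ∧ Q.natDegree = m) {v : Fin m → ℝ} (hv : Function.Injective v)
    (h : ∀ k, P.eval (v k) = Q.eval (v k)) : P = Q := by
  rcases Nat.eq_zero_or_pos m with rfl | hm
  · rw [eq_one_of_monic_natDegree_zero hP.1 hP.2, eq_one_of_monic_natDegree_zero hQ.1 hQ.2]
  refine Polynomial.eq_of_degree_sub_lt_of_eval_index_eq Finset.univ hv.injOn ?_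
    fun k _ => h k
  rw [Finset.card_univ, Fintype.card_fin]
  have hd : P.degree = Q.degree := by
    rw [degree_eq_natDegree hP.1.ne_zero, degree_eq_natDegree hQ.1.ne_zero, hP.2, hQ.2]
  refine (degree_sub_lt_left hd hP.1.ne_zero (by rw [hP.1, hQ.1])).trans_eq ?_
  rw [degree_eq_natDegree hP.1.ne_zero, hP.2]

open Polynomial in
lemma monic_prod_X_sub_C (b : Fin m → ℝ) :
    (∏ j, (X - C (b j)) : ℝ[X]).Monic ∧ (∏ j, (X - C (b j)) : ℝ[X]).natDegree = m :=
  ⟨monic_prod_of_monic _ _ fun j _ => monic_X_sub_C _, by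
    rw [natDegree_prod_of_monic _ _ fun j _ => monic_X_sub_C _]; simp⟩

open Polynomial in
/-- Partial fractions: both sides are monic of degree `m` and agree at the nodes `c k`. -/
lemma prod_X_sub_C_eq_secularPoly {c : Fin m → ℝ} (hc : Function.Injective c) (b : Fin m → ℝ) :
    ∏ j, (X - C (b j)) = secularPoly c (interlaceWeight c b) := by
  refine eq_of_monic_of_eval_eq (monic_prod_X_sub_C b) (monic_secularPoly c _) hc fun k => ?_
  rw [eval_secularPoly_node, interlaceWeight_eq, div_mul_cancel₀ _ (prod_erase_sub_ne_zero hc k)]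
  simp [eval_prod]

open Polynomial in
/-- Comparison of the coefficients of degree `m - 1`. -/
lemma sum_interlaceWeight {c : Fin m → ℝ} (hc : Function.Injective c) (b : Fin m → ℝ) :
    ∑ k, interlaceWeight c b k = ∑ k, b k - ∑ k, c k := by
  rcases Nat.eq_zero_or_pos m with rfl | hm
  · simp
  have h := congrArg (fun P => P.coeff (m - 1)) (prod_X_sub_C_eq_secularPoly hc b)
  have hcard : (Finset.univ : Finset (Fin m)).card = m := by simp
  have h1 := prod_X_sub_C_coeff_card_pred (Finset.univ : Finset (Fin m)) b (by rw [hcard]; exact hm)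
  have h2 := prod_X_sub_C_coeff_card_pred (Finset.univ : Finset (Fin m)) c (by rw [hcard]; exact hm)
  rw [hcard] at h1 h2
  simp only [secularPoly, coeff_sub, finsetSum_coeff, coeff_C_mul, h1, h2] at h
  have h3 : ∀ k : Fin m, (∏ j ∈ Finset.univ.erase k, (X - C (c j)) : ℝ[X]).coeff (m - 1) = 1 := by
    intro k
    have hmon : (∏ j ∈ Finset.univ.erase k, (X - C (c j)) : ℝ[X]).Monic :=
      monic_prod_of_monic _ _ fun j _ => monic_X_sub_C _
    have hdeg : (∏ j ∈ Finset.univ.erase k, (X - C (c j)) : ℝ[X]).natDegree = m - 1 := by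
      rw [natDegree_prod_of_monic _ _ fun j _ => monic_X_sub_C _]
      simp [Finset.card_erase_of_mem]
    rw [← hdeg]; exact hmon
  simp only [h3, mul_one] at h
  linarith

lemma neg_one_pow_mul_prod_erase_pos {c : Fin m → ℝ} (hc : StrictMono c) (k : Fin m) :
    0 < (-1 : ℝ) ^ (m - 1 - (k : ℕ)) * ∏ j ∈ Finset.univ.erase k, (c k - c j) := by
  have hdisj : Disjoint (Finset.Iio k) (Finset.Ioi k) := by
    rw [Finset.disjoint_left]; intro a ha hb
    exact lt_asymm (Finset.mem_Iio.1 ha) (Finset.mem_Ioi.1 hb)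
  have hun : Finset.univ.erase k = (Finset.Iio k).disjUnion (Finset.Ioi k) hdisj := by
    ext j; simp [lt_or_lt_iff_ne]
  rw [hun, Finset.prod_disjUnion, mul_left_comm]
  refine mul_pos (Finset.prod_pos fun j hj => sub_pos.2 (hc (Finset.mem_Iio.1 hj))) ?_
  rw [← Fin.card_Ioi, ← Finset.prod_const, ← Finset.prod_mul_distrib]
  refine Finset.prod_pos fun j hj => ?_
  have := hc (Finset.mem_Ioi.1 hj)
  linarith

open Polynomial in
/-- For positive weights, the secular polynomial has a zero between any two consecutive nodes and
one above the last node, by its signs at the nodes and at infinity. -/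
lemma exists_interlaceWeight_eq {c : Fin m → ℝ} (hc : StrictMono c) {w : Fin m → ℝ}
    (hw : ∀ k, 0 < w k) : ∃ b ∈ interlaceSet c, interlaceWeight c b = w := by
  have hmon := monic_secularPoly c w
  have hsign : ∀ k : Fin m, 0 < (-1 : ℝ) ^ (m - (k : ℕ)) * (secularPoly c w).eval (c k) := by
    intro k
    have h1 := mul_pos (hw k) (neg_one_pow_mul_prod_erase_pos hc k)
    rw [eval_secularPoly_node, show m - (k : ℕ) = (m - 1 - k) + 1 by have := k.2; omega, pow_succ]
    linarith
  have hroot : ∀ k : Fin m, ∃ z, c k < z ∧ (∀ l, k < l → z < c l) ∧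
      (secularPoly c w).eval z = 0 := by
    intro k
    -- the right end of the interval in which the zero is found
    obtain ⟨u, hu, hul, hus⟩ : ∃ u, c k < u ∧ (∀ l, k < l → u ≤ c l) ∧
        0 < (-1 : ℝ) ^ (m - (k : ℕ) - 1) * (secularPoly c w).eval u := by
      by_cases hk : (k : ℕ) + 1 < m
      · refine ⟨c ⟨k + 1, hk⟩, hc (Fin.lt_def.2 (by simp)), fun l hl => hc.monotone
          (Fin.le_def.2 (Fin.lt_def.1 hl)), ?_⟩
        exact hsign ⟨k + 1, hk⟩
      · have hm : 0 < m := k.pos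
        have hdeg : 0 < (secularPoly c w).degree := by
          rw [degree_eq_natDegree hmon.1.ne_zero, hmon.2]; exact_mod_cast hm
        have htop := (secularPoly c w).tendsto_atTop_of_leadingCoeff_nonneg hdeg
          (by rw [hmon.1]; norm_num)
        obtain ⟨u, hu1, hu2⟩ :=
          ((htop.eventually_gt_atTop 0).and (eventually_gt_atTop (c k))).exists
        refine ⟨u, hu2, fun l hl => absurd (Fin.lt_def.1 hl) (by omega), ?_⟩
        rw [show m - (k : ℕ) - 1 = 0 by omega, pow_zero, one_mul]
        exact hu1
    have hcont : ContinuousOn (fun z => (-1 : ℝ) ^ (m - (k : ℕ)) * (secularPoly c w).eval z)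
        (Set.Icc (c k) u) := (continuous_const.mul (secularPoly c w).continuous).continuousOn
    have hneg : (-1 : ℝ) ^ (m - (k : ℕ)) * (secularPoly c w).eval u < 0 := by
      rw [show m - (k : ℕ) = (m - k - 1) + 1 by have := k.2; omega, pow_succ]
      linarith
    obtain ⟨z, hz, hz0⟩ := intermediate_value_Ioo' hu.le hcont ⟨hneg, hsign k⟩
    refine ⟨z, hz.1, fun l hl => hz.2.trans_le (hul l hl), ?_⟩
    exact (mul_eq_zero.1 hz0).resolve_left (pow_ne_zero _ (by norm_num))
  choose b hb1 hb2 hb3 using hroot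
  have hb : b ∈ interlaceSet c := ⟨hb1, hb2⟩
  refine ⟨b, hb, ?_⟩
  have hpoly : ∏ j, (X - C (b j)) = secularPoly c w := by
    refine eq_of_monic_of_eval_eq (monic_prod_X_sub_C b) hmon
      (strictMono_of_mem_interlaceSet hb).injective fun k => ?_
    rw [hb3, eval_prod]
    exact Finset.prod_eq_zero (Finset.mem_univ k) (by simp)
  funext k
  have h := congrArg (fun P => P.eval (c k)) hpoly
  simp only [eval_secularPoly_node, eval_prod, eval_sub, eval_X, eval_C] at h
  rw [interlaceWeight_eq, h, neg_neg,
    mul_div_cancel_right₀ _ (prod_erase_sub_ne_zero hc.injective k)]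

open Polynomial in
lemma injOn_interlaceWeight {c : Fin m → ℝ} (hc : StrictMono c) :
    Set.InjOn (interlaceWeight c) (interlaceSet c) := by
  intro b hb b' hb' h
  have hpoly : (∏ j, (X - C (b j)) : ℝ[X]) = ∏ j, (X - C (b' j)) := by
    rw [prod_X_sub_C_eq_secularPoly hc.injective, prod_X_sub_C_eq_secularPoly hc.injective, h]
  funext k
  have h1 := congrArg (fun P => P.eval (b k)) hpoly
  simp only [eval_prod, eval_sub, eval_X, eval_C] at h1
  rw [Finset.prod_eq_zero (Finset.mem_univ k) (sub_self _), eq_comm, Finset.prod_eq_zero_iff] at h1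
  obtain ⟨j, -, hj⟩ := h1
  rw [sub_eq_zero] at hj
  rcases lt_trichotomy j k with h2 | rfl | h2
  · exact absurd hj ((hb'.2 j k h2).trans (hb.1 k)).ne'
  · exact hj
  · exact absurd hj ((hb.2 k j h2).trans (hb'.1 j)).ne

lemma image_interlaceWeight {c : Fin m → ℝ} (hc : StrictMono c) :
    interlaceWeight c '' interlaceSet c = {w | ∀ k, 0 < w k} := by
  ext w
  constructor
  · rintro ⟨b, hb, rfl⟩ k
    exact interlaceWeight_pos hc hb k
  · intro hw
    obtain ⟨b, hb, h⟩ := exists_interlaceWeight_eq hc hw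
    exact ⟨b, hb, h⟩

lemma isOpen_interlaceSet (c : Fin m → ℝ) : IsOpen (interlaceSet c) := by
  have : interlaceSet c = (⋂ k, {b : Fin m → ℝ | c k < b k}) ∩
      ⋂ k, ⋂ l, ⋂ _ : k < l, {b : Fin m → ℝ | b k < c l} := by
    ext b; simp [interlaceSet]
  rw [this]
  refine (isOpen_iInter_of_finite fun k => isOpen_lt continuous_const (continuous_apply k)).inter
    (isOpen_iInter_of_finite fun k => isOpen_iInter_of_finite fun l =>
      isOpen_iInter_of_finite fun _ => isOpen_lt (continuous_apply k) continuous_const)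

lemma continuous_interlaceWeight (c : Fin m → ℝ) : Continuous (interlaceWeight c) := by
  unfold interlaceWeight
  fun_prop

/-- The Jacobian matrix of the weights as functions of the zeros. -/
noncomputable def interlaceJacobian (c b : Fin m → ℝ) : Matrix (Fin m) (Fin m) ℝ :=
  Matrix.of fun k j => (∏ i ∈ Finset.univ.erase k, (c k - c i))⁻¹ *
    ∏ l ∈ Finset.univ.erase j, (c k - b l)

lemma hasFDerivAt_interlaceWeight (c b : Fin m → ℝ) :
    HasFDerivAt (interlaceWeight c)
      (LinearMap.toContinuousLinearMap (Matrix.toLin' (interlaceJacobian c b))) b := by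
  rw [hasFDerivAt_pi']
  intro k
  have h1 : ∀ j ∈ (Finset.univ : Finset (Fin m)), HasFDerivAt (fun b : Fin m → ℝ => c k - b j)
      (-(ContinuousLinearMap.proj j : (Fin m → ℝ) →L[ℝ] ℝ)) b := fun j _ =>
    (ContinuousLinearMap.proj j : (Fin m → ℝ) →L[ℝ] ℝ).hasFDerivAt.const_sub (c k)
  have h2 := (HasFDerivAt.finsetProd h1).neg.const_mul
    (∏ i ∈ Finset.univ.erase k, (c k - c i))⁻¹
  have hfun : (fun b => interlaceWeight c b k) = fun b =>
      (∏ i ∈ Finset.univ.erase k, (c k - c i))⁻¹ * -∏ j, (c k - b j) := by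
    funext b; rw [interlaceWeight_eq, div_eq_inv_mul]
  rw [hfun]
  refine h2.congr_fderiv ?_
  ext v
  simp [interlaceJacobian, Matrix.mulVec, dotProduct, Finset.mul_sum, mul_assoc]

open Polynomial in
/-- Polynomials of degree less than `m`, evaluated at `m` points, in terms of their coefficients. -/
lemma of_eval_eq_vandermonde_mul (v : Fin m → ℝ) (R : Fin m → ℝ[X])
    (hR : ∀ j, (R j).natDegree < m) : (Matrix.of fun i j => (R j).eval (v i)) =
      Matrix.vandermonde v * Matrix.of fun i j : Fin m => (R j).coeff i := by
  ext i j
  rw [Matrix.mul_apply, Matrix.of_apply, eval_eq_sum_range' (hR j), Finset.sum_range]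
  refine Finset.sum_congr rfl fun l _ => ?_
  simp [Matrix.vandermonde_apply, mul_comm]

lemma abs_prod_prod_erase (x : Fin m → ℝ) :
    |∏ k, ∏ j ∈ Finset.univ.erase k, (x k - x j)| = vand x ^ 2 := by
  have h := Finset.prod_prod_Ioi_mul_eq_prod_prod_off_diag (fun j i : Fin m => x i - x j)
  have h' : ∀ k : Fin m, ({k}ᶜ : Finset (Fin m)) = Finset.univ.erase k := fun k => by ext; simp
  simp only [h'] at h
  rw [← h, vand, ← sq_abs, Finset.abs_prod, Finset.abs_prod, ← Finset.prod_pow]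
  refine Finset.prod_congr rfl fun i _ => ?_
  rw [Finset.abs_prod, Finset.abs_prod, ← Finset.prod_pow]
  refine Finset.prod_congr rfl fun j _ => ?_
  rw [abs_mul, abs_sub_comm, sq]

open Polynomial in
/-- Up to the factors of the rows, the Jacobian matrix has the entries `R j (c k)` with `R j` the
product of the `X - b l` over `l ≠ j`. It is therefore a Vandermonde matrix in `c` times the matrix
of coefficients of the `R j`, and the determinant of the latter is found by evaluating at `b`, where
the matrix is diagonal. -/
lemma abs_det_interlaceJacobian {c b : Fin m → ℝ} (hc : StrictMono c) (hb : StrictMono b) :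
    |(interlaceJacobian c b).det| = vand b / vand c := by
  have hVc := vand_pos hc
  have hVb := vand_pos hb
  let R : Fin m → ℝ[X] := fun j => ∏ l ∈ Finset.univ.erase j, (X - C (b l))
  have hR : ∀ j, (R j).natDegree < m := by
    intro j
    simp only [R]
    rw [natDegree_prod_of_monic _ _ fun j _ => monic_X_sub_C _]
    have := j.2
    simp [Finset.card_erase_of_mem]
    omega
  have heval : ∀ (v : Fin m → ℝ) i j, (R j).eval (v i) =
      ∏ l ∈ Finset.univ.erase j, (v i - b l) := fun v i j => by simp [R, eval_prod]
  have h1 := congrArg Matrix.det (of_eval_eq_vandermonde_mul c R hR)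
  have h2 := congrArg Matrix.det (of_eval_eq_vandermonde_mul b R hR)
  have h3 : (Matrix.of fun i j => (R j).eval (b i)).det =
      ∏ k, ∏ j ∈ Finset.univ.erase k, (b k - b j) := by
    rw [show (Matrix.of fun i j => (R j).eval (b i)) =
      Matrix.diagonal fun k => ∏ j ∈ Finset.univ.erase k, (b k - b j) by
        ext i j
        rw [Matrix.of_apply, heval]
        by_cases h : i = j
        · subst h; simp
        · rw [Matrix.diagonal_apply_ne _ h]
          exact Finset.prod_eq_zero (i := i) (by simp [h]) (sub_self _)]
    exact Matrix.det_diagonal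
  rw [Matrix.det_mul, ← vand_eq_det] at h1 h2
  rw [h3] at h2
  have hJ : (interlaceJacobian c b).det = (∏ k, (∏ i ∈ Finset.univ.erase k, (c k - c i))⁻¹) *
      (Matrix.of fun i j => (R j).eval (c i)).det := by
    rw [← Matrix.det_mul_column]
    congr 1
    ext i j
    simp [interlaceJacobian, heval]
  have h4 := congrArg abs h2
  rw [abs_prod_prod_erase, abs_mul, abs_of_pos hVb] at h4
  rw [hJ, h1, abs_mul, abs_mul, Finset.prod_inv_distrib, abs_inv, abs_prod_prod_erase,
    abs_of_pos hVc]
  have h5 : |(Matrix.of fun i j : Fin m => (R j).coeff i).det| = vand b := by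
    have : vand b * vand b = vand b * |(Matrix.of fun i j : Fin m => (R j).coeff i).det| := by
      rw [← h4]; ring
    exact (mul_left_cancel₀ hVb.ne' this).symm
  rw [h5]
  field_simp

/-- Change of variables from the weights to the zeros. -/
lemma lintegral_pos_eq_lintegral_interlaceSet {c : Fin m → ℝ} (hc : StrictMono c)
    (F : (Fin m → ℝ) → ℝ≥0∞) :
    ∫⁻ w in {w | ∀ k, 0 < w k}, F w =
      ∫⁻ b in interlaceSet c, ENNReal.ofReal (vand b / vand c) * F (interlaceWeight c b) := by
  rw [← image_interlaceWeight hc, lintegral_image_eq_lintegral_abs_det_fderiv_mul volume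
    (isOpen_interlaceSet c).measurableSet
    (fun b _ => (hasFDerivAt_interlaceWeight c b).hasFDerivWithinAt) (injOn_interlaceWeight hc)]
  refine setLIntegral_congr_fun (isOpen_interlaceSet c).measurableSet fun b hb => ?_
  rw [← abs_det_interlaceJacobian hc (strictMono_of_mem_interlaceSet hb)]
  simp [ContinuousLinearMap.det]

end Interlacing

/-! ### Integrals of determinants over interlacing sequences -/

section DetIntegral

variable {p : ℕ}

/-- The sequences that interlace the given `p + 1` points. -/
def interlaceBox (c : Fin (p + 1) → ℝ) : Set (Fin p → ℝ) :=
  Set.pi Set.univ fun i => Set.Ioo (c i.castSucc) (c i.succ)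

lemma measurableSet_interlaceBox (c : Fin (p + 1) → ℝ) : MeasurableSet (interlaceBox c) :=
  MeasurableSet.univ_pi fun _ => measurableSet_Ioo

/-- A determinant of increments is a determinant of values, bordered by a column of ones. -/
lemma det_sub_eq_det_cons (F : Fin p → ℝ → ℝ) (c : Fin (p + 1) → ℝ) :
    (Matrix.of fun j i : Fin p => F j (c i.succ) - F j (c i.castSucc)).det =
      (Matrix.of fun i j : Fin (p + 1) =>
        (Fin.cons 1 fun j => F j (c i) : Fin (p + 1) → ℝ) j).det := by
  let A : Matrix (Fin (p + 1)) (Fin (p + 1)) ℝ := Matrix.of fun i j =>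
    (Fin.cons 1 fun j => F j (c i) : Fin (p + 1) → ℝ) j
  let B : Matrix (Fin (p + 1)) (Fin (p + 1)) ℝ := Matrix.of fun i =>
    (Fin.cons (A 0) fun i j => A i.succ j - A i.castSucc j :
      Fin (p + 1) → Fin (p + 1) → ℝ) i
  have h := Matrix.det_eq_of_forall_row_eq_smul_add_pred (A := A) (B := B) (fun _ => 1)
    (fun j => by simp [B]) (fun i j => by simp [B])
  rw [show (Matrix.of fun i j : Fin (p + 1) =>
    (Fin.cons 1 fun j => F j (c i) : Fin (p + 1) → ℝ) j) = A from rfl, h,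
    Matrix.det_succ_column_zero, Fin.sum_univ_succ, Finset.sum_eq_zero, add_zero]
  · rw [← Matrix.det_transpose]
    simp only [Fin.val_zero, pow_zero, B, A, Matrix.of_apply, Fin.cons_zero, one_mul]
    congr 1
  · intro i _
    simp [B, A]

lemma integrable_det (f : Fin p → ℝ → ℝ) (s : Fin p → Set ℝ)
    (hf : ∀ j i, IntegrableOn (f j) (s i)) :
    IntegrableOn (fun a : Fin p → ℝ => (Matrix.of fun j i => f j (a i)).det)
      (Set.pi Set.univ s) := by
  simp only [Matrix.det_apply', Matrix.of_apply]
  rw [IntegrableOn, volume_pi, Measure.restrict_pi_pi]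
  refine integrable_finsetSum _ fun σ _ => Integrable.const_mul ?_ _
  exact Integrable.fintype_prod fun i => hf (σ i) i

lemma integral_det (f : Fin p → ℝ → ℝ) (s : Fin p → Set ℝ)
    (hf : ∀ j i, IntegrableOn (f j) (s i)) :
    ∫ a in Set.pi Set.univ s, (Matrix.of fun j i => f j (a i)).det =
      (Matrix.of fun j i => ∫ x in s i, f j x).det := by
  simp only [Matrix.det_apply', Matrix.of_apply]
  rw [volume_pi, Measure.restrict_pi_pi, integral_finsetSum]
  · refine Finset.sum_congr rfl fun σ _ => ?_
    rw [integral_const_mul]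
    congr 1
    exact integral_fintype_prod_eq_prod (fun i => f (σ i))
  · intro σ _
    refine Integrable.const_mul ?_ _
    exact Integrable.fintype_prod fun i => hf (σ i) i

/-- A determinant of functions integrates, over the sequences that interlace `c`, to the
determinant of their primitives. -/
lemma lintegral_det_interlaceBox {c : Fin (p + 1) → ℝ} (hc : Monotone c) (f F : Fin p → ℝ → ℝ)
    (hf : ∀ j i : Fin p, IntegrableOn (f j) (Set.Ioo (c i.castSucc) (c i.succ)))
    (hF : ∀ j i : Fin p, ∫ x in (c i.castSucc)..(c i.succ), f j x =
      F j (c i.succ) - F j (c i.castSucc))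
    (hpos : ∀ a ∈ interlaceBox c, 0 ≤ (Matrix.of fun j i => f j (a i)).det) :
    ∫⁻ a in interlaceBox c, ENNReal.ofReal (Matrix.of fun j i => f j (a i)).det =
      ENNReal.ofReal (Matrix.of fun i j : Fin (p + 1) =>
        (Fin.cons 1 fun j => F j (c i) : Fin (p + 1) → ℝ) j).det := by
  rw [← ofReal_integral_eq_lintegral_ofReal (μ := volume.restrict (interlaceBox c))
    (integrable_det f _ hf), interlaceBox, integral_det f _ hf, ← det_sub_eq_det_cons]
  · congr 3
    ext j i
    rw [← hF, intervalIntegral.integral_of_le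
      (hc (Fin.castSucc_lt_succ).le), integral_Ioc_eq_integral_Ioo]
  · exact (ae_restrict_iff' (measurableSet_interlaceBox c)).2 (Eventually.of_forall hpos)

lemma vand_eq_det_of (a : Fin p → ℝ) :
    vand a = (Matrix.of fun j i : Fin p => a i ^ (j : ℕ)).det := by
  rw [vand_eq_det, ← Matrix.det_transpose]
  rfl

lemma strictMono_of_mem_interlaceBox {c : Fin (p + 1) → ℝ} (hc : Monotone c) {a : Fin p → ℝ}
    (ha : a ∈ interlaceBox c) : StrictMono a := by
  intro i j hij
  have h1 := (ha i trivial).2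
  have h2 := (ha j trivial).1
  have h3 : c i.succ ≤ c j.castSucc := hc (Fin.le_def.2 (by simpa using Fin.lt_def.1 hij))
  exact h1.trans (h3.trans_lt h2)

/-- The monomials have monomials as primitives, and so the Vandermonde product of the inner points
integrates to the one of the outer points. -/
lemma lintegral_vand_interlaceBox {c : Fin (p + 1) → ℝ} (hc : Monotone c) :
    ∫⁻ a in interlaceBox c, ENNReal.ofReal (vand a) =
      ENNReal.ofReal (vand c / p.factorial) := by
  simp only [vand_eq_det_of (p := p)]
  rw [lintegral_det_interlaceBox hc (fun j x => x ^ (j : ℕ))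
    (fun j x => x ^ ((j : ℕ) + 1) / ((j : ℕ) + 1))]
  · congr 1
    have : (Matrix.of fun i j : Fin (p + 1) =>
        (Fin.cons 1 fun j : Fin p => c i ^ ((j : ℕ) + 1) / ((j : ℕ) + 1) :
          Fin (p + 1) → ℝ) j) = Matrix.of fun i j : Fin (p + 1) =>
          (Fin.cons 1 fun j : Fin p => (((j : ℕ) + 1 : ℝ))⁻¹ : Fin (p + 1) → ℝ) j *
            Matrix.vandermonde c i j := by
      ext i j
      refine Fin.cases ?_ (fun j => ?_) j
      · simp [Matrix.vandermonde_apply]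
      · simp [Matrix.vandermonde_apply, div_eq_inv_mul]
    rw [this, Matrix.det_mul_row, ← vand_eq_det, Fin.prod_univ_succ]
    simp only [Fin.cons_zero, Fin.cons_succ, one_mul]
    rw [Finset.prod_inv_distrib, Fin.prod_univ_eq_prod_range (fun j : ℕ => (j : ℝ) + 1) p,
      ← Finset.prod_range_add_one_eq_factorial]
    push_cast
    rw [div_eq_inv_mul]
  · intro j i
    exact (continuous_pow _).integrableOn_Icc.mono_set Set.Ioo_subset_Icc_self
  · intro j i
    rw [integral_pow]
    ring
  · intro a ha
    rw [← vand_eq_det_of]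
    exact (vand_pos (strictMono_of_mem_interlaceBox hc ha)).le

lemma det_rpow_mul (a : Fin p → ℝ) (ha : ∀ i, 0 < a i) (r : ℝ) :
    (Matrix.of fun j i : Fin p => a i ^ ((j : ℕ) + r)).det = vand a * ∏ i, a i ^ r := by
  have : (Matrix.of fun j i : Fin p => a i ^ ((j : ℕ) + r)) =
      Matrix.of fun j i : Fin p => a i ^ r * (Matrix.of fun j i : Fin p => a i ^ (j : ℕ)) j i := by
    ext j i
    simp only [Matrix.of_apply]
    rw [Real.rpow_add (ha i), Real.rpow_natCast, mul_comm]
  rw [this, Matrix.det_mul_row, ← vand_eq_det_of, mul_comm]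

/-- The powers `x ^ (j - 1 / 2)` have the primitives `x ^ (j + 1 / 2) / (j + 1 / 2)`, which vanish
at the first of the outer points, namely `0`; the bordered determinant reduces to one of size `p`.
-/
lemma lintegral_vand_mul_interlaceBox {b : Fin p → ℝ} (hb : StrictMono b) (hb0 : ∀ i, 0 < b i) :
    ∫⁻ a in interlaceBox (Fin.cons 0 b : Fin (p + 1) → ℝ),
        ENNReal.ofReal (vand a * ∏ i, a i ^ (-(1 / 2) : ℝ)) =
      ENNReal.ofReal (vand b * (∏ i, b i ^ (1 / 2 : ℝ)) / ∏ j : Fin p, ((j : ℝ) + 1 / 2)) := by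
  set c : Fin (p + 1) → ℝ := Fin.cons 0 b with hcdef
  have hc : StrictMono c := by
    intro i j hij
    induction j using Fin.cases with
    | zero => exact absurd hij (Fin.not_lt_zero i)
    | succ j =>
      induction i using Fin.cases with
      | zero => simpa [c] using hb0 j
      | succ i => simpa [c] using hb (Fin.succ_lt_succ_iff.1 hij)
  have hpos : ∀ a ∈ interlaceBox c, ∀ i, 0 < a i := fun a ha i =>
    lt_of_le_of_lt (by simpa [c] using hc.monotone (Fin.zero_le i.castSucc)) (ha i trivial).1
  have hc0 : ∀ i, 0 ≤ c i := fun i => by simpa [c] using hc.monotone (Fin.zero_le i)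
  rw [setLIntegral_congr_fun (g := fun a => ENNReal.ofReal
    (Matrix.of fun j i : Fin p => a i ^ (((j : ℕ) : ℝ) + -(1 / 2))).det)
    (measurableSet_interlaceBox c) (fun a ha => by
      simp only [det_rpow_mul a (hpos a ha)]),
    lintegral_det_interlaceBox hc.monotone (fun j x => x ^ (((j : ℕ) : ℝ) + -(1 / 2)))
    (fun j x => x ^ (((j : ℕ) : ℝ) + 1 / 2) / (((j : ℕ) : ℝ) + 1 / 2))]
  · have hr0 : (0 : ℝ) < 1 / 2 := by norm_num
    generalize (1 / 2 : ℝ) = r at hr0 ⊢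
    congr 1
    -- the row of the point `0` is `1, 0, ..., 0`
    rw [Matrix.det_succ_row_zero, Fin.sum_univ_succ, Finset.sum_eq_zero]
    · have h1 : ∀ j i : Fin p, b i ^ (((j : ℕ) : ℝ) + r) / (((j : ℕ) : ℝ) + r) =
          (((j : ℕ) : ℝ) + r)⁻¹ *
            (Matrix.of fun j i : Fin p => b i ^ (((j : ℕ) : ℝ) + r)) j i := by
        intro j i; rw [Matrix.of_apply, div_eq_inv_mul]
      have h2 := det_rpow_mul b hb0 r
      have h3 := Matrix.det_mul_column (fun j : Fin p => (((j : ℕ) : ℝ) + r)⁻¹)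
        (Matrix.of fun j i : Fin p => b i ^ (((j : ℕ) : ℝ) + r))
      rw [h2, Finset.prod_inv_distrib] at h3
      rw [div_eq_inv_mul, ← h3, ← Matrix.det_transpose]
      simp only [Fin.val_zero, pow_zero, Matrix.of_apply, Fin.cons_zero, one_mul, add_zero]
      congr 1
      ext j i
      simp [Matrix.submatrix_apply, c, div_eq_inv_mul]
    · intro j _
      have : (0 : ℝ) ^ (((j : ℕ) : ℝ) + r) = 0 := Real.zero_rpow (by positivity)
      simp [c, this]
  · intro j i
    refine ((intervalIntegral.intervalIntegrable_rpow' (a := c i.castSucc)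
      (b := c i.succ) ?_).1).mono_set Set.Ioo_subset_Ioc_self
    have : (0 : ℝ) ≤ (j : ℕ) := by positivity
    linarith
  · intro j i
    have : (0 : ℝ) ≤ (j : ℕ) := by positivity
    rw [integral_rpow (Or.inl (by linarith)),
      show (((j : ℕ) : ℝ) + -(1 / 2) + 1) = ((j : ℕ) : ℝ) + 1 / 2 by ring, sub_div]
  · intro a ha
    rw [det_rpow_mul a (hpos a ha)]
    exact mul_nonneg (vand_pos (strictMono_of_mem_interlaceBox hc.monotone ha)).le
      (Finset.prod_nonneg fun i _ => Real.rpow_nonneg (hpos a ha i).le _)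

end DetIntegral

/-! ### The characteristic polynomial of a bordered antisymmetric matrix -/

section Bordered

variable {n : Type*} [Fintype n] [DecidableEq n]

/-- The antisymmetric matrix obtained from `A` by adding the last column `v` and the last row `-v`.
The new index is the one of the summand `Fin 1`. -/
def borderSkew (A : Matrix n n ℝ) (v : n → ℝ) : Matrix (n ⊕ Fin 1) (n ⊕ Fin 1) ℝ :=
  Matrix.fromBlocks A (Matrix.of fun i _ => v i) (Matrix.of fun _ i => -v i) 0

omit [DecidableEq n] in
lemma mulVec_dotProduct_self_of_skew {A : Matrix n n ℝ} (hA : Aᵀ = -A) (y : n → ℝ) :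
    (A *ᵥ y) ⬝ᵥ y = 0 := by
  have h : (A *ᵥ y) ⬝ᵥ y = -((A *ᵥ y) ⬝ᵥ y) := by
    conv_lhs => rw [← Matrix.vecMul_transpose, ← Matrix.dotProduct_mulVec, hA, Matrix.neg_mulVec,
      dotProduct_neg, dotProduct_comm]
  linarith

/-- The Schur complement, with `y` standing for `(s - A)⁻¹ v`. -/
lemma eval_charpoly_borderSkew {A : Matrix n n ℝ} (v : n → ℝ) {s : ℝ}
    (hdet : A.charpoly.eval s ≠ 0) (y : n → ℝ) (hy : s • y - A *ᵥ y = v) :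
    (borderSkew A v).charpoly.eval s = A.charpoly.eval s * (s + v ⬝ᵥ y) := by
  rw [Matrix.eval_charpoly] at hdet
  rw [Matrix.eval_charpoly, Matrix.eval_charpoly]
  set M := Matrix.scalar n s - A with hM
  have hblock : Matrix.scalar (n ⊕ Fin 1) s - borderSkew A v =
      Matrix.fromBlocks M (Matrix.of fun i _ => -v i) (Matrix.of fun _ i => v i)
        (Matrix.scalar (Fin 1) s) := by
    ext i j
    rcases i with i | i <;> rcases j with j | j <;>
      simp [borderSkew, hM, Matrix.scalar_apply, Matrix.diagonal_apply]
  have hMu : IsUnit M.det := isUnit_iff_ne_zero.2 hdet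
  have : Invertible M := M.invertibleOfIsUnitDet hMu
  have hMy : M *ᵥ y = v := by
    rw [hM, Matrix.sub_mulVec, ← hy]
    congr 1
    ext i
    simp [Matrix.scalar_apply, Matrix.mulVec_diagonal]
  have hinv : ⅟M *ᵥ v = y := by
    rw [← hMy, Matrix.mulVec_mulVec, invOf_mul_self, Matrix.one_mulVec]
  rw [hblock, Matrix.det_fromBlocks₁₁]
  congr 1
  rw [Matrix.det_fin_one]
  have h1 : ((Matrix.of fun (_ : Fin 1) (i : n) => v i) * ⅟M *
      Matrix.of fun (i : n) (_ : Fin 1) => -v i) 0 0 = -(v ⬝ᵥ y) := by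
    rw [Matrix.mul_assoc, Matrix.mul_apply, ← hinv]
    simp only [dotProduct, Matrix.of_apply, Matrix.mulVec, Matrix.mul_apply, mul_neg,
      Finset.sum_neg_distrib]
  rw [Matrix.sub_apply, h1]
  simp [Matrix.scalar_apply]

/-- In an orthonormal eigenbasis of `Aᵀ A`, the characteristic polynomial of the bordered matrix is
a sum over the squares of the coordinates of the border. -/
lemma eval_charpoly_borderSkew_basis {A : Matrix n n ℝ} (hA : Aᵀ = -A)
    (b : OrthonormalBasis n ℝ (EuclideanSpace ℝ n)) (β : n → ℝ)
    (hb : ∀ k, (Aᵀ * A) *ᵥ (b k).ofLp = β k • (b k).ofLp) {s : ℝ}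
    (hdet : A.charpoly.eval s ≠ 0) (hβ : ∀ k, s ^ 2 + β k ≠ 0) (u : n → ℝ) :
    (borderSkew A (fun i => ∑ k, u k * b k i)).charpoly.eval s =
      A.charpoly.eval s * (s * (1 + ∑ k, u k ^ 2 / (s ^ 2 + β k))) := by
  set v : n → ℝ := fun i => ∑ k, u k * b k i with hv
  -- `z = (s² - A²)⁻¹ v`, so that `(s - A)⁻¹ v = s z + A z`
  let z : n → ℝ := ∑ k, (u k / (s ^ 2 + β k)) • (b k).ofLp
  have hv' : v = ∑ k, u k • (b k).ofLp := by
    ext i; simp [hv]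
  have hAA : A *ᵥ (A *ᵥ z) = -((Aᵀ * A) *ᵥ z) := by
    rw [hA, Matrix.mulVec_mulVec, Matrix.neg_mul, Matrix.neg_mulVec, neg_neg]
  have hz : s ^ 2 • z + (Aᵀ * A) *ᵥ z = v := by
    rw [hv', Matrix.mulVec_sum, Finset.smul_sum, ← Finset.sum_add_distrib]
    refine Finset.sum_congr rfl fun k _ => ?_
    rw [Matrix.mulVec_smul, hb, smul_smul, smul_smul, ← add_smul]
    congr 1
    have := hβ k
    field_simp
  have hvz : v ⬝ᵥ z = ∑ k, u k ^ 2 / (s ^ 2 + β k) := by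
    have horth : ∀ k l, (b k).ofLp ⬝ᵥ (b l).ofLp = if k = l then 1 else 0 := by
      intro k l
      have := orthonormal_iff_ite.1 b.orthonormal k l
      rw [← this, EuclideanSpace.inner_eq_star_dotProduct]
      simp [dotProduct_comm]
    rw [hv', sum_dotProduct]
    refine Finset.sum_congr rfl fun k _ => ?_
    simp only [z, dotProduct_sum, smul_dotProduct, dotProduct_smul, horth, smul_eq_mul]
    rw [Finset.sum_eq_single k]
    · simp; ring
    · intro l _ hl; simp [hl.symm]
    · simp
  have hAz : (A *ᵥ z) ⬝ᵥ z = 0 := mulVec_dotProduct_self_of_skew hA z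
  have hAAz : (A *ᵥ (A *ᵥ z)) ⬝ᵥ (A *ᵥ z) = 0 := mulVec_dotProduct_self_of_skew hA _
  have hvA : v ⬝ᵥ (A *ᵥ z) = 0 := by
    rw [← hz, add_dotProduct, smul_dotProduct, dotProduct_comm z, hAz]
    rw [hAA, neg_dotProduct, neg_eq_zero] at hAAz
    rw [hAAz]; simp
  rw [eval_charpoly_borderSkew v hdet (s • z + A *ᵥ z) ?_]
  · rw [dotProduct_add, dotProduct_smul, hvA, hvz, smul_eq_mul]
    ring
  · rw [Matrix.mulVec_add, Matrix.mulVec_smul, hAA, ← hz, smul_add, smul_smul, sq]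
    abel

open Polynomial in
/-- As `Aᵀ = -A`, the matrix `-s² - Aᵀ A` factors into `s - A` and minus its transpose. -/
lemma charpoly_transpose_mul_self {A : Matrix n n ℝ} (hA : Aᵀ = -A) (s : ℝ) :
    ((Aᵀ * A).charpoly).eval (-s ^ 2) = (-1) ^ Fintype.card n * (A.charpoly.eval s) ^ 2 := by
  rw [Matrix.eval_charpoly, Matrix.eval_charpoly]
  have h1 : Matrix.scalar n (-s ^ 2) - Aᵀ * A =
      -((Matrix.scalar n s - A)ᵀ * (Matrix.scalar n s - A)) := by
    rw [Matrix.transpose_sub, hA]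
    have hT : (Matrix.scalar n s)ᵀ = Matrix.scalar n s := by simp [Matrix.scalar_apply]
    have hc : A * Matrix.scalar n s = Matrix.scalar n s * A :=
      (Matrix.scalar_commute s (fun _ => Commute.all _ _) A).symm
    have h2 : Matrix.scalar n (-s ^ 2) = -(Matrix.scalar n s * Matrix.scalar n s) := by
      rw [← map_mul, ← map_neg]; congr 1; ring
    rw [hT, h2, sub_neg_eq_add, add_mul, mul_sub, mul_sub, hc, neg_mul]
    abel
  rw [h1, Matrix.det_neg, Matrix.det_mul, Matrix.det_transpose, sq]

/-- Two families with the same multiset of values differ by a reindexing. -/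
lemma exists_equiv_of_map_univ_eq {α β γ : Type*} [Fintype α] [Fintype β] {f : α → γ} {g : β → γ}
    (h : Finset.univ.val.map f = Finset.univ.val.map g) : ∃ e : α ≃ β, ∀ x, g (e x) = f x := by
  classical
  have hcard : ∀ c, Fintype.card {a // f a = c} = Fintype.card {b // g b = c} := by
    intro c
    have := congrArg (Multiset.count c) h
    rw [Multiset.count_map, Multiset.count_map] at this
    rw [Fintype.card_subtype, Fintype.card_subtype, Finset.card_def, Finset.card_def,
      Finset.filter_val, Finset.filter_val]
    simpa [eq_comm] using this
  refine ⟨((Equiv.sigmaFiberEquiv f).symm.trans (Equiv.sigmaCongrRight fun c =>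
    Fintype.equivOfCardEq (hcard c))).trans (Equiv.sigmaFiberEquiv g), fun x => ?_⟩
  exact (Fintype.equivOfCardEq (hcard (f x)) ⟨x, rfl⟩).2

open Polynomial in
lemma roots_prod_X_sub_C_eq_map {ι R : Type*} [CommRing R] [IsDomain R] [Fintype ι] (f : ι → R) :
    (∏ i, (X - C (f i)) : R[X]).roots = Finset.univ.val.map f := by
  have := roots_multiset_prod_X_sub_C (Finset.univ.val.map f)
  rw [Multiset.map_map] at this
  exact this

open Polynomial in
/-- The eigenvalues of `Aᵀ A` are the numbers `c i`, with multiplicities `d i`. -/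
lemma exists_equiv_eigenvalues {m : ℕ} {A : Matrix n n ℝ} (hA : Aᵀ = -A) {c : Fin m → ℝ}
    {d : Fin m → ℕ} (hcard : Fintype.card n = ∑ i, d i)
    (hχ : ∀ s : ℝ, A.charpoly.eval s ^ 2 = ∏ i, (s ^ 2 + c i) ^ d i)
    (hB : (Aᵀ * A).IsHermitian) :
    ∃ e : n ≃ (i : Fin m) × Fin (d i), ∀ k, c (e k).1 = hB.eigenvalues k := by
  refine exists_equiv_of_map_univ_eq (g := fun x : (i : Fin m) × Fin (d i) => c x.1) ?_
  -- the two polynomials agree at all the points `-s²`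
  have hpoly : (Aᵀ * A).charpoly = ∏ x : (i : Fin m) × Fin (d i), (X - C (c x.1)) := by
    rw [Fintype.prod_sigma]
    simp only [Finset.prod_const, Finset.card_univ, Fintype.card_fin]
    apply Polynomial.eq_of_infinite_eval_eq
    refine (Set.Iic_infinite (0 : ℝ)).mono fun y hy => ?_
    obtain ⟨s, rfl⟩ : ∃ s : ℝ, -s ^ 2 = y := ⟨√(-y), by
      rw [Real.sq_sqrt (neg_nonneg.2 hy), neg_neg]⟩
    simp only [Set.mem_ofPred_eq]
    rw [charpoly_transpose_mul_self hA, hχ, hcard, ← Finset.prod_pow_eq_pow_sum,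
      ← Finset.prod_mul_distrib]
    simp only [eval_pow, eval_prod, eval_X, eval_C, eval_sub]
    refine Finset.prod_congr rfl fun i _ => ?_
    rw [← mul_pow]
    ring
  have hroots := congrArg roots hpoly
  rw [hB.charpoly_eq, roots_prod_X_sub_C_eq_map, roots_prod_X_sub_C_eq_map] at hroots
  simpa only [RCLike.ofReal_real_eq_id, id] using hroots

end Bordered

/-! ### Gaussian vectors and sums of squares of their coordinates -/

section Gaussian

/-- The law of the entries above the diagonal, centred Gaussian of variance `1 / 4`. -/
noncomputable abbrev entryLaw : Measure ℝ := gaussianReal 0 (1 / 4)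

lemma gaussianPDFReal_entry (x : ℝ) :
    gaussianPDFReal 0 (1 / 4) x = √(2 / Real.pi) * Real.exp (-2 * x ^ 2) := by
  rw [gaussianPDFReal, ← Real.sqrt_inv]
  congr 2
  · push_cast; field_simp; norm_num
  · push_cast; ring

lemma entryLaw_eq : entryLaw =
    volume.withDensity fun x => ENNReal.ofReal (√(2 / Real.pi) * Real.exp (-2 * x ^ 2)) := by
  rw [entryLaw, gaussianReal_of_var_ne_zero _ (by norm_num)]
  congr 1
  ext x
  rw [gaussianPDF, gaussianPDFReal_entry]

/-- Rotation invariance of Gaussian vectors with independent coordinates of equal variance. -/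
lemma map_entryLaw_orthonormalBasis {n : Type*} [Fintype n]
    (b : OrthonormalBasis n ℝ (EuclideanSpace ℝ n)) :
    (Measure.pi fun _ : n => entryLaw).map (fun u i => ∑ k, u k * b k i) =
      Measure.pi fun _ : n => entryLaw := by
  have hstd : (Measure.pi fun _ : n => gaussianReal 0 1).map (fun u i => ∑ k, u k * b k i) =
      Measure.pi fun _ : n => gaussianReal 0 1 := by
    have h := (map_pi_eq_stdGaussian (ι := n)).trans (stdGaussian_eq_map_pi_orthonormalBasis b)
    have h2 := congrArg (Measure.map (WithLp.ofLp)) h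
    rw [Measure.map_map (by fun_prop) (by fun_prop), Measure.map_map (by fun_prop) (by fun_prop)]
      at h2
    have e1 : (WithLp.ofLp ∘ WithLp.toLp 2 : (n → ℝ) → n → ℝ) = id := rfl
    rw [e1, Measure.map_id] at h2
    conv_rhs => rw [h2]
    congr 1
    ext u i
    simp
  have hscale : (Measure.pi fun _ : n => gaussianReal 0 1).map (fun u i => (1 / 2 : ℝ) * u i) =
      Measure.pi fun _ : n => entryLaw := by
    have : ∀ i : n, SigmaFinite ((gaussianReal 0 1).map ((1 / 2 : ℝ) * ·)) := by
      intro i; rw [gaussianReal_map_const_mul]; infer_instance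
    rw [Measure.pi_map_pi (fun i => by fun_prop)]
    congr 1
    ext1 i
    rw [gaussianReal_map_const_mul]
    congr 1
    · simp
    · ext; push_cast; norm_num
  rw [← hscale, Measure.map_map (by fun_prop) (by fun_prop)]
  have : (fun u i => ∑ k, u k * b k i) ∘ (fun (u : n → ℝ) i => (1 / 2 : ℝ) * u i) =
      (fun (u : n → ℝ) i => (1 / 2 : ℝ) * u i) ∘ (fun u i => ∑ k, u k * b k i) := by
    ext u i
    simp [Finset.mul_sum, mul_assoc]
  rw [this, ← Measure.map_map (by fun_prop) (by fun_prop), hstd]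

/-- Sums of squares over disjoint groups of coordinates are independent. -/
lemma map_sum_sq_sigma {n : Type*} [Fintype n] {m : ℕ} {d : Fin m → ℕ}
    (e : n ≃ (i : Fin m) × Fin (d i)) :
    (Measure.pi fun _ : n => entryLaw).map (fun u i => ∑ j, u (e.symm ⟨i, j⟩) ^ 2) =
      Measure.pi fun i =>
        (Measure.pi fun _ : Fin (d i) => entryLaw).map (fun y => ∑ j, y j ^ 2) := by
  have h1 := (measurePreserving_piCongrLeft
    (fun _ : (i : Fin m) × Fin (d i) => entryLaw) e).map_eq
  have h2 := Measure.infinitePi_map_piCurry (X := fun (i : Fin m) (_ : Fin (d i)) => ℝ)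
    (fun (i : Fin m) (_ : Fin (d i)) => entryLaw)
  simp only [Measure.infinitePi_eq_pi] at h2
  have hm : ∀ i, Measurable fun y : Fin (d i) → ℝ => ∑ j, y j ^ 2 := fun i => by fun_prop
  have hp : ∀ i, IsProbabilityMeasure
      ((Measure.pi fun _ : Fin (d i) => entryLaw).map (fun y => ∑ j, y j ^ 2)) := fun i =>
    Measure.isProbabilityMeasure_map (hm i).aemeasurable
  rw [← Measure.pi_map_pi (fun i => (hm i).aemeasurable), ← h2, ← h1,
    Measure.map_map (by fun_prop) (by fun_prop), Measure.map_map (by fun_prop) (by fun_prop)]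
  congr 1
  ext u i
  simp only [Function.comp_apply, MeasurableEquiv.coe_piCurry, Sigma.curry]
  refine Finset.sum_congr rfl fun j _ => ?_
  congr 1
  rw [← Equiv.piCongrLeft_apply_apply (fun _ => ℝ) e u (e.symm ⟨i, j⟩), e.apply_symm_apply]
  rfl

/-- The density of the square of an entry. -/
noncomputable def sqDensity (w : ℝ) : ℝ :=
  (Set.Ioi 0).indicator (fun w => √(2 / Real.pi) * w ^ (-(1 / 2) : ℝ) * Real.exp (-2 * w)) w

/-- The density of the sum of the squares of two independent entries. -/
noncomputable def sqSumDensity (w : ℝ) : ℝ :=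
  (Set.Ioi 0).indicator (fun w => 2 * Real.exp (-2 * w)) w

lemma measurable_sqDensity : Measurable sqDensity :=
  Measurable.indicator (by fun_prop) measurableSet_Ioi

lemma measurable_sqSumDensity : Measurable sqSumDensity :=
  Measurable.indicator (by fun_prop) measurableSet_Ioi

lemma sqDensity_nonneg (w : ℝ) : 0 ≤ sqDensity w :=
  Set.indicator_nonneg (fun w (hw : 0 < w) => by positivity) w

lemma sqSumDensity_nonneg (w : ℝ) : 0 ≤ sqSumDensity w :=
  Set.indicator_nonneg (fun w _ => by positivity) w

lemma sqDensity_of_nonpos {w : ℝ} (hw : w ≤ 0) : sqDensity w = 0 :=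
  Set.indicator_of_notMem (by simpa using hw) _

lemma sqSumDensity_of_nonpos {w : ℝ} (hw : w ≤ 0) : sqSumDensity w = 0 :=
  Set.indicator_of_notMem (by simpa using hw) _

lemma lintegral_Ioi_comp_sq (G : ℝ → ℝ≥0∞) :
    ∫⁻ r in Set.Ioi 0, ENNReal.ofReal (2 * r) * G (r ^ 2) = ∫⁻ w in Set.Ioi 0, G w := by
  have himg : (fun r : ℝ => r ^ 2) '' Set.Ioi 0 = Set.Ioi 0 := by
    ext w
    constructor
    · rintro ⟨r, hr, rfl⟩
      exact pow_pos (Set.mem_Ioi.1 hr) 2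
    · exact fun hw => ⟨√w, Real.sqrt_pos.2 hw, Real.sq_sqrt (le_of_lt hw)⟩
  have hinj : Set.InjOn (fun r : ℝ => r ^ 2) (Set.Ioi 0) := fun x hx y hy h =>
    (sq_eq_sq₀ (le_of_lt hx) (le_of_lt hy)).1 h
  conv_rhs => rw [← himg]
  rw [lintegral_image_eq_lintegral_abs_deriv_mul measurableSet_Ioi
    (fun x _ => ((hasDerivAt_pow 2 x).hasDerivWithinAt)) hinj]
  refine setLIntegral_congr_fun measurableSet_Ioi fun r hr => ?_
  simp [abs_of_pos (Set.mem_Ioi.1 hr)]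

/-- The two half-lines contribute equally, which makes up for the factor `2` in the derivative of
the square. -/
lemma lintegral_comp_sq (G : ℝ → ℝ≥0∞) :
    ∫⁻ r, ENNReal.ofReal |r| * G (r ^ 2) = ∫⁻ w in Set.Ioi 0, G w := by
  have h1 := lintegral_Ioi_comp_sq G
  have h2 : ∫⁻ r in Set.Ioi 0, ENNReal.ofReal |r| * G (r ^ 2) = 2⁻¹ * ∫⁻ w in Set.Ioi 0, G w := by
    rw [← h1, ← lintegral_const_mul' _ _ (by norm_num)]
    refine setLIntegral_congr_fun measurableSet_Ioi fun r hr => ?_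
    rw [abs_of_pos (Set.mem_Ioi.1 hr), ← mul_assoc, ENNReal.ofReal_mul (by norm_num),
      ENNReal.ofReal_ofNat, ← mul_assoc, ENNReal.inv_mul_cancel (by norm_num) (by norm_num),
      one_mul]
  have h3 : ∫⁻ r in Set.Iic 0, ENNReal.ofReal |r| * G (r ^ 2) =
      2⁻¹ * ∫⁻ w in Set.Ioi 0, G w := by
    rw [← h2, ← setLIntegral_congr Iio_ae_eq_Iic]
    have := (Measure.measurePreserving_neg (volume : Measure ℝ)).setLIntegral_comp_emb
      (MeasurableEquiv.neg ℝ).measurableEmbedding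
      (fun r => ENNReal.ofReal |r| * G (r ^ 2)) (Set.Iio 0)
    simp only [abs_neg, neg_sq] at this
    rw [this]
    simp
  rw [← lintegral_add_compl _ measurableSet_Ioi (A := Set.Ioi (0 : ℝ)), Set.compl_Ioi, h2, h3,
    ← add_mul, ENNReal.inv_two_add_inv_two, one_mul]

lemma map_sq_entryLaw : entryLaw.map (fun x => x ^ 2) =
    volume.withDensity fun w => ENNReal.ofReal (sqDensity w) := by
  ext s hs
  rw [Measure.map_apply (by fun_prop) hs, entryLaw_eq, withDensity_apply _ (by measurability),
    withDensity_apply _ hs, ← lintegral_indicator (by measurability), ← lintegral_indicator hs]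
  have h : ∀ w, s.indicator (fun w => ENNReal.ofReal (sqDensity w)) w =
      (Set.Ioi 0).indicator (s.indicator (fun w =>
        ENNReal.ofReal (√(2 / Real.pi) * w ^ (-(1 / 2) : ℝ) * Real.exp (-2 * w)))) w := by
    intro w
    by_cases h1 : w ∈ s <;> by_cases h2 : w ∈ Set.Ioi (0 : ℝ) <;> simp [h1, h2, sqDensity]
  simp only [h]
  rw [lintegral_indicator measurableSet_Ioi, ← lintegral_comp_sq]
  refine lintegral_congr_ae ?_
  have h0 : ∀ᵐ x : ℝ, x ≠ 0 := by simp [ae_iff]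
  filter_upwards [h0] with x hx
  have hx' : 0 < |x| := abs_pos.2 hx
  by_cases h1 : x ^ 2 ∈ s
  · rw [Set.indicator_of_mem (by exact h1), Set.indicator_of_mem h1,
      ← ENNReal.ofReal_mul (abs_nonneg x), ← sq_abs x, ← Real.rpow_natCast |x| 2,
      ← Real.rpow_mul hx'.le, Nat.cast_ofNat, show (2 : ℝ) * -(1 / 2) = -1 by norm_num,
      Real.rpow_neg_one]
    congr 1
    field_simp
  · rw [Set.indicator_of_notMem (by exact h1), Set.indicator_of_notMem h1, mul_zero]

/-- In polar coordinates the angle is integrated out; the squared radius is exponential. -/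
lemma map_add_sq_entryLaw : (entryLaw.prod entryLaw).map (fun x => x.1 ^ 2 + x.2 ^ 2) =
    volume.withDensity fun w => ENNReal.ofReal (sqSumDensity w) := by
  ext s hs
  rw [Measure.map_apply (by fun_prop) hs, entryLaw_eq, prod_withDensity (by fun_prop) (by fun_prop),
    withDensity_apply _ (by measurability),
    withDensity_apply _ hs, ← lintegral_indicator (by measurability), ← lintegral_indicator hs,
    ← Measure.volume_eq_prod, ← lintegral_comp_polarCoord_symm, polarCoord_target,
    Measure.volume_eq_prod, ← Measure.prod_restrict]
  have hpt : ∀ q : ℝ × ℝ, ENNReal.ofReal q.1 •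
      ((fun x : ℝ × ℝ => x.1 ^ 2 + x.2 ^ 2) ⁻¹' s).indicator
      (fun z => ENNReal.ofReal (√(2 / Real.pi) * Real.exp (-2 * z.1 ^ 2)) *
        ENNReal.ofReal (√(2 / Real.pi) * Real.exp (-2 * z.2 ^ 2))) (polarCoord.symm q) =
      (ENNReal.ofReal q.1 * s.indicator
        (fun w => ENNReal.ofReal (2 / Real.pi * Real.exp (-2 * w))) (q.1 ^ 2)) * 1 := by
    intro q
    have hsq : (polarCoord.symm q).1 ^ 2 + (polarCoord.symm q).2 ^ 2 = q.1 ^ 2 := by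
      rw [polarCoord_symm_apply]
      linear_combination q.1 ^ 2 * Real.cos_sq_add_sin_sq q.2
    rw [mul_one, smul_eq_mul]
    congr 1
    by_cases h1 : q.1 ^ 2 ∈ s
    · rw [Set.indicator_of_mem (by rw [Set.mem_preimage, hsq]; exact h1), Set.indicator_of_mem h1,
        ← ENNReal.ofReal_mul (by positivity), ← hsq]
      congr 1
      rw [mul_mul_mul_comm, Real.mul_self_sqrt (by positivity), ← Real.exp_add]
      ring_nf
    · rw [Set.indicator_of_notMem (by rw [Set.mem_preimage, hsq]; exact h1),
        Set.indicator_of_notMem h1]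
  simp only [hpt]
  have hmeas : Measurable fun r : ℝ => ENNReal.ofReal r * s.indicator
      (fun w => ENNReal.ofReal (2 / Real.pi * Real.exp (-2 * w))) (r ^ 2) :=
    ENNReal.measurable_ofReal.mul ((Measurable.indicator (by fun_prop) hs).comp (by fun_prop))
  rw [lintegral_prod_mul hmeas.aemeasurable aemeasurable_const, lintegral_const, one_mul,
    Measure.restrict_apply_univ, Real.volume_Ioo]
  have h : ∀ w, s.indicator (fun w => ENNReal.ofReal (sqSumDensity w)) w =
      (Set.Ioi 0).indicator (s.indicator (fun w =>
        ENNReal.ofReal (2 * Real.exp (-2 * w)))) w := by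
    intro w
    by_cases h1 : w ∈ s <;> by_cases h2 : w ∈ Set.Ioi (0 : ℝ) <;> simp [h1, h2, sqSumDensity]
  simp only [h]
  rw [lintegral_indicator measurableSet_Ioi,
    ← lintegral_Ioi_comp_sq (s.indicator fun w => ENNReal.ofReal (2 * Real.exp (-2 * w))),
    ← lintegral_mul_const' _ _ ENNReal.ofReal_ne_top]
  refine setLIntegral_congr_fun measurableSet_Ioi fun r hr => ?_
  by_cases h1 : r ^ 2 ∈ s
  · rw [Set.indicator_of_mem h1, Set.indicator_of_mem h1, ← ENNReal.ofReal_mul (le_of_lt hr),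
      ← ENNReal.ofReal_mul (by
      have := Set.mem_Ioi.1 hr; positivity), ← ENNReal.ofReal_mul (by
      have := Set.mem_Ioi.1 hr; positivity)]
    congr 1
    field_simp
    ring
  · rw [Set.indicator_of_notMem h1, Set.indicator_of_notMem h1, mul_zero, mul_zero, zero_mul]

/-- A product of probability measures with densities has the product density. -/
lemma pi_withDensity_ofReal {ι : Type*} [Fintype ι] {g : ι → ℝ → ℝ} (hg : ∀ i x, 0 ≤ g i x)
    (hgm : ∀ i, Measurable (g i))
    [∀ i, IsProbabilityMeasure (volume.withDensity fun x => ENNReal.ofReal (g i x))] :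
    Measure.pi (fun i => volume.withDensity fun x => ENNReal.ofReal (g i x)) =
      volume.withDensity fun x => ENNReal.ofReal (∏ i, g i (x i)) := by
  have hint : ∀ i, Integrable (g i) := by
    intro i
    refine ⟨(hgm i).aestronglyMeasurable, ?_⟩
    rw [hasFiniteIntegral_iff_ofReal (ae_of_all _ (hg i))]
    have := measure_univ (μ := volume.withDensity fun x => ENNReal.ofReal (g i x))
    rw [withDensity_apply _ MeasurableSet.univ, setLIntegral_univ] at this
    rw [this]
    exact ENNReal.one_lt_top
  refine Measure.pi_eq fun s hs => ?_
  rw [withDensity_apply _ (MeasurableSet.univ_pi hs), volume_pi, Measure.restrict_pi_pi,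
    ← ofReal_integral_eq_lintegral_ofReal, integral_fintype_prod_eq_prod,
    ENNReal.ofReal_prod_of_nonneg]
  · refine Finset.prod_congr rfl fun i _ => ?_
    rw [withDensity_apply _ (hs i), ofReal_integral_eq_lintegral_ofReal (hint i).integrableOn
      (ae_of_all _ (hg i))]
  · exact fun i _ => integral_nonneg (hg i)
  · exact Integrable.fintype_prod fun i => (hint i).integrableOn
  · exact ae_of_all _ fun x => Finset.prod_nonneg fun i _ => hg i _

end Gaussian

/-! ### The law of the zeros of the characteristic polynomial of a Gaussian bordering -/

section Border

variable {m : ℕ}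

open Polynomial in
/-- The defining property of the weights, at the point `-y`. -/
lemma prod_add_interlace {c : Fin m → ℝ} (hc : Function.Injective c) (b : Fin m → ℝ) {y : ℝ}
    (hy : ∀ i, y + c i ≠ 0) :
    (1 + ∑ k, interlaceWeight c b k / (y + c k)) * ∏ i, (y + c i) = ∏ i, (y + b i) := by
  have h := congrArg (eval (-y)) (prod_X_sub_C_eq_secularPoly hc b)
  simp only [secularPoly, eval_sub, eval_prod, eval_finsetSum, eval_mul, eval_C, eval_X] at h
  have hneg : ∀ z : Fin m → ℝ, ∏ j, (-y - z j) = (-1) ^ m * ∏ j, (y + z j) := fun z => by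
    rw [← Fin.prod_const, ← Finset.prod_mul_distrib]
    exact Finset.prod_congr rfl fun j _ => by ring
  have hk : ∀ k, ∏ j ∈ Finset.univ.erase k, (-y - c j) =
      -((-1) ^ m * (∏ j, (y + c j)) / (y + c k)) := fun k => by
    rw [← hneg, ← Finset.mul_prod_erase Finset.univ (fun j => -y - c j) (Finset.mem_univ k)]
    have := hy k
    field_simp
    ring
  simp only [hk, hneg] at h
  have h1 : ((-1 : ℝ)) ^ m ≠ 0 := pow_ne_zero _ (by norm_num)
  apply mul_left_cancel₀ h1
  rw [h, add_mul, one_mul, Finset.sum_mul, mul_add, Finset.mul_sum, sub_eq_add_neg,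
    ← Finset.sum_neg_distrib]
  congr 1
  exact Finset.sum_congr rfl fun k _ => by ring

/-- A measurable function of the zeros is a measurable function of the weights, since a continuous
injective map on a Borel set is a measurable embedding. -/
lemma exists_measurable_comp_interlaceWeight {c : Fin m → ℝ} (hc : StrictMono c)
    {k : (Fin m → ℝ) → ℝ≥0∞} (hk : Measurable k) : ∃ F : (Fin m → ℝ) → ℝ≥0∞, Measurable F ∧
      ∀ b ∈ interlaceSet c, F (interlaceWeight c b) = k b := by
  have hemb : MeasurableEmbedding ((interlaceSet c).domRestrict (interlaceWeight c)) :=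
    ContinuousOn.measurableEmbedding (isOpen_interlaceSet c).measurableSet
      (continuous_interlaceWeight c).continuousOn (injOn_interlaceWeight hc)
  refine ⟨Function.extend ((interlaceSet c).domRestrict (interlaceWeight c)) (fun b => k b) 0,
    hemb.measurable_extend (hk.comp measurable_subtype_coe) measurable_zero, fun b hb => ?_⟩
  exact hemb.injective.extend_apply _ _ (⟨b, hb⟩ : interlaceSet c)

variable {n : Type*} [Fintype n] [DecidableEq n]

/-- If `A` is antisymmetric and `Aᵀ A` has the eigenvalues `c i` with multiplicities `d i`, then a
Gaussian border `v` of `A` gives a characteristic polynomial with zeros `b` interlacing with `c`,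
and the law of `b` is computed from the densities `g i` of the weights in the coordinates
`interlaceWeight c`. As in `HasSpectralDensity`, the zeros enter through pairs of functions `h` of
the border and `k` of the zeros that agree whenever `b` are the zeros for `v`; the relation between
the characteristic polynomials is required only for `s > 0`, where no denominator vanishes. -/
lemma lintegral_borderSkew {A : Matrix n n ℝ} (hA : Aᵀ = -A) {c : Fin m → ℝ} (hc : StrictMono c)
    (hc0 : ∀ i, 0 ≤ c i) {d : Fin m → ℕ} (hcard : Fintype.card n = ∑ i, d i)
    (hχ : ∀ s : ℝ, A.charpoly.eval s ^ 2 = ∏ i, (s ^ 2 + c i) ^ d i)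
    {g : Fin m → ℝ → ℝ} (hg0 : ∀ i w, 0 ≤ g i w) (hgm : ∀ i, Measurable (g i))
    (hgs : ∀ i w, w ≤ 0 → g i w = 0)
    (hg : ∀ i, (Measure.pi fun _ : Fin (d i) => entryLaw).map (fun y => ∑ j, y j ^ 2) =
      volume.withDensity fun w => ENNReal.ofReal (g i w))
    {h : (n → ℝ) → ℝ≥0∞} (hh : Measurable h) {k : (Fin m → ℝ) → ℝ≥0∞} (hk : Measurable k)
    (hhk : ∀ v, ∀ b ∈ interlaceSet c, (∀ s > 0, (borderSkew A v).charpoly.eval s *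
      ∏ i, (s ^ 2 + c i) = A.charpoly.eval s * (s * ∏ i, (s ^ 2 + b i))) → h v = k b) :
    ∫⁻ v, h v ∂(Measure.pi fun _ : n => entryLaw) =
      ∫⁻ b in interlaceSet c, ENNReal.ofReal (vand b / vand c *
        ∏ i, g i (interlaceWeight c b i)) * k b := by
  have hB : (Aᵀ * A).IsHermitian := by
    simpa [Matrix.conjTranspose_eq_transpose_of_trivial] using
      Matrix.isHermitian_conjTranspose_mul_self A
  obtain ⟨e, he⟩ := exists_equiv_eigenvalues hA hcard hχ hB
  obtain ⟨F, hF, hFk⟩ := exists_measurable_comp_interlaceWeight hc hk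
  have hprob : ∀ i, IsProbabilityMeasure (volume.withDensity fun w => ENNReal.ofReal (g i w)) := by
    intro i
    rw [← hg i]
    have hm : Measurable fun y : Fin (d i) → ℝ => ∑ j, y j ^ 2 := by fun_prop
    exact Measure.isProbabilityMeasure_map hm.aemeasurable
  -- the law of the weights
  have hW := map_sum_sq_sigma e
  simp only [hg] at hW
  rw [pi_withDensity_ofReal hg0 hgm] at hW
  have hWm : Measurable fun (u : n → ℝ) i => ∑ j, u (e.symm ⟨i, j⟩) ^ 2 := by fun_prop
  have hGm : Measurable fun w : Fin m → ℝ => ∏ i, g i (w i) :=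
    Finset.measurable_fun_prod _ fun i _ => (hgm i).comp (measurable_pi_apply i)
  have hpos : MeasurableSet {w : Fin m → ℝ | ∀ i, 0 < w i} := by
    rw [Set.ofPred_forall]
    exact MeasurableSet.iInter fun i => measurableSet_lt measurable_const (measurable_pi_apply i)
  -- almost surely all the weights are positive, and so they come from interlacing zeros
  have hae : ∀ᵐ u ∂(Measure.pi fun _ : n => entryLaw), ∀ i, 0 < ∑ j, u (e.symm ⟨i, j⟩) ^ 2 := by
    have : ∀ᵐ w ∂(Measure.pi fun _ : n => entryLaw).map
        (fun u i => ∑ j, u (e.symm ⟨i, j⟩) ^ 2), ∀ i, 0 < w i := by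
      rw [hW, ae_withDensity_iff (by fun_prop)]
      refine ae_of_all _ fun w hw i => ?_
      by_contra hi
      exact hw (by rw [Finset.prod_eq_zero (Finset.mem_univ i) (hgs i _ (not_lt.1 hi)),
        ENNReal.ofReal_zero])
    exact ae_of_ae_map hWm.aemeasurable this
  -- by rotation invariance the border may be taken to have independent coordinates in the
  -- eigenbasis of `Aᵀ A`
  have hrot : Measurable fun (u : n → ℝ) i => ∑ k, u k * hB.eigenvectorBasis k i := by fun_prop
  calc ∫⁻ v, h v ∂(Measure.pi fun _ : n => entryLaw)
      = ∫⁻ u, h (fun i => ∑ k, u k * hB.eigenvectorBasis k i)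
          ∂(Measure.pi fun _ : n => entryLaw) := by
        conv_lhs => rw [← map_entryLaw_orthonormalBasis hB.eigenvectorBasis]
        rw [lintegral_map hh hrot]
    _ = ∫⁻ u, F (fun i => ∑ j, u (e.symm ⟨i, j⟩) ^ 2) ∂(Measure.pi fun _ : n => entryLaw) := by
        refine lintegral_congr_ae ?_
        filter_upwards [hae] with u hu
        obtain ⟨b, hb, hbw⟩ := exists_interlaceWeight_eq hc hu
        rw [← hbw, hFk b hb]
        refine hhk _ b hb fun s hs => ?_
        have hsc : ∀ i, s ^ 2 + c i ≠ 0 := fun i => by have := hc0 i; positivity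
        have hdet : A.charpoly.eval s ≠ 0 := by
          intro h0
          have h1 := hχ s
          rw [h0, zero_pow two_ne_zero] at h1
          exact Finset.prod_ne_zero_iff.2 (fun i _ => pow_ne_zero _ (hsc i)) h1.symm
        rw [eval_charpoly_borderSkew_basis hA hB.eigenvectorBasis hB.eigenvalues
          hB.mulVec_eigenvectorBasis hdet (fun k => by rw [← he]; exact hsc _) u]
        have hsum : ∑ k, u k ^ 2 / (s ^ 2 + hB.eigenvalues k) =
            ∑ i, interlaceWeight c b i / (s ^ 2 + c i) := by
          rw [← e.symm.sum_comp, Fintype.sum_sigma]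
          refine Finset.sum_congr rfl fun i _ => ?_
          rw [hbw, Finset.sum_div]
          refine Finset.sum_congr rfl fun j _ => ?_
          rw [← he, e.apply_symm_apply]
        rw [hsum, ← prod_add_interlace hc.injective b hsc]
        ring
    _ = ∫⁻ w, ENNReal.ofReal (∏ i, g i (w i)) * F w := by
        rw [← lintegral_map hF hWm, hW, lintegral_withDensity_eq_lintegral_mul _ (by fun_prop) hF]
        rfl
    _ = ∫⁻ w in {w | ∀ i, 0 < w i}, ENNReal.ofReal (∏ i, g i (w i)) * F w := by
        rw [← lintegral_indicator hpos]
        refine lintegral_congr fun w => ?_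
        by_cases hw : w ∈ {w : Fin m → ℝ | ∀ i, 0 < w i}
        · rw [Set.indicator_of_mem hw]
        · rw [Set.indicator_of_notMem hw]
          obtain ⟨i, hi⟩ := not_forall.1 hw
          rw [Finset.prod_eq_zero (Finset.mem_univ i) (hgs i _ (not_lt.1 hi)),
            ENNReal.ofReal_zero, zero_mul]
    _ = _ := by
        rw [lintegral_pos_eq_lintegral_interlaceSet hc]
        refine setLIntegral_congr_fun (isOpen_interlaceSet c).measurableSet fun b hb => ?_
        have hv : 0 ≤ vand b / vand c :=
          (div_pos (vand_pos (strictMono_of_mem_interlaceSet hb)) (vand_pos hc)).le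
        rw [hFk b hb, ENNReal.ofReal_mul hv, mul_assoc]

end Border

/-! ### Antisymmetric matrices with independent Gaussian entries, by successive bordering -/

section Skew

/-- The positions above the diagonal. -/
abbrev UpperIdx (N : ℕ) : Type := {e : Fin N × Fin N // e.1 < e.2}

/-- The antisymmetric matrix with the given entries above the diagonal. -/
def skew {N : ℕ} (x : UpperIdx N → ℝ) : Matrix (Fin N) (Fin N) ℝ :=
  Matrix.of fun i j =>
    if h : i < j then x ⟨(i, j), h⟩ else if h : j < i then -x ⟨(j, i), h⟩ else 0

lemma skew_transpose {N : ℕ} (x : UpperIdx N → ℝ) : (skew x)ᵀ = -skew x := by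
  ext i j
  rcases lt_trichotomy i j with h | rfl | h
  · simp [skew, h, h.not_gt]
  · simp [skew]
  · simp [skew, h, h.not_gt]

/-- The positions above the diagonal are those outside of the last column and those in it. -/
noncomputable def upperIdxSucc (N : ℕ) : UpperIdx N ⊕ Fin N ≃ UpperIdx (N + 1) :=
  Equiv.ofBijective
    (Sum.elim (fun e => ⟨(e.1.1.castSucc, e.1.2.castSucc), Fin.castSucc_lt_castSucc_iff.2 e.2⟩)
      fun i => ⟨(i.castSucc, Fin.last N), i.castSucc_lt_last⟩) <| by
    constructor
    · rintro (⟨⟨a, b⟩, h⟩ | i) (⟨⟨a', b'⟩, h'⟩ | i') hh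
      · simpa using hh
      · simp [Fin.castSucc_ne_last] at hh
      · simp [(Fin.castSucc_ne_last _).symm] at hh
      · simpa using hh
    · rintro ⟨⟨i, j⟩, h⟩
      induction j using Fin.lastCases with
      | last =>
        obtain ⟨i, rfl⟩ := Fin.exists_castSucc_eq.2 (ne_of_lt h)
        exact ⟨Sum.inr i, rfl⟩
      | cast j =>
        obtain ⟨i, rfl⟩ := Fin.exists_castSucc_eq.2 (ne_of_lt (h.trans j.castSucc_lt_last))
        exact ⟨Sum.inl ⟨(i, j), Fin.castSucc_lt_castSucc_iff.1 h⟩, rfl⟩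

/-- The entries of a bordered matrix. -/
noncomputable def consColumn {N : ℕ} (x : (UpperIdx N → ℝ) × (Fin N → ℝ)) : UpperIdx (N + 1) → ℝ :=
  fun e => Sum.elim x.1 x.2 ((upperIdxSucc N).symm e)

/-- The last column is independent of the other entries. -/
lemma measurePreserving_consColumn (N : ℕ) :
    MeasurePreserving (consColumn (N := N))
      ((Measure.pi fun _ => entryLaw).prod (Measure.pi fun _ => entryLaw))
      (Measure.pi fun _ => entryLaw) := by
  have h1 := measurePreserving_piCongrLeft (fun _ : UpperIdx (N + 1) => entryLaw) (upperIdxSucc N)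
  have h2 := measurePreserving_sumPiEquivProdPi_symm
    (fun _ : UpperIdx N ⊕ Fin N => entryLaw)
  convert h1.comp h2 using 1
  ext x e
  obtain ⟨e, rfl⟩ := (upperIdxSucc N).surjective e
  rw [consColumn, Equiv.symm_apply_apply]
  simp only [Function.comp_apply]
  rw [MeasurableEquiv.coe_piCongrLeft, Equiv.piCongrLeft_apply_apply]
  rcases e with e | e <;> rfl

lemma consColumn_upperIdxSucc {N : ℕ} (x : (UpperIdx N → ℝ) × (Fin N → ℝ)) (e) :
    consColumn x (upperIdxSucc N e) = Sum.elim x.1 x.2 e := by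
  rw [consColumn, Equiv.symm_apply_apply]

lemma skew_consColumn {N : ℕ} (x : (UpperIdx N → ℝ) × (Fin N → ℝ)) :
    skew (consColumn x) =
      Matrix.reindex finSumFinEquiv finSumFinEquiv (borderSkew (skew x.1) x.2) := by
  rw [← (Matrix.reindex finSumFinEquiv finSumFinEquiv).symm_apply_eq]
  ext a b
  rw [Matrix.reindex_symm, Matrix.reindex_apply, Matrix.submatrix_apply, Equiv.symm_symm]
  have hlast : Fin.natAdd N (0 : Fin 1) = Fin.last N := rfl
  have hcast : ∀ i : Fin N, Fin.castAdd 1 i = i.castSucc := fun _ => rfl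
  rcases a with i | i <;> rcases b with j | j
  · simp only [finSumFinEquiv_apply_left, hcast, borderSkew, Matrix.fromBlocks_apply₁₁,
      skew, Matrix.of_apply, Fin.castSucc_lt_castSucc_iff]
    split_ifs with h h'
    · exact consColumn_upperIdxSucc x (Sum.inl ⟨(i, j), h⟩)
    · exact congrArg Neg.neg (consColumn_upperIdxSucc x (Sum.inl ⟨(j, i), h'⟩))
    · rfl
  · obtain rfl := Subsingleton.elim j 0
    simp only [finSumFinEquiv_apply_left, finSumFinEquiv_apply_right, hcast, hlast,
      borderSkew, Matrix.fromBlocks_apply₁₂, skew, Matrix.of_apply, Fin.castSucc_lt_last, dif_pos]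
    exact consColumn_upperIdxSucc x (Sum.inr i)
  · obtain rfl := Subsingleton.elim i 0
    simp only [finSumFinEquiv_apply_left, finSumFinEquiv_apply_right, hcast, hlast,
      borderSkew, Matrix.fromBlocks_apply₂₁, skew, Matrix.of_apply, Fin.castSucc_lt_last, dif_pos,
      (Fin.castSucc_lt_last j).not_gt]
    exact congrArg Neg.neg (consColumn_upperIdxSucc x (Sum.inr j))
  · obtain rfl := Subsingleton.elim i 0
    obtain rfl := Subsingleton.elim j 0
    simp [skew, borderSkew, hlast]

lemma lintegral_consColumn {N : ℕ} {h : (UpperIdx (N + 1) → ℝ) → ℝ≥0∞} (hh : Measurable h) :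
    ∫⁻ x, h x ∂(Measure.pi fun _ => entryLaw) =
      ∫⁻ x, ∫⁻ v, h (consColumn (x, v)) ∂(Measure.pi fun _ => entryLaw)
        ∂(Measure.pi fun _ => entryLaw) := by
  rw [← (measurePreserving_consColumn N).lintegral_comp hh]
  exact lintegral_prod _ (hh.comp (measurePreserving_consColumn N).measurable).aemeasurable

lemma charpoly_skew_consColumn {N : ℕ} (x : UpperIdx N → ℝ) (v : Fin N → ℝ) :
    (skew (consColumn (x, v))).charpoly = (borderSkew (skew x) v).charpoly := by
  rw [skew_consColumn, Matrix.charpoly_reindex]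

lemma map_sum_sq_one : (Measure.pi fun _ : Fin 1 => entryLaw).map (fun y => ∑ j, y j ^ 2) =
    volume.withDensity fun w => ENNReal.ofReal (sqDensity w) := by
  rw [← map_sq_entryLaw]
  conv_rhs => rw [← (measurePreserving_funUnique entryLaw (Fin 1)).map_eq]
  rw [Measure.map_map (by fun_prop) (by fun_prop)]
  congr 1
  ext y
  simp

lemma map_sum_sq_two : (Measure.pi fun _ : Fin 2 => entryLaw).map (fun y => ∑ j, y j ^ 2) =
    volume.withDensity fun w => ENNReal.ofReal (sqSumDensity w) := by
  rw [← map_add_sq_entryLaw, ← (measurePreserving_finTwoArrow entryLaw).map_eq,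
    Measure.map_map (by fun_prop) (by fun_prop)]
  congr 1
  ext y
  simp [Fin.sum_univ_two]

end Skew

/-! ### Interlacing sequences of positive numbers -/

section Cone

/-- The increasing sequences of positive numbers. -/
def openCone (p : ℕ) : Set (Fin p → ℝ) := {a | StrictMono a ∧ ∀ i, 0 < a i}

lemma measurableSet_openCone (p : ℕ) : MeasurableSet (openCone p) := by
  have : openCone p = (⋂ i, ⋂ j, ⋂ _ : i < j, {a : Fin p → ℝ | a i < a j}) ∩
      ⋂ i, {a | 0 < a i} := by
    ext a; simp [openCone, StrictMono]
  rw [this]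
  refine MeasurableSet.inter ?_ (MeasurableSet.iInter fun i =>
    measurableSet_lt measurable_const (measurable_pi_apply i))
  exact MeasurableSet.iInter fun i => MeasurableSet.iInter fun j => MeasurableSet.iInter fun _ =>
    measurableSet_lt (measurable_pi_apply i) (measurable_pi_apply j)

lemma measurableSet_interlace {m p : ℕ} {c : (Fin p → ℝ) → Fin m → ℝ} (hc : Measurable c) :
    MeasurableSet {x : (Fin p → ℝ) × (Fin m → ℝ) | x.2 ∈ interlaceSet (c x.1)} := by
  have : {x : (Fin p → ℝ) × (Fin m → ℝ) | x.2 ∈ interlaceSet (c x.1)} =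
      (⋂ k, {x | c x.1 k < x.2 k}) ∩ ⋂ k, ⋂ l, ⋂ _ : k < l, {x | x.2 k < c x.1 l} := by
    ext x; simp [interlaceSet]
  rw [this]
  have h1 : ∀ k, Measurable fun x : (Fin p → ℝ) × (Fin m → ℝ) => c x.1 k := fun k =>
    (measurable_pi_apply k).comp (hc.comp measurable_fst)
  have h2 : ∀ k, Measurable fun x : (Fin p → ℝ) × (Fin m → ℝ) => x.2 k := fun k =>
    (measurable_pi_apply k).comp measurable_snd
  exact (MeasurableSet.iInter fun k => measurableSet_lt (h1 k) (h2 k)).inter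
    (MeasurableSet.iInter fun k => MeasurableSet.iInter fun l => MeasurableSet.iInter fun _ =>
      measurableSet_lt (h2 k) (h1 l))

lemma measurable_setLIntegral_interlaceSet {m p : ℕ} {c : (Fin p → ℝ) → Fin m → ℝ}
    (hc : Measurable c) {φ : (Fin p → ℝ) → (Fin m → ℝ) → ℝ≥0∞}
    (hφ : Measurable (Function.uncurry φ)) :
    Measurable fun a => ∫⁻ b in interlaceSet (c a), φ a b := by
  have h := (hφ.indicator (measurableSet_interlace hc)).lintegral_prod_right'
    (ν := (volume : Measure (Fin m → ℝ)))
  convert h using 2 with a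
  rw [← lintegral_indicator (isOpen_interlaceSet _).measurableSet]
  rfl

/-- Tonelli's theorem on a set described in two ways. -/
lemma setLIntegral_setLIntegral_swap {α β : Type*} [MeasurableSpace α] [MeasurableSpace β]
    {μ : Measure α} {ν : Measure β} [SFinite μ] [SFinite ν] {S : Set α} {S' : Set β}
    {I : α → Set β} {J : β → Set α} (hS : MeasurableSet S) (hS' : MeasurableSet S')
    (hI : ∀ a, MeasurableSet (I a)) (hJ : ∀ b, MeasurableSet (J b))
    (hT : MeasurableSet {x : α × β | x.2 ∈ I x.1})
    (hIJ : ∀ a b, (a ∈ S ∧ b ∈ I a) ↔ (b ∈ S' ∧ a ∈ J b)) {φ : α → β → ℝ≥0∞}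
    (hφ : Measurable (Function.uncurry φ)) :
    ∫⁻ a in S, ∫⁻ b in I a, φ a b ∂ν ∂μ = ∫⁻ b in S', ∫⁻ a in J b, φ a b ∂μ ∂ν := by
  have hT' : MeasurableSet {x : α × β | x.1 ∈ S ∧ x.2 ∈ I x.1} := (measurable_fst hS).inter hT
  have h := lintegral_lintegral_swap (μ := μ) (ν := ν)
    (f := fun a b => {x : α × β | x.1 ∈ S ∧ x.2 ∈ I x.1}.indicator (Function.uncurry φ) (a, b))
    (hφ.indicator hT').aemeasurable
  rw [← lintegral_indicator hS, ← lintegral_indicator hS']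
  convert h using 3 with a b
  · by_cases ha : a ∈ S
    · rw [Set.indicator_of_mem ha, ← lintegral_indicator (hI a)]
      refine lintegral_congr fun b => ?_
      by_cases hb : b ∈ I a <;> simp [ha, hb]
    · simp [ha]
  · by_cases hb : b ∈ S'
    · rw [Set.indicator_of_mem hb, ← lintegral_indicator (hJ b)]
      refine lintegral_congr fun a => ?_
      have := hIJ a b
      by_cases ha : a ∈ J b
      · obtain ⟨h1, h2⟩ := this.2 ⟨hb, ha⟩
        simp [ha, h1, h2]
      · have : ¬ (a ∈ S ∧ b ∈ I a) := fun h => ha (this.1 h).2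
        simp [ha, this]
    · have : ∀ a, ¬ (a ∈ S ∧ b ∈ I a) := fun a h => hb ((hIJ a b).1 h).1
      simp [hb, this]

/-- The interlacing `0 < a 0 < b 0 < a 1 < b 1 < ...`, seen from `a` and from `b`. -/
lemma openCone_interlace_iff {p : ℕ} (a b : Fin p → ℝ) :
    (a ∈ openCone p ∧ b ∈ interlaceSet a) ↔
      (b ∈ openCone p ∧ a ∈ interlaceBox (Fin.cons 0 b : Fin (p + 1) → ℝ)) := by
  constructor
  · rintro ⟨ha, hb⟩
    refine ⟨⟨strictMono_of_mem_interlaceSet hb, fun i => (ha.2 i).trans (hb.1 i)⟩,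
      fun i _ => ⟨?_, by simpa using hb.1 i⟩⟩
    rcases p with _ | p
    · exact i.elim0
    · induction i using Fin.cases with
      | zero => simpa using ha.2 0
      | succ i =>
        rw [← Fin.succ_castSucc, Fin.cons_succ]
        exact hb.2 _ _ (Fin.castSucc_lt_succ)
  · rintro ⟨hb, ha⟩
    have hmono : Monotone (Fin.cons 0 b : Fin (p + 1) → ℝ) := by
      intro i j hij
      induction i using Fin.cases with
      | zero =>
        induction j using Fin.cases with
        | zero => exact le_rfl
        | succ j => simpa using (hb.2 j).le
      | succ i =>
        induction j using Fin.cases with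
        | zero => simp at hij
        | succ j => simpa using hb.1.monotone (Fin.succ_le_succ_iff.1 hij)
    have h1 : ∀ i, a i < b i := fun i => by simpa using (ha i trivial).2
    have h2 : ∀ i j, i < j → b i < a j := fun i j hij => by
      refine lt_of_le_of_lt ?_ (ha j trivial).1
      have := hmono (show i.succ ≤ j.castSucc by
        rw [Fin.le_def]; simpa using Fin.lt_def.1 hij)
      simpa using this
    refine ⟨⟨strictMono_of_mem_interlaceBox hmono ha, fun i => ?_⟩, h1, h2⟩
    refine lt_of_le_of_lt ?_ (ha i trivial).1
    simpa using hmono (Fin.zero_le i.castSucc)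

/-- The interlacing `0 < b 0 < a 0 < b 1 < ... < a (p - 1) < b p`, seen from `a` and from `b`. -/
lemma openCone_interlace_cons_iff {p : ℕ} (a : Fin p → ℝ) (b : Fin (p + 1) → ℝ) :
    (a ∈ openCone p ∧ b ∈ interlaceSet (Fin.cons 0 a : Fin (p + 1) → ℝ)) ↔
      (b ∈ openCone (p + 1) ∧ a ∈ interlaceBox b) := by
  constructor
  · rintro ⟨ha, hb⟩
    refine ⟨⟨strictMono_of_mem_interlaceSet hb, fun i => lt_of_le_of_lt ?_ (hb.1 i)⟩,
      fun i _ => ⟨by simpa using hb.2 i.castSucc i.succ Fin.castSucc_lt_succ,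
        by simpa using hb.1 i.succ⟩⟩
    induction i using Fin.cases with
    | zero => simp
    | succ i => simpa using (ha.2 i).le
  · rintro ⟨hb, ha⟩
    refine ⟨⟨strictMono_of_mem_interlaceBox hb.1.monotone ha, fun i =>
      (hb.2 _).trans (ha i trivial).1⟩, fun k => ?_, fun k l hkl => ?_⟩
    · induction k using Fin.cases with
      | zero => simpa using hb.2 0
      | succ k => simpa using (ha k trivial).2
    · induction l using Fin.cases with
      | zero => simp at hkl
      | succ l =>
        rw [Fin.cons_succ]
        exact lt_of_le_of_lt (hb.1.monotone (Fin.le_castSucc_iff.2 hkl)) (ha l trivial).1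

end Cone

/-! ### The joint density of the squares of the eigenvalues -/

section Induction

open Polynomial in
/-- The squares of the positive eigenvalues of `√(-1)` times the Gaussian antisymmetric matrix of
size `N` have the joint density `ρ` on the open cone. The statement is about all pairs of
functions `h` of the matrix and `k` of these squares that agree when the characteristic polynomial
is `X ^ ε * ∏ i, (X ^ 2 + a i)`, so that it does not refer to a choice of the eigenvalues. With
`h = 1` and `k = 1` it says that `ρ` has total mass one. -/
def HasSpectralDensity (N p ε : ℕ) (ρ : (Fin p → ℝ) → ℝ) : Prop :=
  ∀ (h : (UpperIdx N → ℝ) → ℝ≥0∞) (k : (Fin p → ℝ) → ℝ≥0∞), Measurable h → Measurable k →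
    (∀ x, ∀ a ∈ openCone p, (skew x).charpoly = X ^ ε * ∏ i, (X ^ 2 + C (a i)) → h x = k a) →
    ∫⁻ x, h x ∂(Measure.pi fun _ => entryLaw) = ∫⁻ a in openCone p, ENNReal.ofReal (ρ a) * k a

/-- The density for even size, up to a constant (for `a` with positive terms). -/
noncomputable def evenWeight {p : ℕ} (a : Fin p → ℝ) : ℝ :=
  (∏ i, a i ^ (-(1 / 2) : ℝ)) * vand a ^ 2 * Real.exp (-2 * ∑ i, a i)

/-- The density for odd size, up to a constant (for `a` with positive terms). -/
noncomputable def oddWeight {p : ℕ} (a : Fin p → ℝ) : ℝ :=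
  (∏ i, a i ^ (1 / 2 : ℝ)) * vand a ^ 2 * Real.exp (-2 * ∑ i, a i)

lemma measurable_vand {p : ℕ} : Measurable (vand : (Fin p → ℝ) → ℝ) := by
  unfold vand
  fun_prop

lemma measurable_evenWeight {p : ℕ} : Measurable (evenWeight : (Fin p → ℝ) → ℝ) := by
  have := measurable_vand (p := p)
  unfold evenWeight
  fun_prop

lemma measurable_oddWeight {p : ℕ} : Measurable (oddWeight : (Fin p → ℝ) → ℝ) := by
  have := measurable_vand (p := p)
  unfold oddWeight
  fun_prop

open Polynomial in
lemma eq_of_eval_eq_of_pos {P Q : ℝ[X]} (h : ∀ s > 0, P.eval s = Q.eval s) : P = Q :=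
  Polynomial.eq_of_infinite_eval_eq P Q ((Set.Ioi_infinite (0 : ℝ)).mono fun s hs => h s hs)

lemma hasSpectralDensity_zero : HasSpectralDensity 0 0 0 evenWeight := by
  intro h k hh hk hhk
  have h0 : ∀ x, h x = k ![] := fun x => by
    refine hhk x ![] ⟨fun i => i.elim0, fun i => i.elim0⟩ ?_
    simp [Matrix.charpoly]
  have hcone : openCone 0 = Set.univ := Set.eq_univ_of_forall fun a =>
    ⟨fun i => i.elim0, fun i => i.elim0⟩
  simp only [h0, hcone, Measure.restrict_univ, lintegral_const, measure_univ, mul_one]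
  have h1 : ∀ a : Fin 0 → ℝ, ENNReal.ofReal (evenWeight a) * k a = k ![] := fun a => by
    rw [Subsingleton.elim a ![]]
    simp [evenWeight, vand]
  simp only [h1, lintegral_const]
  rw [volume_pi, Measure.pi_univ]
  simp

lemma measurable_lintegral_consColumn {N : ℕ} {h : (UpperIdx (N + 1) → ℝ) → ℝ≥0∞}
    (hh : Measurable h) : Measurable fun x : UpperIdx N → ℝ =>
      ∫⁻ v, h (consColumn (x, v)) ∂(Measure.pi fun _ => entryLaw) :=
  Measurable.lintegral_prod_right' (hh.comp (measurePreserving_consColumn N).measurable)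

/-- From size `2p` to size `2p + 1`. All the eigenvalues of `Aᵀ A` have multiplicity two, so that
the weights are exponential variables. -/
lemma lintegral_borderSkew_even {p : ℕ} {x : UpperIdx (2 * p) → ℝ} {a : Fin p → ℝ}
    (ha : a ∈ openCone p)
    (hχ : (skew x).charpoly = .X ^ 0 * ∏ i, (.X ^ 2 + .C (a i)))
    {h : (UpperIdx (2 * p + 1) → ℝ) → ℝ≥0∞} {k : (Fin p → ℝ) → ℝ≥0∞} (hh : Measurable h)
    (hk : Measurable k)
    (hhk : ∀ x, ∀ b ∈ openCone p, (skew x).charpoly = .X ^ 1 * ∏ i, (.X ^ 2 + .C (b i)) →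
      h x = k b) :
    ∫⁻ v, h (consColumn (x, v)) ∂(Measure.pi fun _ => entryLaw) =
      ∫⁻ b in interlaceSet a, ENNReal.ofReal (vand b / vand a *
        (2 ^ p * Real.exp (-2 * (∑ i, b i - ∑ i, a i)))) * k b := by
  have heval : ∀ s : ℝ, (skew x).charpoly.eval s = ∏ i, (s ^ 2 + a i) := fun s => by
    rw [hχ]; simp [Polynomial.eval_prod]
  refine (lintegral_borderSkew (h := fun v => h (consColumn (x, v))) (skew_transpose x) ha.1
    (fun i => (ha.2 i).le) (d := fun _ => 2)
    (g := fun _ => sqSumDensity) (by simp [mul_comm])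
    (fun s => by rw [heval, ← Finset.prod_pow])
    (fun _ => sqSumDensity_nonneg) (fun _ => measurable_sqSumDensity)
    (fun _ _ => sqSumDensity_of_nonpos) (fun _ => map_sum_sq_two)
    (hh.comp ((measurePreserving_consColumn _).measurable.comp measurable_prodMk_left)) hk
      ?_).trans ?_
  · intro v b hb hs
    refine hhk _ b ⟨strictMono_of_mem_interlaceSet hb, fun i => (ha.2 i).trans (hb.1 i)⟩ ?_
    rw [charpoly_skew_consColumn]
    refine eq_of_eval_eq_of_pos fun s hs0 => ?_
    have h1 := hs s hs0
    have h2 : ∏ i, (s ^ 2 + a i) ≠ 0 := (Finset.prod_pos fun i _ => by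
      have := ha.2 i; positivity).ne'
    rw [heval, mul_comm] at h1
    rw [mul_left_cancel₀ h2 h1]
    simp [Polynomial.eval_prod]
  · refine setLIntegral_congr_fun (isOpen_interlaceSet a).measurableSet fun b hb => ?_
    have hw := interlaceWeight_pos ha.1 hb
    simp only [sqSumDensity, Set.indicator_of_mem (Set.mem_Ioi.2 (hw _))]
    rw [Finset.prod_mul_distrib, Fin.prod_const, ← Real.exp_sum, ← Finset.mul_sum,
      sum_interlaceWeight ha.1.injective]

lemma prod_erase_zero {M : Type*} [CommMonoid M] {p : ℕ} (f : Fin (p + 1) → M) :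
    ∏ j ∈ Finset.univ.erase 0, f j = ∏ j : Fin p, f j.succ := by
  rw [Fin.univ_succ, Finset.erase_cons, Finset.prod_map]
  rfl

/-- The weight of the node `0`. -/
lemma interlaceWeight_cons_zero {p : ℕ} (a : Fin p → ℝ) (b : Fin (p + 1) → ℝ) :
    interlaceWeight (Fin.cons 0 a) b 0 = (∏ i, b i) / ∏ i, a i := by
  rw [interlaceWeight, prod_erase_zero, Fin.prod_univ_succ b]
  simp only [Fin.cons_zero, Fin.cons_succ, sub_zero, zero_sub, neg_div_neg_eq]
  rw [Finset.prod_div_distrib, mul_div_assoc]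

lemma vand_cons_zero {p : ℕ} (a : Fin p → ℝ) :
    vand (Fin.cons 0 a : Fin (p + 1) → ℝ) = (∏ i, a i) * vand a := by
  rw [vand, Fin.prod_univ_succ, vand]
  congr 1
  · rw [Fin.Ioi_zero_eq_map, Finset.prod_map]
    simp
  · refine Finset.prod_congr rfl fun i _ => ?_
    rw [Fin.Ioi_succ, Finset.prod_map]
    simp

lemma strictMono_cons_zero {p : ℕ} {a : Fin p → ℝ} (ha : a ∈ openCone p) :
    StrictMono (Fin.cons 0 a : Fin (p + 1) → ℝ) := by
  intro i j hij
  induction j using Fin.cases with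
  | zero => simp at hij
  | succ j =>
    induction i using Fin.cases with
    | zero => simpa using ha.2 j
    | succ i => simpa using ha.1 (Fin.succ_lt_succ_iff.1 hij)

/-- From size `2p + 1` to size `2p + 2`. The eigenvalue `0` of `Aᵀ A` is simple, and its weight is
the square of a Gaussian variable; the other eigenvalues have multiplicity two. -/
lemma lintegral_borderSkew_odd {p : ℕ} {x : UpperIdx (2 * p + 1) → ℝ} {a : Fin p → ℝ}
    (ha : a ∈ openCone p)
    (hχ : (skew x).charpoly = .X ^ 1 * ∏ i, (.X ^ 2 + .C (a i)))
    {h : (UpperIdx (2 * p + 1 + 1) → ℝ) → ℝ≥0∞} {k : (Fin (p + 1) → ℝ) → ℝ≥0∞} (hh : Measurable h)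
    (hk : Measurable k)
    (hhk : ∀ x, ∀ b ∈ openCone (p + 1),
      (skew x).charpoly = .X ^ 0 * ∏ i, (.X ^ 2 + .C (b i)) → h x = k b) :
    ∫⁻ v, h (consColumn (x, v)) ∂(Measure.pi fun _ => entryLaw) =
      ∫⁻ b in interlaceSet (Fin.cons 0 a : Fin (p + 1) → ℝ),
        ENNReal.ofReal (vand b / ((∏ i, a i) * vand a) * (√(2 / Real.pi) *
          ((∏ i, b i) / ∏ i, a i) ^ (-(1 / 2) : ℝ) *
          (2 ^ p * Real.exp (-2 * (∑ i, b i - ∑ i, a i))))) * k b := by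
  set c : Fin (p + 1) → ℝ := Fin.cons 0 a with hcdef
  have hc : StrictMono c := strictMono_cons_zero ha
  have hc0 : ∀ i, 0 ≤ c i := fun i => hc.monotone (Fin.zero_le i)
  have heval : ∀ s : ℝ, (skew x).charpoly.eval s = s * ∏ i, (s ^ 2 + a i) := fun s => by
    rw [hχ]; simp [Polynomial.eval_prod]
  have hprod : ∀ s : ℝ, ∏ i, (s ^ 2 + c i) = s ^ 2 * ∏ i, (s ^ 2 + a i) := fun s => by
    rw [Fin.prod_univ_succ]; simp [hcdef]
  refine (lintegral_borderSkew (h := fun v => h (consColumn (x, v))) (skew_transpose x) hc hc0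
    (d := Fin.cons 1 fun _ => 2)
    (g := Fin.cons sqDensity fun _ => sqSumDensity)
    (by rw [Fin.sum_univ_succ]; simp; ring)
    (fun s => by
      rw [heval, Fin.prod_univ_succ, mul_pow]
      simp [hcdef, Finset.prod_pow])
    (Fin.cases sqDensity_nonneg fun _ => sqSumDensity_nonneg)
    (Fin.cases measurable_sqDensity fun _ => measurable_sqSumDensity)
    (Fin.cases (fun _ => sqDensity_of_nonpos) fun _ _ => sqSumDensity_of_nonpos)
    (Fin.cases map_sum_sq_one fun _ => map_sum_sq_two)
    (hh.comp ((measurePreserving_consColumn _).measurable.comp measurable_prodMk_left)) hk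
      ?_).trans ?_
  · intro v b hb hs
    refine hhk _ b ⟨strictMono_of_mem_interlaceSet hb, fun i => (hc0 i).trans_lt (hb.1 i)⟩ ?_
    rw [charpoly_skew_consColumn]
    refine eq_of_eval_eq_of_pos fun s hs0 => ?_
    have h1 := hs s hs0
    have h2 : s ^ 2 * ∏ i, (s ^ 2 + a i) ≠ 0 := (mul_pos (by positivity)
      (Finset.prod_pos fun i _ => by have := ha.2 i; positivity)).ne'
    rw [heval, hprod] at h1
    have h3 : (s ^ 2 * ∏ i, (s ^ 2 + a i)) * (borderSkew (skew x) v).charpoly.eval s =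
        (s ^ 2 * ∏ i, (s ^ 2 + a i)) * ∏ i, (s ^ 2 + b i) := by linear_combination h1
    rw [mul_left_cancel₀ h2 h3]
    simp [Polynomial.eval_prod]
  · refine setLIntegral_congr_fun (isOpen_interlaceSet c).measurableSet fun b hb => ?_
    have hw := interlaceWeight_pos hc hb
    have hsum := sum_interlaceWeight hc.injective b
    rw [Fin.sum_univ_succ, Fin.sum_univ_succ c] at hsum
    have h0 : c 0 = 0 := rfl
    have hcs : ∀ i : Fin p, c i.succ = a i := fun i => rfl
    simp only [h0, hcs, zero_add] at hsum
    rw [Fin.prod_univ_succ]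
    simp only [Fin.cons_zero, Fin.cons_succ, sqDensity, sqSumDensity,
      Set.indicator_of_mem (Set.mem_Ioi.2 (hw _))]
    rw [Finset.prod_mul_distrib, Fin.prod_const, ← Real.exp_sum, ← Finset.mul_sum, ← hsum,
      mul_add, Real.exp_add, hcdef, vand_cons_zero, interlaceWeight_cons_zero]
    congr 3
    ring

/-- From even to odd size: the squares of the old eigenvalues are integrated out over the sequences
that interlace the new ones. One factor `vand a` and the exponential of `a` cancel. -/
lemma HasSpectralDensity.odd {p : ℕ} {Z : ℝ} (hZ : 0 ≤ Z)
    (H : HasSpectralDensity (2 * p) p 0 fun a => Z * evenWeight a) :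
    HasSpectralDensity (2 * p + 1) p 1
      fun b => (Z * 2 ^ p / ∏ j : Fin p, ((j : ℝ) + 1 / 2)) * oddWeight b := by
  intro h k hh hk hhk
  have hvm := measurable_vand (p := p)
  have hem := measurable_evenWeight (p := p)
  set φ : (Fin p → ℝ) → (Fin p → ℝ) → ℝ≥0∞ := fun a b => ENNReal.ofReal (vand b / vand a *
    (2 ^ p * Real.exp (-2 * (∑ i, b i - ∑ i, a i)))) * k b with hφdef
  have hφ : Measurable (Function.uncurry φ) := by
    simp only [hφdef, Function.uncurry_def]
    fun_prop
  rw [lintegral_consColumn hh, H _ _ (measurable_lintegral_consColumn hh)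
    (measurable_setLIntegral_interlaceSet (c := fun a => a) measurable_id hφ)
    (fun x a ha hχ => lintegral_borderSkew_even ha hχ hh hk hhk)]
  have h1 : ∀ a, ENNReal.ofReal (Z * evenWeight a) * ∫⁻ b in interlaceSet a, φ a b =
      ∫⁻ b in interlaceSet a, ENNReal.ofReal (Z * evenWeight a) * φ a b := fun a =>
    (lintegral_const_mul' _ _ ENNReal.ofReal_ne_top).symm
  simp only [h1]
  -- the old sequence becomes the inner variable of integration
  rw [setLIntegral_setLIntegral_swap (φ := fun a b => ENNReal.ofReal (Z * evenWeight a) * φ a b)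
    (measurableSet_openCone p) (measurableSet_openCone p)
    (fun a => (isOpen_interlaceSet a).measurableSet) (fun b => measurableSet_interlaceBox _)
    (measurableSet_interlace measurable_id) openCone_interlace_iff
    (((hem.const_mul Z).comp measurable_fst).ennreal_ofReal.mul hφ)]
  refine setLIntegral_congr_fun (measurableSet_openCone p) fun b hb => ?_
  have hE : 0 ≤ Z * 2 ^ p * vand b * Real.exp (-2 * ∑ i, b i) := by
    have := vand_pos hb.1; positivity
  have h2 : ∀ a ∈ interlaceBox (Fin.cons 0 b : Fin (p + 1) → ℝ),
      ENNReal.ofReal (Z * evenWeight a) * φ a b =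
        (ENNReal.ofReal (Z * 2 ^ p * vand b * Real.exp (-2 * ∑ i, b i)) * k b) *
          ENNReal.ofReal (vand a * ∏ i, a i ^ (-(1 / 2) : ℝ)) := by
    intro a ha
    have hac := ((openCone_interlace_iff a b).2 ⟨hb, ha⟩).1
    have hva := vand_pos hac.1
    have hpa : 0 ≤ ∏ i, a i ^ (-(1 / 2) : ℝ) :=
      Finset.prod_nonneg fun i _ => Real.rpow_nonneg (hac.2 i).le _
    rw [hφdef, ← mul_assoc, ← ENNReal.ofReal_mul, mul_right_comm _ (k b), ← ENNReal.ofReal_mul hE]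
    · congr 2
      rw [evenWeight, mul_sub, Real.exp_sub]
      field_simp
    · unfold evenWeight; positivity
  rw [setLIntegral_congr_fun (measurableSet_interlaceBox _) h2, lintegral_const_mul'',
    lintegral_vand_mul_interlaceBox hb.1 hb.2, mul_right_comm, ← ENNReal.ofReal_mul hE]
  · congr 2
    rw [oddWeight]
    ring
  · fun_prop

/-- From odd to even size. As the weight of the node `0` is `∏ b / ∏ a`, all the powers of `∏ a`
cancel as well. -/
lemma HasSpectralDensity.even {p : ℕ} {Z : ℝ} (hZ : 0 ≤ Z)
    (H : HasSpectralDensity (2 * p + 1) p 1 fun a => Z * oddWeight a) :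
    HasSpectralDensity (2 * p + 1 + 1) (p + 1) 0
      fun b => (Z * √(2 / Real.pi) * 2 ^ p / p.factorial) * evenWeight b := by
  intro h k hh hk hhk
  have hvm := measurable_vand (p := p)
  have hvm' := measurable_vand (p := p + 1)
  have hom := measurable_oddWeight (p := p)
  set φ : (Fin p → ℝ) → (Fin (p + 1) → ℝ) → ℝ≥0∞ := fun a b =>
    ENNReal.ofReal (vand b / ((∏ i, a i) * vand a) * (√(2 / Real.pi) *
      ((∏ i, b i) / ∏ i, a i) ^ (-(1 / 2) : ℝ) *
      (2 ^ p * Real.exp (-2 * (∑ i, b i - ∑ i, a i))))) * k b with hφdef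
  have hφ : Measurable (Function.uncurry φ) := by
    simp only [hφdef, Function.uncurry_def]
    fun_prop
  have hcm : Measurable fun a : Fin p → ℝ => (Fin.cons 0 a : Fin (p + 1) → ℝ) := by
    refine measurable_pi_iff.2 (Fin.cases ?_ fun i => ?_)
    · exact measurable_const
    · exact measurable_pi_apply i
  rw [lintegral_consColumn hh, H _ _ (measurable_lintegral_consColumn hh)
    (measurable_setLIntegral_interlaceSet hcm hφ)
    (fun x a ha hχ => lintegral_borderSkew_odd ha hχ hh hk hhk)]
  have h1 : ∀ a, ENNReal.ofReal (Z * oddWeight a) *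
      ∫⁻ b in interlaceSet (Fin.cons 0 a : Fin (p + 1) → ℝ), φ a b =
      ∫⁻ b in interlaceSet (Fin.cons 0 a : Fin (p + 1) → ℝ),
        ENNReal.ofReal (Z * oddWeight a) * φ a b := fun a =>
    (lintegral_const_mul' _ _ ENNReal.ofReal_ne_top).symm
  simp only [h1]
  -- the old sequence becomes the inner variable of integration
  rw [setLIntegral_setLIntegral_swap (φ := fun a b => ENNReal.ofReal (Z * oddWeight a) * φ a b)
    (measurableSet_openCone p) (measurableSet_openCone (p + 1))
    (fun a => (isOpen_interlaceSet _).measurableSet) (fun b => measurableSet_interlaceBox _)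
    (measurableSet_interlace hcm) openCone_interlace_cons_iff
    (((hom.const_mul Z).comp measurable_fst).ennreal_ofReal.mul hφ)]
  refine setLIntegral_congr_fun (measurableSet_openCone (p + 1)) fun b hb => ?_
  have hpb : 0 < ∏ i, b i := Finset.prod_pos fun i _ => hb.2 i
  have hE : 0 ≤ Z * √(2 / Real.pi) * 2 ^ p * vand b * (∏ i, b i) ^ (-(1 / 2) : ℝ) *
      Real.exp (-2 * ∑ i, b i) := by
    have := vand_pos hb.1; positivity
  have h2 : ∀ a ∈ interlaceBox b, ENNReal.ofReal (Z * oddWeight a) * φ a b =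
        (ENNReal.ofReal (Z * √(2 / Real.pi) * 2 ^ p * vand b * (∏ i, b i) ^ (-(1 / 2) : ℝ) *
          Real.exp (-2 * ∑ i, b i)) * k b) * ENNReal.ofReal (vand a) := by
    intro a ha
    have hac := ((openCone_interlace_cons_iff a b).2 ⟨hb, ha⟩).1
    have hva := vand_pos hac.1
    have hpa : 0 < ∏ i, a i := Finset.prod_pos fun i _ => hac.2 i
    have hpow : ∏ i, a i ^ (1 / 2 : ℝ) = (∏ i, a i) ^ (1 / 2 : ℝ) :=
      Real.finsetProd_rpow _ _ (fun i _ => (hac.2 i).le) _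
    have hhalf : (∏ i, a i) ^ (1 / 2 : ℝ) * (∏ i, a i) ^ (1 / 2 : ℝ) = ∏ i, a i := by
      rw [← Real.rpow_add hpa]; norm_num
    rw [hφdef, ← mul_assoc, ← ENNReal.ofReal_mul, mul_right_comm _ (k b), ← ENNReal.ofReal_mul hE]
    · congr 2
      rw [oddWeight, mul_sub, Real.exp_sub, hpow, Real.div_rpow hpb.le hpa.le,
        Real.rpow_neg hpa.le]
      have := Real.rpow_pos_of_pos hpa (1 / 2)
      generalize (∏ i, a i) ^ (1 / 2 : ℝ) = r at *
      rw [← hhalf]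
      field_simp
    · unfold oddWeight
      rw [hpow]
      positivity
  rw [setLIntegral_congr_fun (measurableSet_interlaceBox _) h2, lintegral_const_mul'',
    lintegral_vand_interlaceBox hb.1.monotone, mul_right_comm, ← ENNReal.ofReal_mul hE]
  · congr 2
    rw [evenWeight, Real.finsetProd_rpow _ _ (fun i _ => (hb.2 i).le)]
    ring
  · fun_prop

/-- The normalization constant of the density for even size. -/
noncomputable def evenNorm : ℕ → ℝ
  | 0 => 1
  | p + 1 => evenNorm p * 2 ^ p / (∏ j : Fin p, ((j : ℝ) + 1 / 2)) * √(2 / Real.pi) * 2 ^ p /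
      p.factorial

/-- The normalization constant of the density for odd size. -/
noncomputable def oddNorm (p : ℕ) : ℝ := evenNorm p * 2 ^ p / ∏ j : Fin p, ((j : ℝ) + 1 / 2)

lemma evenNorm_nonneg (p : ℕ) : 0 ≤ evenNorm p := by
  induction p with
  | zero => exact zero_le_one
  | succ p ih => rw [evenNorm]; positivity

lemma hasSpectralDensity_even (p : ℕ) :
    HasSpectralDensity (2 * p) p 0 fun a => evenNorm p * evenWeight a := by
  induction p with
  | zero => simpa [evenNorm] using hasSpectralDensity_zero
  | succ p ih =>
    exact (ih.odd (evenNorm_nonneg p)).even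
      (div_nonneg (mul_nonneg (evenNorm_nonneg p) (by positivity)) (by positivity))

lemma hasSpectralDensity_odd (p : ℕ) :
    HasSpectralDensity (2 * p + 1) p 1 fun a => oddNorm p * oddWeight a :=
  (hasSpectralDensity_even p).odd (evenNorm_nonneg p)

end Induction

/-! ### The normalization constant -/

lemma prod_Ioi_succ {M : Type*} [CommMonoid M] {p : ℕ} (f : Fin (p + 1) → Fin (p + 1) → M) :
    ∏ i, ∏ j ∈ Finset.Ioi i, f i j =
      (∏ i : Fin p, ∏ j ∈ Finset.Ioi i, f i.castSucc j.castSucc) *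
        ∏ i : Fin p, f i.castSucc (Fin.last p) := by
  have hswap : ∀ {q : ℕ} (g : Fin q → Fin q → M),
      ∏ i, ∏ j ∈ Finset.Ioi i, g i j = ∏ j, ∏ i ∈ Finset.Iio j, g i j := fun g =>
    Finset.prod_comm' fun i j => by simp
  rw [hswap, hswap, Fin.prod_univ_castSucc]
  congr 1
  · refine Finset.prod_congr rfl fun j _ => ?_
    rw [Fin.Iio_castSucc, Finset.prod_map]
    rfl
  · rw [Fin.Iio_last_eq_map, Finset.prod_map]
    rfl

/-- The factors with `j = p` in the product that defines `densityConst`, after a shift of indices.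
-/
lemma prod_sub_mul_add (p : ℕ) :
    ∏ i : Fin p, (((p : ℝ) - (i : ℕ)) * ((p : ℝ) + (i : ℕ) + 1)) = (2 * p).factorial := by
  rw [Fin.prod_univ_eq_prod_range (fun i : ℕ => ((p : ℝ) - i) * ((p : ℝ) + i + 1)) p,
    Finset.prod_mul_distrib, ← Finset.prod_range_reflect]
  have h1 := factorial_mul_prod_Ico 0 0 p (Nat.zero_le p)
  have h2 := factorial_mul_prod_Ico p 0 p (Nat.zero_le p)
  simp only [Nat.Ico_zero_eq_range, Nat.factorial_zero, Nat.cast_one, one_mul, Nat.cast_zero,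
    zero_add, add_zero] at h1 h2
  rw [two_mul, ← h2, ← h1]
  congr 1
  refine Finset.prod_congr rfl fun i hi => ?_
  have : i + 1 ≤ p := Finset.mem_range.1 hi
  rw [Nat.sub_sub, add_comm 1 i, Nat.cast_sub this]
  push_cast
  ring

lemma prod_add_half (p : ℕ) :
    (∏ j : Fin p, ((j : ℝ) + 1 / 2)) * (4 ^ p * p.factorial) = (2 * p).factorial := by
  rw [← prod_odd_mul, show (4 : ℝ) ^ p = 2 ^ p * 2 ^ p by rw [← mul_pow]; norm_num,
    show ∏ j : Fin p, (2 * (j : ℝ) + 1) = ∏ j : Fin p, 2 * ((j : ℝ) + 1 / 2) from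
      Finset.prod_congr rfl fun j _ => by ring, Finset.prod_mul_distrib, Fin.prod_const]
  ring

lemma oddNorm_succ (p : ℕ) : oddNorm (p + 1) =
    oddNorm p * (√(2 / Real.pi) * 2 ^ (4 * p + 3) * (p + 1) / (2 * (p + 1)).factorial) := by
  rw [oddNorm, evenNorm, ← oddNorm, ← prod_add_half (p + 1), Nat.factorial_succ p]
  have h : ∏ j : Fin (p + 1), ((j : ℝ) + 1 / 2) ≠ 0 :=
    Finset.prod_ne_zero_iff.2 fun j _ => by positivity
  have h4 : (4 : ℝ) ^ (p + 1) = 2 ^ (2 * p + 2) := by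
    rw [show (4 : ℝ) = 2 ^ 2 by norm_num, ← pow_mul]; ring_nf
  rw [h4]
  push_cast
  field_simp
  ring

lemma densityConst_succ (p : ℕ) : densityConst (p + 1) =
    densityConst p * (√(2 / Real.pi) * 2 * (p + 1) / (2 * (p + 1)).factorial) := by
  rw [densityConst, densityConst, prod_Ioi_succ]
  simp only [Fin.val_castSucc, Fin.val_last]
  rw [prod_sub_mul_add]
  have h1 : (2 : ℝ) ^ (3 * ((p + 1 : ℕ) : ℝ) / 2) = 2 ^ (3 * (p : ℝ) / 2) * (2 * √2) := by
    rw [show 3 * ((p + 1 : ℕ) : ℝ) / 2 = 3 * (p : ℝ) / 2 + (1 + 1 / 2) by push_cast; ring,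
      Real.rpow_add two_pos, Real.rpow_add two_pos, Real.rpow_one, Real.sqrt_eq_rpow]
  have h2 : Real.pi ^ (((p + 1 : ℕ) : ℝ) / 2) = Real.pi ^ ((p : ℝ) / 2) * √Real.pi := by
    rw [show ((p + 1 : ℕ) : ℝ) / 2 = (p : ℝ) / 2 + 1 / 2 by push_cast; ring,
      Real.rpow_add Real.pi_pos, Real.sqrt_eq_rpow]
  rw [h1, h2, Real.sqrt_div (by norm_num), Nat.factorial_succ p]
  push_cast
  have h3 : ((2 * p).factorial : ℝ) ≠ 0 := by positivity
  have h4 := Real.sqrt_pos.2 Real.pi_pos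
  have h5 := Real.rpow_pos_of_pos Real.pi_pos ((p : ℝ) / 2)
  field_simp

/-- The constants from the induction on the size and the constant `c_p`. The power of `2` is
absorbed by the rescaling from `a` to `x`. -/
lemma oddNorm_eq (p : ℕ) : oddNorm p = densityConst p * 2 ^ (2 * p ^ 2) := by
  induction p with
  | zero => simp [oddNorm, evenNorm, densityConst]
  | succ p ih =>
    rw [oddNorm_succ, densityConst_succ, ih, show 2 * (p + 1) ^ 2 = 2 * p ^ 2 + 4 * p + 2 by ring]
    ring

/-! ### The vector of the positive eigenvalues -/

section Eigenvalues

/-- The antisymmetric Hermitian matrix with the given imaginary parts above the diagonal: `√(-1)`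
times a real antisymmetric matrix. -/
noncomputable def hermitianOf {N : ℕ} (x : UpperIdx N → ℝ) : Matrix (Fin N) (Fin N) ℂ :=
  Complex.I • (skew x).map Complex.ofRealHom

/-- An antisymmetric Hermitian matrix has purely imaginary entries. -/
lemma eq_hermitianOf {N : ℕ} {M : Matrix (Fin N) (Fin N) ℂ} (hM : Mᵀ = -M)
    (hM' : M.IsHermitian) : M = hermitianOf fun e : UpperIdx N => (M e.1.1 e.1.2).im := by
  have hre : ∀ i j, (M i j).re = 0 := by
    intro i j
    have h1 := congrFun (congrFun hM i) j
    have h2 := congrArg Complex.re (hM'.apply i j)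
    rw [Matrix.transpose_apply, Matrix.neg_apply] at h1
    rw [h1] at h2
    simp only [Complex.star_def, Complex.conj_re, Complex.neg_re] at h2
    linarith
  have hskew : ∀ i j, (M j i).im = -(M i j).im := by
    intro i j
    simpa using congrArg Complex.im (congrFun (congrFun hM i) j)
  ext i j
  apply Complex.ext
  · simp [hermitianOf, hre]
  · rcases lt_trichotomy i j with h | rfl | h
    · simp [hermitianOf, skew, h]
    · have := hskew i i
      simp [hermitianOf, skew]
      linarith
    · simp [hermitianOf, skew, h, h.not_gt, hskew i j]

open Polynomial in
/-- The characteristic polynomial of `√(-1) A` has the roots `±√(a i)` and `0`. -/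
lemma charpoly_hermitianOf {p : ℕ} {x : UpperIdx (2 * p + 1) → ℝ} {a : Fin p → ℝ}
    (ha : ∀ i, 0 < a i) (hχ : (skew x).charpoly = X ^ 1 * ∏ i, (X ^ 2 + C (a i))) :
    (hermitianOf x).charpoly = (X - C 0) * ((∏ i, (X - C ((√(a i) : ℝ) : ℂ))) *
      ∏ i, (X - C ((-√(a i) : ℝ) : ℂ))) := by
  refine Polynomial.funext fun z => ?_
  rw [Matrix.eval_charpoly]
  have h1 : Matrix.scalar (Fin (2 * p + 1)) z - hermitianOf x =
      Complex.I • (Matrix.scalar (Fin (2 * p + 1)) (-Complex.I * z) -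
        (skew x).map Complex.ofRealHom) := by
    rw [hermitianOf, smul_sub]
    congr 1
    ext i j
    by_cases h : i = j
    · subst h
      simp only [Matrix.scalar_apply, Matrix.diagonal_apply_eq, Matrix.smul_apply, smul_eq_mul]
      linear_combination z * Complex.I_mul_I
    · simp [Matrix.scalar_apply, h]
  rw [h1, Matrix.det_smul, ← Matrix.eval_charpoly, Matrix.charpoly_map, hχ, Fintype.card_fin]
  simp only [Polynomial.map_mul, Polynomial.map_pow, Polynomial.map_prod, Polynomial.map_add,
    Polynomial.map_X, Polynomial.map_C, eval_mul, eval_pow, eval_prod, eval_add, eval_sub, eval_X,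
    eval_C, sub_zero, pow_one, Complex.ofRealHom_eq_coe]
  have hprod : ∏ i, ((-Complex.I * z) ^ 2 + (a i : ℂ)) =
      (-1) ^ p * ((∏ i, (z - (√(a i) : ℝ))) * ∏ i, (z - (-√(a i) : ℝ))) := by
    rw [← Finset.prod_mul_distrib, ← Fin.prod_const p (-1 : ℂ),
      ← Finset.prod_mul_distrib]
    refine Finset.prod_congr rfl fun i _ => ?_
    have hsq : ((√(a i) : ℝ) : ℂ) ^ 2 = a i := by
      rw [← Complex.ofReal_pow, Real.sq_sqrt (ha i).le]
    push_cast
    linear_combination z ^ 2 * Complex.I_sq - hsq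
  have hone : ((-1 : ℂ) ^ p) * (-1) ^ p = 1 := by
    rw [← mul_pow]; simp
  rw [hprod, pow_succ, pow_mul, Complex.I_sq]
  generalize (∏ i, (z - (√(a i) : ℝ))) * ∏ i, (z - (-√(a i) : ℝ)) = w
  linear_combination (-Complex.I ^ 2 * z * w) * hone - z * w * Complex.I_sq

lemma positiveEigenvalueVector_hermitianOf {p : ℕ} {x : UpperIdx (2 * p + 1) → ℝ} {a : Fin p → ℝ}
    (ha : a ∈ openCone p) (hχ : (skew x).charpoly = .X ^ 1 * ∏ i, (.X ^ 2 + .C (a i))) :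
    positiveEigenvalueVector p (hermitianOf x) = WithLp.toLp 2 fun i => √(a i) := by
  have hpos : ∀ i, 0 < √(a i) := fun i => Real.sqrt_pos.2 (ha.2 i)
  have hmono : StrictMono fun i => √(a i) := fun i j hij =>
    Real.sqrt_lt_sqrt (ha.2 i).le (ha.1 hij)
  have hne : ∀ f : Fin p → ℂ, (∏ i, (Polynomial.X - Polynomial.C (f i))) ≠ 0 := fun f =>
    (Polynomial.monic_prod_of_monic _ _ fun i _ => Polynomial.monic_X_sub_C _).ne_zero
  have hroots : ((hermitianOf x).charpoly.roots.map Complex.re).filter (fun y => 0 < y) =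
      ((List.ofFn fun i => √(a i) : List ℝ) : Multiset ℝ) := by
    rw [charpoly_hermitianOf ha.2 hχ, Polynomial.roots_mul (mul_ne_zero
      (Polynomial.X_sub_C_ne_zero 0) (mul_ne_zero (hne _) (hne _))),
      Polynomial.roots_mul (mul_ne_zero (hne _) (hne _)), Polynomial.roots_X_sub_C,
      roots_prod_X_sub_C_eq_map, roots_prod_X_sub_C_eq_map, Multiset.map_add, Multiset.map_add,
      Multiset.map_map, Multiset.map_map, Multiset.filter_add, Multiset.filter_add,
      ← Fin.univ_val_map]
    have e1 : (Multiset.map Complex.re {0}).filter (fun y => 0 < y) = 0 := by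
      simp
    have e2 : (Finset.univ.val.map (Complex.re ∘ fun i : Fin p => ((√(a i) : ℝ) : ℂ))).filter
        (fun y => 0 < y) = Finset.univ.val.map fun i => √(a i) := by
      rw [Multiset.filter_eq_self.2]
      · rfl
      · intro y hy
        obtain ⟨i, -, rfl⟩ := Multiset.mem_map.1 hy
        exact hpos i
    have e3 : (Finset.univ.val.map (Complex.re ∘ fun i : Fin p => ((-√(a i) : ℝ) : ℂ))).filter
        (fun y => 0 < y) = 0 := by
      rw [Multiset.filter_eq_nil]
      intro y hy
      obtain ⟨i, -, rfl⟩ := Multiset.mem_map.1 hy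
      simp only [Function.comp_apply, Complex.ofReal_re]
      linarith [hpos i]
    rw [e1, e2, e3, zero_add, add_zero]
  have hlist : positiveEigenvalues (hermitianOf x) = List.ofFn fun i => √(a i) := by
    refine List.Perm.eq_of_pairwise' (r := (· ≤ ·)) (Multiset.pairwise_sort _ _)
      (List.pairwise_ofFn.2 fun i j hij => (hmono hij).le) ?_
    rw [← Multiset.coe_eq_coe, ← hroots, positiveEigenvalues, Multiset.sort_eq]
  rw [positiveEigenvalueVector, hlist]
  congr 1
  ext i
  rw [List.getD_eq_getElem _ _ (by simp)]
  simp

end Eigenvalues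

section Law

/-- The values at the natural numbers of the polynomial `X * ∏ i, (X ^ 2 + a i)`. A polynomial is
replaced by these values because they form a point of the Polish space `ℕ → ℝ`. -/
noncomputable def charValues {p : ℕ} (a : Fin p → ℝ) (s : ℕ) : ℝ := s * ∏ i, ((s : ℝ) ^ 2 + a i)

lemma continuous_charValues {p : ℕ} : Continuous (charValues : (Fin p → ℝ) → ℕ → ℝ) := by
  unfold charValues
  fun_prop

open Polynomial in
lemma charpoly_eq_of_eval_eq_charValues {p : ℕ} {P : ℝ[X]} {a : Fin p → ℝ}
    (h : (fun s : ℕ => P.eval (s : ℝ)) = charValues a) : P = X ^ 1 * ∏ i, (X ^ 2 + C (a i)) := by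
  refine Polynomial.eq_of_infinite_eval_eq _ _
    ((Set.infinite_range_of_injective Nat.cast_injective).mono ?_)
  rintro _ ⟨s, rfl⟩
  have := congrFun h s
  simpa [charValues, eval_prod] using this

open Polynomial in
/-- The characteristic polynomial determines the increasing sequence of its parameters. -/
lemma injOn_charValues {p : ℕ} : Set.InjOn (charValues : (Fin p → ℝ) → ℕ → ℝ) (openCone p) := by
  intro a ha b hb h
  have hne : (X ^ 1 : ℝ[X]) ≠ 0 := pow_ne_zero _ X_ne_zero
  have hab : (X ^ 1 * ∏ i, (X ^ 2 + C (a i)) : ℝ[X]) = X ^ 1 * ∏ i, (X ^ 2 + C (b i)) := by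
    refine charpoly_eq_of_eval_eq_charValues ?_
    rw [← h]
    ext s
    simp [charValues, eval_prod]
  have hab' := mul_left_cancel₀ hne hab
  -- the products agree as functions of `-s²`, hence as polynomials in this variable
  have hpoly : (∏ i, (X - C (a i)) : ℝ[X]) = ∏ i, (X - C (b i)) := by
    refine Polynomial.eq_of_infinite_eval_eq _ _ ((Set.Iic_infinite (0 : ℝ)).mono fun y hy => ?_)
    have h1 := congrArg (eval (√(-y))) hab'
    simp only [eval_prod, eval_add, eval_pow, eval_X, eval_C,
      Real.sq_sqrt (neg_nonneg.2 (Set.mem_Iic.1 hy))] at h1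
    have hneg : ∀ z : Fin p → ℝ, ∏ j, (y - z j) = (-1) ^ p * ∏ j, (-y + z j) := fun z => by
      rw [← Fin.prod_const, ← Finset.prod_mul_distrib]
      exact Finset.prod_congr rfl fun j _ => by ring
    simp only [Set.mem_ofPred_eq, eval_prod, eval_sub, eval_X, eval_C, hneg, h1]
  have hroots := congrArg roots hpoly
  rw [roots_prod_X_sub_C_eq_map, roots_prod_X_sub_C_eq_map, Fin.univ_val_map, Fin.univ_val_map,
    Multiset.coe_eq_coe] at hroots
  exact List.ofFn_injective (List.Perm.eq_of_pairwise' (r := (· ≤ ·))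
    (List.pairwise_ofFn.2 fun i j hij => (ha.1 hij).le)
    (List.pairwise_ofFn.2 fun i j hij => (hb.1 hij).le) hroots)

lemma measurable_charpoly_eval (N : ℕ) :
    Measurable fun (x : UpperIdx N → ℝ) (s : ℕ) => (skew x).charpoly.eval (s : ℝ) := by
  refine measurable_pi_iff.2 fun s => Continuous.measurable ?_
  simp only [Matrix.eval_charpoly]
  refine Continuous.matrix_det (continuous_matrix fun i j => ?_)
  simp only [Matrix.sub_apply, skew, Matrix.of_apply]
  refine continuous_const.sub ?_
  split_ifs <;> fun_prop

/-- The vector of the positive eigenvalues is almost surely a measurable function of the entries,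
and its law has a density with respect to the squares of the eigenvalues. -/
lemma aemeasurable_and_lintegral_positiveEigenvalueVector (p : ℕ) :
    AEMeasurable (fun x : UpperIdx (2 * p + 1) → ℝ => positiveEigenvalueVector p (hermitianOf x))
      (Measure.pi fun _ => entryLaw) ∧
    ∀ f : EuclideanSpace ℝ (Fin p) → ℝ≥0∞, Measurable f →
      ∫⁻ x : UpperIdx (2 * p + 1) → ℝ, f (positiveEigenvalueVector p (hermitianOf x))
          ∂(Measure.pi fun _ => entryLaw) =
        ∫⁻ a in openCone p, ENNReal.ofReal (oddNorm p * oddWeight a) *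
          f (WithLp.toLp 2 fun i => √(a i)) := by
  set Ψ := fun (x : UpperIdx (2 * p + 1) → ℝ) (s : ℕ) => (skew x).charpoly.eval (s : ℝ) with hΨ
  have hΨm : Measurable Ψ := measurable_charpoly_eval _
  have hdens := hasSpectralDensity_odd p
  have hemb : MeasurableEmbedding ((openCone p).domRestrict (charValues (p := p))) :=
    ContinuousOn.measurableEmbedding (measurableSet_openCone p)
      continuous_charValues.continuousOn injOn_charValues
  have hval : ∀ x : UpperIdx (2 * p + 1) → ℝ, ∀ a : Fin p → ℝ,
      (skew x).charpoly = .X ^ 1 * ∏ i, (.X ^ 2 + .C (a i)) → Ψ x = charValues a := by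
    intro x a hχ
    ext s
    simp [hΨ, hχ, charValues, Polynomial.eval_prod]
  -- `L` recovers the vector of square roots from the values of the characteristic polynomial
  let r : (Fin p → ℝ) → EuclideanSpace ℝ (Fin p) := fun a => WithLp.toLp 2 fun i => √(a i)
  have hr : Measurable r := by fun_prop
  let L : (ℕ → ℝ) → EuclideanSpace ℝ (Fin p) :=
    Function.extend ((openCone p).domRestrict (charValues (p := p))) (fun a => r a) 0
  have hL : Measurable L :=
    hemb.measurable_extend (hr.comp measurable_subtype_coe) measurable_zero
  have hLv : ∀ a ∈ openCone p, L (charValues a) = r a := fun a ha =>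
    hemb.injective.extend_apply _ _ (⟨a, ha⟩ : openCone p)
  -- the density has total mass one, and so the characteristic polynomial almost surely has the form
  -- `X * ∏ i, (X ^ 2 + a i)` with `a` in the open cone
  have hG : MeasurableSet (Ψ ⁻¹' (charValues '' openCone p)) :=
    hΨm ((measurableSet_openCone p).image_of_continuousOn_injOn
      continuous_charValues.continuousOn injOn_charValues)
  have hGae : ∀ᵐ x ∂(Measure.pi fun _ => entryLaw), Ψ x ∈ charValues '' openCone p := by
    have h1 := hdens (fun _ => 1) (fun _ => 1) measurable_const measurable_const
      fun _ _ _ _ => rfl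
    have h2 := hdens ((Ψ ⁻¹' (charValues '' openCone p)).indicator 1) (fun _ => 1)
      (measurable_one.indicator hG) measurable_const fun x a ha hχ =>
        Set.indicator_of_mem (by exact ⟨a, ha, (hval x a hχ).symm⟩) _
    rw [← h1, lintegral_indicator_one hG, lintegral_one, measure_univ] at h2
    exact (prob_compl_eq_zero_iff hG).2 h2
  have hae : (fun x => L (Ψ x)) =ᵐ[Measure.pi fun _ => entryLaw]
      fun x => positiveEigenvalueVector p (hermitianOf x) := by
    filter_upwards [hGae] with x hx
    obtain ⟨a, ha, hax⟩ := hx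
    rw [← hax, hLv a ha,
      positiveEigenvalueVector_hermitianOf ha (charpoly_eq_of_eval_eq_charValues hax.symm)]
  refine ⟨⟨_, hL.comp hΨm, hae.symm⟩, fun f hf => ?_⟩
  rw [← hdens (fun x => f (L (Ψ x))) (fun a => f (r a)) (hf.comp (hL.comp hΨm)) (hf.comp hr)
    fun x a ha hχ => by rw [hval x a hχ, hLv a ha]]
  refine lintegral_congr_ae ?_
  filter_upwards [hae] with x hx
  rw [hx]

end Law

/-! ### The law of the rescaled vector of positive eigenvalues -/

section Rescaled

variable {p : ℕ}

lemma image_sq_div_openCone {σ : ℝ} (hσ : 0 < σ) :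
    (fun (x : Fin p → ℝ) i => (x i / σ) ^ 2) '' openCone p = openCone p := by
  ext a
  constructor
  · rintro ⟨x, hx, rfl⟩
    refine ⟨fun i j hij => ?_, fun i => pow_pos (div_pos (hx.2 i) hσ) 2⟩
    have h1 := div_lt_div_of_pos_right (hx.1 hij) hσ
    exact pow_lt_pow_left₀ h1 (div_pos (hx.2 i) hσ).le two_ne_zero
  · intro ha
    refine ⟨fun i => σ * √(a i), ⟨fun i j hij => ?_, fun i => ?_⟩, ?_⟩
    · exact mul_lt_mul_of_pos_left (Real.sqrt_lt_sqrt (ha.2 i).le (ha.1 hij)) hσ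
    · exact mul_pos hσ (Real.sqrt_pos.2 (ha.2 i))
    · ext i
      beta_reduce
      rw [mul_div_cancel_left₀ _ hσ.ne', Real.sq_sqrt (ha.2 i).le]

/-- The change of variables `a = (x / σ) ^ 2`, coordinate by coordinate. -/
lemma lintegral_openCone_comp_sq {σ : ℝ} (hσ : 0 < σ) (F : (Fin p → ℝ) → ℝ≥0∞) :
    ∫⁻ a in openCone p, F a = ∫⁻ x in openCone p,
      ENNReal.ofReal (∏ i, 2 * x i / σ ^ 2) * F fun i => (x i / σ) ^ 2 := by
  have hder : ∀ x ∈ openCone p, HasFDerivWithinAt (fun (x : Fin p → ℝ) i => (x i / σ) ^ 2)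
      (ContinuousLinearMap.pi fun i => ((2 * x i / σ ^ 2) • ContinuousLinearMap.id ℝ ℝ) ∘L
        ContinuousLinearMap.proj i) (openCone p) x := by
    intro x _
    refine HasFDerivAt.hasFDerivWithinAt (hasFDerivAt_pi.2 fun i => ?_)
    have h1 : HasDerivAt (fun y : ℝ => (y / σ) ^ 2) (2 * x i / σ ^ 2) (x i) := by
      refine (((hasDerivAt_id' (x i)).div_const σ).fun_pow 2).congr_deriv ?_
      norm_num
      field_simp
    refine (h1.hasFDerivAt.comp x (ContinuousLinearMap.proj (R := ℝ) i).hasFDerivAt).congr_fderiv ?_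
    ext v
    simp [mul_comm]
  have hinj : Set.InjOn (fun (x : Fin p → ℝ) i => (x i / σ) ^ 2) (openCone p) := by
    intro x hx y hy h
    ext i
    have h1 := (sq_eq_sq₀ (div_pos (hx.2 i) hσ).le (div_pos (hy.2 i) hσ).le).1 (congrFun h i)
    exact (div_left_inj' hσ.ne').1 h1
  conv_lhs => rw [← image_sq_div_openCone hσ]
  rw [lintegral_image_eq_lintegral_abs_det_fderiv_mul volume (measurableSet_openCone p) hder hinj]
  refine setLIntegral_congr_fun (measurableSet_openCone p) fun x hx => ?_
  have hpos : 0 ≤ ∏ i, 2 * x i / σ ^ 2 := Finset.prod_nonneg fun i _ => by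
    have := hx.2 i; positivity
  rw [ContinuousLinearMap.det_pi, ← abs_of_nonneg hpos]
  simp

/-- The density of the rescaled vector, with the Jacobian of the rescaling, is the limit density of
the watermelon. -/
lemma oddWeight_mul_eq_density {t : ℝ} (ht0 : 0 < t) (ht1 : t < 1) {x : Fin p → ℝ}
    (hx : x ∈ openCone p) :
    (∏ i, 2 * x i / (2 * √(t * (1 - t))) ^ 2) *
      (oddNorm p * oddWeight fun i => (x i / (2 * √(t * (1 - t)))) ^ 2) =
      density p t (WithLp.toLp 2 x) := by
  have hτ : 0 < t * (1 - t) := mul_pos ht0 (sub_pos.2 ht1)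
  rw [density, if_pos ⟨fun i => (hx.2 i).le, fun i j hij => hx.1.monotone hij⟩,
    EuclideanSpace.real_norm_sq_eq, show 2 * t * (1 - t) = 2 * (t * (1 - t)) by ring,
    ← starNorm_eq_rpow p hτ, starNorm, oddNorm_eq, oddWeight]
  generalize t * (1 - t) = τ at hτ ⊢
  have hs : 0 < √τ := Real.sqrt_pos.2 hτ
  have hsq : √τ ^ 2 = τ := Real.sq_sqrt hτ.le
  have h1 : ∏ i, ((x i / (2 * √τ)) ^ 2) ^ (1 / 2 : ℝ) = (∏ i, x i) / (2 * √τ) ^ p := by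
    rw [← Fin.prod_const, ← Finset.prod_div_distrib]
    refine Finset.prod_congr rfl fun i _ => ?_
    rw [← Real.sqrt_eq_rpow, Real.sqrt_sq (div_nonneg (hx.2 i).le (by positivity))]
  have h2 : ∏ i, 2 * x i / (2 * √τ) ^ 2 = 2 ^ p * (∏ i, x i) / ((2 * √τ) ^ 2) ^ p := by
    rw [Finset.prod_div_distrib, Finset.prod_mul_distrib, Fin.prod_const, Fin.prod_const]
  have h3 : vand (fun i => (x i / (2 * √τ)) ^ 2) ^ 2 * (4 * τ) ^ (p ^ 2) =
      (4 * τ) ^ p * ∏ i, ∏ j ∈ Finset.Ioi i, (x j ^ 2 - x i ^ 2) ^ 2 := by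
    rw [← prod_Ioi_const_sq_mul p (4 * τ), ← mul_assoc, ← mul_pow, vand,
      mul_comm ((4 * τ) ^ p)]
    simp only [← Finset.prod_mul_distrib, ← Finset.prod_pow]
    congr 1
    refine Finset.prod_congr rfl fun i _ => Finset.prod_congr rfl fun j _ => ?_
    rw [div_pow, div_pow, mul_pow 2, hsq]
    field_simp
    ring
  have h4 : -2 * ∑ i, (x i / (2 * √τ)) ^ 2 = -(∑ i, x i ^ 2) / (2 * τ) := by
    simp only [div_pow, mul_pow, hsq]
    rw [← Finset.sum_div]
    field_simp
  have h5 := eq_div_of_mul_eq (by positivity) h3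
  rw [h1, h2, h4, h5, mul_pow 2, hsq, pow_mul 2 2, Finset.prod_pow]
  simp only [mul_pow, ← pow_mul]
  field_simp
  rw [pow_mul 2 2 p, pow_mul 2 2 (p ^ 2)]
  norm_num
  ring

lemma lintegral_openCone_eq_lintegral_density {t : ℝ} (ht0 : 0 < t) (ht1 : t < 1)
    (f : EuclideanSpace ℝ (Fin p) → ℝ≥0∞) :
    ∫⁻ a in openCone p, ENNReal.ofReal (oddNorm p * oddWeight a) *
      f ((2 * √(t * (1 - t))) • WithLp.toLp 2 fun i => √(a i)) =
    ∫⁻ x, ENNReal.ofReal (density p t x) * f x := by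
  have hσ : 0 < 2 * √(t * (1 - t)) :=
    mul_pos two_pos (Real.sqrt_pos.2 (mul_pos ht0 (sub_pos.2 ht1)))
  rw [← (PiLp.volume_preserving_toLp (Fin p)).lintegral_comp_emb
    (MeasurableEquiv.toLp 2 (Fin p → ℝ)).measurableEmbedding, lintegral_openCone_comp_sq hσ,
    ← lintegral_indicator (measurableSet_openCone p)]
  refine lintegral_congr fun x => ?_
  by_cases hx : x ∈ openCone p
  · rw [Set.indicator_of_mem hx, ← oddWeight_mul_eq_density ht0 ht1 hx, ENNReal.ofReal_mul
      (Finset.prod_nonneg fun i _ => div_nonneg (mul_nonneg zero_le_two (hx.2 i).le) (sq_nonneg _)),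
      mul_assoc]
    congr 3
    ext i
    simp only [PiLp.smul_apply, smul_eq_mul]
    rw [Real.sqrt_sq (div_nonneg (hx.2 i).le hσ.le), mul_div_cancel₀ _ hσ.ne']
  · rw [Set.indicator_of_notMem hx]
    have : density p t (WithLp.toLp 2 x) = 0 := by
      by_contra h
      obtain ⟨h1, h2⟩ := pos_and_lt_of_density_ne_zero h
      exact hx ⟨fun i j hij => h2 i j hij, h1⟩
    rw [this, ENNReal.ofReal_zero, zero_mul]

variable {Ω : Type*} [MeasurableSpace Ω] {Q : Measure Ω}
  {H : Ω → Matrix (Fin (2 * p + 1)) (Fin (2 * p + 1)) ℂ}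

/-- The imaginary parts of the entries above the diagonal form a Gaussian vector with independent
coordinates. -/
lemma IsGaussianAntisymmetricHermitian.hasLaw (hH : IsGaussianAntisymmetricHermitian H Q) :
    HasLaw (fun ω (e : UpperIdx (2 * p + 1)) => (H ω e.1.1 e.1.2).im)
      (Measure.pi fun _ => entryLaw) Q where
  aemeasurable := aemeasurable_pi_lambda _ fun e => (hH.law _ _ e.2).aemeasurable
  map_eq := by
    rw [hH.indep.map_fun_eq_pi_map fun e => (hH.law _ _ e.2).aemeasurable]
    congr 1
    ext1 e
    exact (hH.law _ _ e.2).map_eq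

lemma hasLaw_smul_positiveEigenvalueVector (hH : IsGaussianAntisymmetricHermitian H Q) {t : ℝ}
    (ht0 : 0 < t) (ht1 : t < 1) :
    HasLaw (fun ω => (2 * √(t * (1 - t))) • positiveEigenvalueVector p (H ω))
      (volume.withDensity fun x => ENNReal.ofReal (density p t x)) Q := by
  obtain ⟨hV, hVlaw⟩ := aemeasurable_and_lintegral_positiveEigenvalueVector p
  have hX := hH.hasLaw
  have heq : ∀ ω, H ω = hermitianOf fun e : UpperIdx (2 * p + 1) => (H ω e.1.1 e.1.2).im :=
    fun ω => eq_hermitianOf (hH.antisymmetric ω) (hH.hermitian ω)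
  have hlaw : HasLaw (fun x : UpperIdx (2 * p + 1) → ℝ =>
      (2 * √(t * (1 - t))) • positiveEigenvalueVector p (hermitianOf x))
      (volume.withDensity fun x => ENNReal.ofReal (density p t x))
      (Measure.pi fun _ => entryLaw) := by
    have hV' : AEMeasurable (fun x : UpperIdx (2 * p + 1) → ℝ =>
        (2 * √(t * (1 - t))) • positiveEigenvalueVector p (hermitianOf x))
        (Measure.pi fun _ => entryLaw) := hV.const_smul (2 * √(t * (1 - t)))
    refine ⟨hV', ?_⟩
    ext s hs
    have hf : Measurable fun x : EuclideanSpace ℝ (Fin p) =>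
        s.indicator (1 : EuclideanSpace ℝ (Fin p) → ℝ≥0∞) ((2 * √(t * (1 - t))) • x) :=
      (measurable_one.indicator hs).comp (measurable_const_smul _)
    rw [← lintegral_indicator_one hs, lintegral_map' (measurable_one.indicator hs).aemeasurable
      hV', hVlaw _ hf, lintegral_openCone_eq_lintegral_density ht0 ht1,
      withDensity_apply _ hs, ← lintegral_indicator hs]
    refine lintegral_congr fun x => ?_
    by_cases hx : x ∈ s <;> simp [hx]
  have h := hlaw.comp hX
  refine h.congr (ae_of_all _ fun ω => ?_)
  simp only [Function.comp_apply]
  rw [← heq]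

end Rescaled

end Watermelon

theorem mainTheorem8 (p : ℕ) (hp : 1 ≤ p)
    -- for every `n`, a uniformly distributed watermelon `W n` with `p` branches and length `2n`
    {Ω : ℕ → Type*} [∀ n, MeasurableSpace (Ω n)] (P : ∀ n, Measure (Ω n))
    [∀ n, IsProbabilityMeasure (P n)]
    (W : ∀ n, Ω n → Fin (2 * n + 1) → Fin p → ℤ)
    (hW : ∀ n, HasLaw (W n) (uniformOn (Watermelon.watermelons p (2 * n))) (P n))
    -- a Gaussian antisymmetric Hermitian matrix `H` of size `2p + 1`
    {Ω' : Type*} [MeasurableSpace Ω'] (Q : Measure Ω') [IsProbabilityMeasure Q]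
    (H : Ω' → Matrix (Fin (2 * p + 1)) (Fin (2 * p + 1)) ℂ)
    (hH : Watermelon.IsGaussianAntisymmetricHermitian H Q)
    (t : unitInterval) :
    TendstoInDistribution (fun n ω => Watermelon.renormalize (W n ω) t) atTop
      (fun ω => (2 * √((t : ℝ) * (1 - (t : ℝ)))) • Watermelon.positiveEigenvalueVector p (H ω))
      P Q ∧
    (0 < (t : ℝ) → (t : ℝ) < 1 →
      HasLaw
        (fun ω => (2 * √((t : ℝ) * (1 - (t : ℝ)))) • Watermelon.positiveEigenvalueVector p (H ω))
        (volume.withDensity fun x => ENNReal.ofReal (Watermelon.density p (t : ℝ) x)) Q) := by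
  by_cases h : 0 < (t : ℝ) ∧ (t : ℝ) < 1
  · have hZ := Watermelon.hasLaw_smul_positiveEigenvalueVector hH h.1 h.2
    exact ⟨Watermelon.tendstoInDistribution_renormalize hp P W hW Q t h.1 h.2 hZ,
      fun _ _ => hZ⟩
  · have ht : t = 0 ∨ t = 1 := by
      rw [not_and_or, not_lt, not_lt] at h
      exact h.imp (fun h0 => Subtype.ext (le_antisymm h0 t.2.1))
        fun h1 => Subtype.ext (le_antisymm t.2.2 h1)
    -- the scaling factor is zero at the end points, and so the limit is the constant `0`
    have hzero : 2 * √((t : ℝ) * (1 - (t : ℝ))) = 0 := by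
      rcases ht with rfl | rfl <;> simp
    simp only [hzero, zero_smul]
    exact ⟨Watermelon.tendstoInDistribution_renormalize_endpoint P W hW Q t ht,
      fun h0 h1 => absurd ⟨h0, h1⟩ h⟩
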